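/- **Theorem (Concatenation of manifolds).** Let $1<k<d$ be integers. Cells of the cubical lattice $\mathbb Z^d$ are located by their centres: a $j$-cell $c$ has exactly $j$ half-integer coordinates, $\mathrm{HalfInt}(c)$ is the set of these dimensions, and $c$ *neighbours* the $(j-1)$-cells $c\pm\frac12 e_i$, $i\in\mathrm{HalfInt}(c)$. All configurations below are taken up to translation by $\mathbb Z^d$. * $\mathrm{XD}_n$: nonempty sets of $n$ $k$-faces that are connected, where two faces are linked if they neighbour a common $(k-1)$-edge. * $\mathrm{SAM}_n$: those elements of $\mathrm{XD}_n$ in which every $(k-1)$-edge is neighboured by at most two faces. $\mathrm{SAM}_n(h)$: those whose boundary (the set of $(k-1)$-edges neighboured by exactly one face, two of them being linked if they neighbour a common $(k-2)$-cell) has exactly $h$ connected components. * $\mathrm{SOM}_n$: sets of $n$ $k$-faces together with connections: at each $(k-1)$-edge $g$ the faces neighbouring $g$ are paired off, with one lone face if their number is odd; the configuration must be nonempty and connected through these connections; and if more than two faces neighbour $g$, the *osculating condition* holds at $g$. With $e_f$ denoting the unit vector from the centre of $g$ to that of $f$, this condition says that for any two different pairs $\{f_1,f_2\}$, $\{f_3,f_4\}$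 at $g$ the vectors $e_{f_1},\dots,e_{f_4}$ are distinct, and if $e_{f_1}=-e_{f_2}$ then $e_{f_3}\perp e_{f_4}$; if the number of faces at $g$ is odd, it is required that the lone face can be paired with some unoccupied lattice $k$-face neighbouring $g$ so that this holds. Let $A$, $B$ be finite sets of $k$-faces (representatives placed in the lattice), let $a$ be the lexicographically largest face of $A$ and $b$ the lexicographically smallest face of $B$, where $a_1<b_1$. Call a set of faces $C$ a *concatenation* of $A$ and $B$ if $C$ is obtained from the mod-2 sum of $A$ and $B$ by adding, mod 2, the boundaries of a finite set of $(k+1)$-cubes and a set of single $k$-faces, the latter consisting of $2k$ faces for each of $a$, $b$ that has dimension $1$ among its half-integer dimensions (in particular only boundaries of cubes are added if neither has), such that every face of the total added mod-2 chain other than $a$ and $b$ has first coordinate strictly between $a_1$ and $b_1$. For faces with connections, it is required in addition that the connections of $A$ (respectively $B$) are kept at every $(k-1)$-edge whose neighbouring faces are the same in $C$ as in $A$ (respectively $B$). Put $N=n+m+2(k^2+3k-1)$. There are a map $\Phi$ on pairs of translation classes of finite sets of faces and a map $\Psi$ on pairs of translation classes of finite sets of faces with connections such that for all $n,m,h,g\ge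 0$ they restrict to injections $$\Phi:\mathrm{SAM}_n(h)\times\mathrm{SAM}_m(g)\rightarrowtail\mathrm{SAM}_{N}(h+g),\qquad \Phi:\mathrm{XD}_n\times\mathrm{XD}_m\rightarrowtail\mathrm{XD}_{N},\qquad \Psi:\mathrm{SOM}_n\times\mathrm{SOM}_m\rightarrowtail\mathrm{SOM}_{N};$$ on these sets the value of $\Phi$ or $\Psi$ is always a concatenation of (suitably placed representatives of) its two arguments; and whenever the underlying face sets of both arguments of $\Psi$ in $\mathrm{SOM}_n\times\mathrm{SOM}_m$ are self-avoiding, the underlying face set of the value of $\Psi$ is the value of $\Phi$ on those face sets. Consequently the numbers of configurations are pseudo-superadditive: $c_n(h)\,c_m(g)\le c_{N}(h+g)$ for SAMs, where $c_n(h)=|\mathrm{SAM}_n(h)|$, and $c_n c_m\le c_{N}$ for SAMs, SOMs and XDs, where $c_n$ is the cardinality of $\mathrm{SAM}_n$, $\mathrm{SOM}_n$, $\mathrm{XD}_n$ respectively. -/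

import Mathlib

open Finset

/-- A cell of the cubical lattice `ℤ^d`, given by its centre coordinates **multiplied by two**: the
cell with centre `c/2` is a unit cube spanning exactly the dimensions `i` in which `c i` is odd
(that is, in which the centre coordinate is a half-integer). -/
abbrev Cell (d : ℕ) := Fin d → ℤ

namespace Cell

variable {d : ℕ}

/-- The half-integer dimensions (orientations) of a cell. -/
def halfInt (c : Cell d) : Finset (Fin d) := univ.filter fun i => Odd (c i)

/-- The dimension of a cell. -/
def dim (c : Cell d) : ℕ := c.halfInt.card

/-- The cells of one dimension less on the boundary of `c`, centred at `c ± ½ j` for the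
half-integer dimensions `j` of `c`. We say that `c` *neighbours* them. -/
def facets (c : Cell d) : Finset (Cell d) :=
  c.halfInt.biUnion fun j => {c + Pi.single j 1, c - Pi.single j 1}

/-- The translate of a cell by an integer vector (doubled coordinates). -/
def translate (v : Fin d → ℤ) (c : Cell d) : Cell d := c + 2 • v

/-- A cell is vertical if the first dimension is one of its half-integer dimensions. -/
def Vertical [NeZero d] (c : Cell d) : Prop := Odd (c 0)

instance [NeZero d] (c : Cell d) : Decidable c.Vertical :=
  inferInstanceAs (Decidable (Odd (c 0)))

lemma translate_zero (c : Cell d) : translate 0 c = c := by simp [translate]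

lemma translate_translate (v w : Fin d → ℤ) (c : Cell d) :
    translate w (translate v c) = translate (v + w) c := by
  simp [translate, add_assoc]

end Cell

section FaceSets

variable {d : ℕ}

/-- The cells of `S` that neighbour the cell `g`. -/
def cofaces (S : Finset (Cell d)) (g : Cell d) : Finset (Cell d) :=
  S.filter fun f => g ∈ f.facets

/-- `S` is nonempty and any two of its elements are joined by a chain in `S` whose consecutive
elements are related by `R`. -/
def IsConnectedVia (S : Finset (Cell d)) (R : Cell d → Cell d → Prop) : Prop :=
  S.Nonempty ∧ ∀ a ∈ S, ∀ b ∈ S,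
    Relation.ReflTransGen (fun x y => x ∈ S ∧ y ∈ S ∧ R x y) a b

/-- Two cells neighbour a common cell of one dimension less. -/
def ShareFacet (f f' : Cell d) : Prop := ∃ g, g ∈ f.facets ∧ g ∈ f'.facets

/-- A fixed `(d,k)`-polyominoid with `n` faces. -/
structure IsXD (k n : ℕ) (S : Finset (Cell d)) : Prop where
  dim_eq : ∀ f ∈ S, f.dim = k
  card_eq : S.card = n
  connected : IsConnectedVia S ShareFacet

/-- The boundary of a set of `k`-faces: the `(k-1)`-edges neighboured by exactly one face. -/
def boundary (S : Finset (Cell d)) : Finset (Cell d) :=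
  (S.biUnion Cell.facets).filter fun g => (cofaces S g).card = 1

/-- The boundary `(k-1)`-edges, two of them being adjacent if they neighbour a common
`(k-2)`-cell. -/
def boundaryGraph (S : Finset (Cell d)) : SimpleGraph (boundary S) :=
  SimpleGraph.fromRel fun g g' => ShareFacet g.1 g'.1

/-- The number of connected components of the boundary. -/
noncomputable def numBoundaryComponents (S : Finset (Cell d)) : ℕ :=
  Nat.card (boundaryGraph S).ConnectedComponent

/-- A self-avoiding `k`-manifold with `n` faces. -/
structure IsSAM (k n : ℕ) (S : Finset (Cell d)) : Prop extends IsXD k n S where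
  selfAvoiding : ∀ g, (cofaces S g).card ≤ 2

/-- Finite sets of cells are identified up to integer translation. -/
instance faceSetoid (d : ℕ) : Setoid (Finset (Cell d)) where
  r S T := ∃ v : Fin d → ℤ, T = S.image (Cell.translate v)
  iseqv :=
    { refl := fun S => ⟨0, by
        have : Cell.translate (0 : Fin d → ℤ) = id := funext Cell.translate_zero
        simp [this]⟩
      symm := by
        rintro S _ ⟨v, rfl⟩
        refine ⟨-v, ?_⟩
        have : Cell.translate (-v) ∘ Cell.translate v = id := by
          funext c; simp [Cell.translate_translate, Cell.translate_zero]
        simp [Finset.image_image, this]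
      trans := by
        rintro S _ _ ⟨v, rfl⟩ ⟨w, rfl⟩
        refine ⟨v + w, ?_⟩
        have : Cell.translate w ∘ Cell.translate v = Cell.translate (v + w) := by
          funext c; simp [Cell.translate_translate]
        simp [Finset.image_image, this] }

/-- Translation classes of finite sets of cells. -/
abbrev FaceClass (d : ℕ) := Quotient (faceSetoid d)

/-- Translation classes of `(d,k)`-polyominoids with `n` faces. -/
def XD (d k n : ℕ) : Set (FaceClass d) :=
  {X | ∃ S : Finset (Cell d), X = ⟦S⟧ ∧ IsXD k n S}

/-- Translation classes of self-avoiding manifolds with `n` faces. -/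
def SAM (d k n : ℕ) : Set (FaceClass d) :=
  {X | ∃ S : Finset (Cell d), X = ⟦S⟧ ∧ IsSAM k n S}

/-- Translation classes of self-avoiding manifolds with `n` faces and `h` boundary components. -/
def SAMh (d k n h : ℕ) : Set (FaceClass d) :=
  {X | ∃ S : Finset (Cell d), X = ⟦S⟧ ∧ IsSAM k n S ∧ numBoundaryComponents S = h}

end FaceSets

section Osculating

/-- A finite set of faces together with a finite set of connections (unordered pairs of faces). -/
@[ext] structure LinkedFaces (d : ℕ) where
  faces : Finset (Cell d)
  links : Finset (Sym2 (Cell d))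

namespace LinkedFaces

variable {d : ℕ}

/-- The connections of `X` at the hyperedge `g`. -/
def linksAt (X : LinkedFaces d) (g : Cell d) : Finset (Sym2 (Cell d)) :=
  X.links.filter fun p => ∀ f ∈ p.toFinset, g ∈ f.facets

/-- The faces of `X` that neighbour `g` and are in no connection at `g`. -/
def loneAt (X : LinkedFaces d) (g : Cell d) : Finset (Cell d) :=
  (cofaces X.faces g).filter fun f => ∀ p ∈ X.linksAt g, f ∉ p

/-- The osculating condition for a set `P` of pairs of faces neighbouring the hyperedge `g`. For a
neighbouring face `f` (in doubled coordinates) `f - g` is the unit vector from the centre of `g`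
towards the centre of `f`. -/
def PairsOsculate (g : Cell d) (P : Finset (Sym2 (Cell d))) : Prop :=
  ∀ f₁ f₂ f₃ f₄ : Cell d, s(f₁, f₂) ∈ P → s(f₃, f₄) ∈ P → s(f₁, f₂) ≠ s(f₃, f₄) →
    [f₁ - g, f₂ - g, f₃ - g, f₄ - g].Nodup ∧
      (f₁ - g = -(f₂ - g) → (f₃ - g) ⬝ᵥ (f₄ - g) = 0)

/-- The osculating condition at a hyperedge `g`. If the number of faces at `g` is odd, it must be
possible to pair the lone face with a further (unoccupied) lattice face neighbouring `g`. -/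
def OsculatesAt (X : LinkedFaces d) (g : Cell d) : Prop :=
  (Even (cofaces X.faces g).card → PairsOsculate g (X.linksAt g)) ∧
  (Odd (cofaces X.faces g).card → ∃ l ∈ X.loneAt g, ∃ f', g ∈ f'.facets ∧ f' ∉ X.faces ∧
    PairsOsculate g (insert s(l, f') (X.linksAt g)))

/-- A self-osculating `k`-manifold with `n` faces. At each hyperedge the connections form a
pairing of the neighbouring faces, with one lone face if their number is odd (in particular, two
faces that are alone at a hyperedge are connected). -/
structure IsSOM (k n : ℕ) (X : LinkedFaces d) : Prop where
  dim_eq : ∀ f ∈ X.faces, f.dim = k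
  card_eq : X.faces.card = n
  links_valid : ∀ p ∈ X.links, ∃ f ∈ X.faces, ∃ f' ∈ X.faces,
    f ≠ f' ∧ ShareFacet f f' ∧ p = s(f, f')
  links_disjoint : ∀ g, ∀ p ∈ X.linksAt g, ∀ q ∈ X.linksAt g, ∀ f, f ∈ p → f ∈ q → p = q
  lone_card : ∀ g, (X.loneAt g).card = (cofaces X.faces g).card % 2
  osculating : ∀ g, 2 < (cofaces X.faces g).card → X.OsculatesAt g
  connected : IsConnectedVia X.faces fun f f' => s(f, f') ∈ X.links

/-- The translate of a linked set of faces by an integer vector. -/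
def translate (v : Fin d → ℤ) (X : LinkedFaces d) : LinkedFaces d where
  faces := X.faces.image (Cell.translate v)
  links := X.links.image (Sym2.map (Cell.translate v))

lemma translate_zero (X : LinkedFaces d) : translate 0 X = X := by
  have h : Cell.translate (0 : Fin d → ℤ) = id := funext Cell.translate_zero
  ext1 <;> simp [translate, h, Sym2.map_id]

lemma translate_translate (v w : Fin d → ℤ) (X : LinkedFaces d) :
    translate w (translate v X) = translate (v + w) X := by
  have h : Cell.translate w ∘ Cell.translate v = Cell.translate (d := d) (v + w) := by
    funext c; simp [Cell.translate_translate]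
  ext1
  · simp [translate, Finset.image_image, h]
  · simp [translate, Finset.image_image, ← Sym2.map_comp, h]

/-- Linked sets of faces are identified up to integer translation. -/
instance linkedSetoid (d : ℕ) : Setoid (LinkedFaces d) where
  r X Y := ∃ v : Fin d → ℤ, Y = X.translate v
  iseqv :=
    { refl := fun X => ⟨0, (translate_zero X).symm⟩
      symm := by
        rintro X _ ⟨v, rfl⟩
        exact ⟨-v, by rw [translate_translate, add_neg_cancel, translate_zero]⟩
      trans := by
        rintro X _ _ ⟨v, rfl⟩ ⟨w, rfl⟩
        exact ⟨v + w, translate_translate v w X⟩ }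

end LinkedFaces

/-- Translation classes of linked sets of faces. -/
abbrev LinkedClass (d : ℕ) := Quotient (LinkedFaces.linkedSetoid d)

/-- The translation class of the underlying set of faces. -/
def LinkedClass.faces {d : ℕ} (X : LinkedClass d) : FaceClass d :=
  Quotient.map LinkedFaces.faces (by rintro S _ ⟨v, rfl⟩; exact ⟨v, rfl⟩) X

/-- Translation classes of self-osculating manifolds with `n` faces. -/
def SOM (d k n : ℕ) : Set (LinkedClass d) :=
  {X | ∃ S : LinkedFaces d, X = ⟦S⟧ ∧ S.IsSOM k n}

end Osculating

section Concatenation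

variable {d : ℕ}

/-- The sum mod 2 of the boundaries of the cubes in `K`. -/
def cubeBoundarySum (K : Finset (Cell d)) : Finset (Cell d) :=
  (K.biUnion Cell.facets).filter fun q => Odd (cofaces K q).card

open scoped symmDiff in
/-- `C` is a concatenation of `A` (bottom) and `B` (top). Here `a` is the lexicographically largest
face of `A` and `b` the lexicographically smallest face of `B`, and `b` lies higher than `a` in the
first dimension. `C` is obtained from `A` and `B` by adding, mod 2, the boundaries of the
`(k+1)`-cubes in `K` and `2k` single buffer `k`-faces (collected in `E`) for each of `a`, `b`
that is vertical; apart from `a` and `b`, all faces so added lie strictly between the heights of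
`a` and `b`. -/
def IsConcatenation [NeZero d] (k : ℕ) (A B C : Finset (Cell d)) : Prop :=
  ∃ a ∈ A, ∃ b ∈ B, ∃ K E : Finset (Cell d),
    (∀ f ∈ A, toLex f ≤ toLex a) ∧ (∀ f ∈ B, toLex b ≤ toLex f) ∧ a 0 < b 0 ∧
    (∀ c ∈ K, c.dim = k + 1) ∧ (∀ f ∈ E, f.dim = k) ∧
    E.card = (if a.Vertical then 2 * k else 0) + (if b.Vertical then 2 * k else 0) ∧
    (∀ q ∈ cubeBoundarySum K ∆ E, q = a ∨ q = b ∨ (a 0 < q 0 ∧ q 0 < b 0)) ∧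
    C = (A ∆ B) ∆ (cubeBoundarySum K ∆ E)

/-- Concatenation of translation classes of sets of faces. -/
def FaceClass.IsConcatenation [NeZero d] (k : ℕ) (X Y Z : FaceClass d) : Prop :=
  ∃ A B C : Finset (Cell d), X = ⟦A⟧ ∧ Y = ⟦B⟧ ∧ Z = ⟦C⟧ ∧ _root_.IsConcatenation k A B C

/-- Concatenation of translation classes of linked sets of faces: the sets of faces are
concatenated, and the connections of the two parts are kept at every hyperedge whose neighbouring
faces have not changed. -/
def LinkedClass.IsConcatenation [NeZero d] (k : ℕ) (X Y Z : LinkedClass d) : Prop :=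
  ∃ A B C : LinkedFaces d, X = ⟦A⟧ ∧ Y = ⟦B⟧ ∧ Z = ⟦C⟧ ∧
    _root_.IsConcatenation k A.faces B.faces C.faces ∧
    (∀ g, cofaces C.faces g = cofaces A.faces g → C.linksAt g = A.linksAt g) ∧
    (∀ g, cofaces C.faces g = cofaces B.faces g → C.linksAt g = B.linksAt g)

end Concatenation

/-- The number of faces added by the concatenation. -/
def extraFaces (k : ℕ) : ℕ := 2 * (k ^ 2 + 3 * k - 1)

/-! Direction `0` is called vertical, and the coordinate `c 0` is the height of a cell. Coordinates
are doubled, so a cell and its facets are at distance 1 and parallel neighbouring cells at distance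
2.

Capping. Let `a` be the lexicographically largest face of `A`. If `a` is horizontal, it is replaced
by the other `2k + 1` facets of the cube on top of it; if `a` is vertical, a column of `2k - 1`
vertical faces and one horizontal face are put on it. Both cases gain `2k` faces and produce a
unique highest face, a horizontal lid (`Lidded`, `low_induction`, `low_joinable`). The lower end of
`B` is treated in the same way after a point reflection.

The tube. The two lids in general span different dimensions. They are joined by `k + 1` cubes in a
single horizontal layer, one initial cube and one for each of the `k` dimensions of the lower lid
(`exists_mid`). The mod-2 boundary of the tube is a closed manifold with `2k(k + 1) + 2` faces.
Gluing along the two lids removes four faces from the count, which gives `n + m + extraFaces k`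
(`Bridge`, `FaceJoin.card_count`). All changes are of two local kinds: a face is exchanged for the
rest of a closed manifold (`Joinable`), or a new face is attached along one edge (`Attachable`).
Neither changes the number of boundary components of a part, and boundaries of the two parts are too
far apart in height to touch.

Injectivity. When the number of faces of `A` is known, `A` is recovered as the bottom of the result,
because two candidates would be nested and of equal size (`Bottom.unique`). Reflection recovers `B`.
What remains mod 2 is the boundary of the tube, whose cubes are visible from their top facets
(`Tube.cubes_eq`). A normal position of `a` and a fixed choice of tube make the join well defined on
translation classes.

Osculating manifolds. When a horizontal `a` is replaced at its edge `g` by the vertical face above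
`g`, the direction of this face seen from `g` changes, and the osculating condition may fail. It
says essentially that at most one pair at `g` is antipodal, and it is repaired by exchanging
partners. There are two possible exchanges, and a parity argument shows that one of them keeps the
manifold connected (`Conn.or_of_exchange`). An exchange can be undone once it is known that it took
place (`Switched.left_unique`). As `a` is lexicographically maximal, exchanges are needed only at
the edges `a - e_i` (`eq_sub_of_antipodal`), so `k` bits at each end suffice. The tube stores them:
for each of its `k` further cubes there are two binary choices. For self-avoiding manifolds all bits
are zero, so that the construction for linked faces lies over the one for face sets. -/

section

/-! ### Facets, connectivity, and exchanging a face for a patch. -/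

namespace Cell

variable {d : ℕ}

theorem mem_halfInt {c : Cell d} {i : Fin d} : i ∈ c.halfInt ↔ Odd (c i) := by
  simp [halfInt]

theorem exists_of_mem_facets {c g : Cell d} (h : g ∈ c.facets) :
    ∃ j s, Odd (c j) ∧ (s = 1 ∨ s = -1) ∧ g = c + Pi.single j s := by
  simp only [facets, mem_biUnion, mem_halfInt, mem_insert, mem_singleton] at h
  obtain ⟨j, hj, rfl | rfl⟩ := h
  · exact ⟨j, 1, hj, by simp⟩
  · exact ⟨j, -1, hj, by simp, by rw [Pi.single_neg, sub_eq_add_neg]⟩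

theorem add_single_mem_facets {c : Cell d} {j : Fin d} {s : ℤ} (hj : Odd (c j))
    (hs : s = 1 ∨ s = -1) : c + Pi.single j s ∈ c.facets := by
  simp only [facets, mem_biUnion, mem_halfInt, mem_insert, mem_singleton]
  refine ⟨j, hj, ?_⟩
  rcases hs with rfl | rfl
  · simp
  · right; rw [Pi.single_neg, sub_eq_add_neg]

theorem mem_facets_iff {c g : Cell d} :
    g ∈ c.facets ↔ ∃ j, Odd (c j) ∧ (g j = c j + 1 ∨ g j = c j - 1) ∧ ∀ m, m ≠ j → g m = c m := by
  constructor
  · intro h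
    obtain ⟨j, s, hj, hs, rfl⟩ := exists_of_mem_facets h
    refine ⟨j, hj, ?_, ?_⟩
    · simp; omega
    · intro m hm; simp [hm]
  · rintro ⟨j, hj, h1, h2⟩
    have : g = c + Pi.single j (g j - c j) := by
      ext m
      by_cases hm : m = j
      · subst hm; simp
      · simp [hm, h2 m hm]
    rw [this]
    exact add_single_mem_facets hj (by omega)

theorem dim_of_mem_facets {c g : Cell d} (h : g ∈ c.facets) : c.dim = g.dim + 1 := by
  obtain ⟨j, hj, h1, h2⟩ := mem_facets_iff.1 h
  have : c.halfInt = insert j g.halfInt := by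
    ext m
    simp only [mem_halfInt, mem_insert]
    by_cases hm : m = j
    · subst hm; simp [hj]
    · simp [hm, h2 m hm]
  rw [dim, dim, this, card_insert_of_notMem]
  rw [mem_halfInt]
  grind

/-- Two different cells share at most one facet. -/
theorem facet_unique {x y g g' : Cell d} (hxy : x ≠ y) (h1 : g ∈ x.facets) (h2 : g ∈ y.facets)
    (h3 : g' ∈ x.facets) (h4 : g' ∈ y.facets) : g = g' := by
  obtain ⟨a, ha, ha1, ha2⟩ := mem_facets_iff.1 h1
  obtain ⟨b, hb, hb1, hb2⟩ := mem_facets_iff.1 h2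
  obtain ⟨c, hc, hc1, hc2⟩ := mem_facets_iff.1 h3
  obtain ⟨e, he, he1, he2⟩ := mem_facets_iff.1 h4
  obtain ⟨m, hm⟩ : ∃ m, x m ≠ y m := Function.ne_iff.1 hxy
  ext i
  have := ha2 i; have := hb2 i; have := hc2 i; have := he2 i
  have := ha2 a; have := hb2 a; have := hc2 a; have := he2 a
  have := ha2 b; have := hb2 b; have := hc2 b; have := he2 b
  have := ha2 c; have := hb2 c; have := hc2 c; have := he2 c
  have := ha2 e; have := hb2 e; have := hc2 e; have := he2 e
  have := ha2 m; have := hb2 m; have := hc2 m; have := he2 m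
  grind

theorem card_facets (c : Cell d) : c.facets.card = 2 * c.dim := by
  rw [facets, card_biUnion, dim, sum_const_nat (m := 2), mul_comm]
  · intro j _
    rw [card_pair]
    intro h
    have := congrFun h j
    simp at this
    omega
  · intro i hi j hj hij
    rw [Function.onFun, Finset.disjoint_left]
    intro g h1 h2
    simp only [mem_insert, mem_singleton] at h1 h2
    have e1 : g i ≠ c i := by rcases h1 with rfl | rfl <;> simp
    apply e1
    rcases h2 with rfl | rfl <;> simp [hij]

end Cell

variable {d : ℕ}

theorem mem_cofaces {S : Finset (Cell d)} {f g : Cell d} :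
    f ∈ cofaces S g ↔ f ∈ S ∧ g ∈ f.facets := by simp [cofaces]

/-- Each edge of a cube lies on exactly two of its facets. -/
theorem exists_cofaces_facets_eq {Q f g : Cell d} (hf : f ∈ Q.facets) (hg : g ∈ f.facets) :
    ∃ u, u ≠ f ∧ cofaces Q.facets g = {f, u} := by
  obtain ⟨j, hj, hj1, hj2⟩ := Cell.mem_facets_iff.1 hf
  obtain ⟨m, hm, hm1, hm2⟩ := Cell.mem_facets_iff.1 hg
  have hjm : m ≠ j := by rintro rfl; grind
  -- The edge `g` differs from `Q` in the two dimensions `j` and `m`. A facet of `Q` that contains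
  -- `g` differs from `Q` in just one of them: `j` gives `f`, and `m` gives the other facet.
  have key : ∀ x : Cell d, x ∈ Q.facets ∧ g ∈ x.facets ↔
      x = f ∨ x = Function.update Q m (g m) := by
    intro x
    constructor
    · rintro ⟨h1, h2⟩
      obtain ⟨a, ha, ha1, ha2⟩ := Cell.mem_facets_iff.1 h1
      obtain ⟨b, hb, hb1, hb2⟩ := Cell.mem_facets_iff.1 h2
      have hab : b ≠ a := by rintro rfl; grind
      have ha' : a = j ∨ a = m := by
        by_contra hcon
        have := hb2 a; have := hm2 a; have := hj2 a
        grind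
      rcases ha' with rfl | rfl
      · left
        ext i
        have := ha2 i; have := hb2 a; have := hj2 i; have := hm2 a
        grind
      · right
        ext i
        have := ha2 i; have := hb2 a; have := hb2 i
        by_cases hi : i = a
        · subst hi; simp; grind
        · simp [hi]; grind
    · rintro (rfl | rfl)
      · exact ⟨hf, hg⟩
      · constructor
        · rw [Cell.mem_facets_iff]
          refine ⟨m, by rw [← hj2 m hjm]; exact hm, ?_, ?_⟩
          · simp; have := hj2 m hjm; omega
          · intro i hi; simp [hi]
        · rw [Cell.mem_facets_iff]
          have := hm2 j hjm.symm
          refine ⟨j, by simpa [hjm.symm] using hj, ?_, ?_⟩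
          · simp [hjm.symm]; omega
          · intro i hi
            by_cases him : i = m
            · subst him; simp
            · simp [him]; rw [hm2 i him, hj2 i hi]
  refine ⟨Function.update Q m (g m), ?_, ?_⟩
  · intro h
    have := congrFun h m
    simp at this
    omega
  · ext x
    rw [mem_cofaces, key]
    simp

theorem mem_boundary {S : Finset (Cell d)} {g : Cell d} :
    g ∈ boundary S ↔ (cofaces S g).card = 1 := by
  simp only [boundary, mem_filter, mem_biUnion, and_iff_right_iff_imp]
  intro h
  obtain ⟨f, hf⟩ := card_eq_one.1 h
  have : f ∈ cofaces S g := by simp [hf]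
  exact ⟨f, (mem_cofaces.1 this).1, (mem_cofaces.1 this).2⟩

theorem ShareFacet.symm {f f' : Cell d} (h : ShareFacet f f') : ShareFacet f' f :=
  let ⟨g, h1, h2⟩ := h
  ⟨g, h2, h1⟩

/-- Every predicate on `S` that is invariant under `R` is constant. -/
def Conn (S : Finset (Cell d)) (R : Cell d → Cell d → Prop) : Prop :=
  ∀ p : Cell d → Prop, (∀ x ∈ S, ∀ y ∈ S, R x y → (p x ↔ p y)) → ∀ x ∈ S, ∀ y ∈ S, (p x ↔ p y)

/-- Reachability from a fixed cell is itself an invariant predicate when `R` is symmetric. The form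
with predicates turns gluing and reconnecting into propositional logic; nonemptiness is split off
because `Conn` holds for the empty set. -/
theorem isConnectedVia_iff {S : Finset (Cell d)} {R : Cell d → Cell d → Prop}
    (hR : ∀ x y, R x y → R y x) : IsConnectedVia S R ↔ S.Nonempty ∧ Conn S R := by
  refine and_congr_right fun _ => ⟨fun h p hp x hx y hy => ?_, fun h x hx y hy => ?_⟩
  · have := h x hx y hy
    clear hy
    induction this with
    | refl => rfl
    | tail _ h2 ih => exact ih.trans (hp _ h2.1 _ h2.2.1 h2.2.2)
  · refine (h (fun z => Relation.ReflTransGen (fun x y => x ∈ S ∧ y ∈ S ∧ R x y) x z) ?_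
      x hx y hy).1 .refl
    intro u hu v hv huv
    exact ⟨fun h => h.tail ⟨hu, hv, huv⟩, fun h => h.tail ⟨hv, hu, hR _ _ huv⟩⟩

/-- The face `f` is exchanged for a connected patch `W` that takes over its neighbours. An invariant
predicate on the new set is constant on `W`, and it extends to `S` by giving `f` this constant
value. -/
theorem Conn.glue {S W : Finset (Cell d)} {RS RW R : Cell d → Cell d → Prop} {f : Cell d}
    (hS : Conn S RS) (hW : Conn W RW) (hf : f ∈ S) (hne : W.Nonempty)
    (hRS : ∀ x ∈ S.erase f, ∀ y ∈ S.erase f, RS x y → R x y)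
    (hRW : ∀ x ∈ W, ∀ y ∈ W, RW x y → R x y)
    (h1 : ∀ x ∈ S.erase f, RS x f ∨ RS f x → ∃ u ∈ W, R x u) : Conn (S.erase f ∪ W) R := by
  intro p hp
  obtain ⟨w, hw⟩ := hne
  have hpW : ∀ x ∈ W, (p x ↔ p w) := fun x hx =>
    hW p (fun x hx y hy h => hp x (mem_union_right _ hx) y (mem_union_right _ hy)
      (hRW x hx y hy h)) x hx w hw
  have key : ∀ x ∈ S.erase f, (p x ↔ p w) := by
    intro x hx
    -- The removed face gets the common value of `p` on the patch.
    have := hS (fun z => if z = f then p w else p z) ?_ x (mem_of_mem_erase hx) f hf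
    · simpa [ne_of_mem_erase hx] using this
    · intro u hu v hv huv
      by_cases huf : u = f <;> by_cases hvf : v = f
      · simp [huf, hvf]
      · subst huf
        have hv' : v ∈ S.erase u := mem_erase.2 ⟨hvf, hv⟩
        obtain ⟨z, hz, hvz⟩ := h1 v hv' (Or.inr huv)
        simp only [if_true, hvf, if_false]
        rw [← hpW z hz]
        exact (hp v (mem_union_left _ hv') z (mem_union_right _ hz) hvz).symm
      · subst hvf
        have hu' : u ∈ S.erase v := mem_erase.2 ⟨huf, hu⟩
        obtain ⟨z, hz, hvz⟩ := h1 u hu' (Or.inl huv)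
        simp only [if_true, huf, if_false]
        rw [← hpW z hz]
        exact hp u (mem_union_left _ hu') z (mem_union_right _ hz) hvz
      · simp only [huf, hvf, if_false]
        have hu' : u ∈ S.erase f := mem_erase.2 ⟨huf, hu⟩
        have hv' : v ∈ S.erase f := mem_erase.2 ⟨hvf, hv⟩
        exact hp u (mem_union_left _ hu') v (mem_union_left _ hv') (hRS u hu' v hv' huv)
  have all : ∀ x ∈ S.erase f ∪ W, (p x ↔ p w) := by
    intro x hx
    rcases mem_union.1 hx with h | h
    exacts [key x h, hpW x h]
  intro x hx y hy
  rw [all x hx, all y hy]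

/-- Two sets of faces `S` and `U` meet in the single face `f` and its edges, and each edge of `f`
is neighboured by exactly two faces of `U`. -/
structure Joinable (S U : Finset (Cell d)) (f : Cell d) : Prop where
  mem_left : f ∈ S
  mem_right : f ∈ U
  inter : ∀ x ∈ S, x ∈ U → x = f
  edge : ∀ x ∈ S, ∀ y ∈ U, ∀ g, g ∈ x.facets → g ∈ y.facets → g ∈ f.facets
  thin : ∀ g ∈ f.facets, ∃ u, u ≠ f ∧ cofaces U g = {f, u}

/-- The union of `S` and `U` without the face `f`. -/
def joinFaces (S U : Finset (Cell d)) (f : Cell d) : Finset (Cell d) := S.erase f ∪ U.erase f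

theorem mem_joinFaces {S U : Finset (Cell d)} {f x : Cell d} :
    x ∈ joinFaces S U f ↔ x ≠ f ∧ (x ∈ S ∨ x ∈ U) := by
  simp only [joinFaces, mem_union, mem_erase]; tauto

namespace Joinable

variable {S U : Finset (Cell d)} {f : Cell d}

theorem joinFaces_eq (h : Joinable S U f) : joinFaces S U f = symmDiff S U := by
  ext x
  rw [mem_joinFaces, mem_symmDiff]
  have := h.inter x; have := h.mem_left; have := h.mem_right
  grind

theorem card_eq (h : Joinable S U f) : (joinFaces S U f).card + 2 = S.card + U.card := by
  rw [joinFaces, card_union_of_disjoint, card_erase_of_mem h.mem_left,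
    card_erase_of_mem h.mem_right]
  · have := card_pos.2 ⟨f, h.mem_left⟩
    have := card_pos.2 ⟨f, h.mem_right⟩
    omega
  · rw [Finset.disjoint_left]
    intro x hx hy
    exact ne_of_mem_erase hx (h.inter x (mem_of_mem_erase hx) (mem_of_mem_erase hy))

theorem cofaces_of_left (h : Joinable S U f) {x g : Cell d} (hx : x ∈ S) (hg : g ∈ x.facets)
    (hgf : g ∉ f.facets) : cofaces (joinFaces S U f) g = cofaces S g := by
  ext y
  rw [mem_cofaces, mem_cofaces, mem_joinFaces]
  have := h.edge x hx y
  grind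

theorem cofaces_of_right (h : Joinable S U f) {x g : Cell d} (hx : x ∈ U) (hg : g ∈ x.facets)
    (hgf : g ∉ f.facets) : cofaces (joinFaces S U f) g = cofaces U g := by
  ext y
  rw [mem_cofaces, mem_cofaces, mem_joinFaces]
  have := h.edge y
  grind

/-- At an edge of `f` the second face `u` of `U` takes the place of `f`. Writing this as a
transposition allows links at `g` to be transported by the same map. -/
theorem cofaces_of_mem (h : Joinable S U f) {u g : Cell d} (hg : g ∈ f.facets)
    (hu : u ≠ f) (hug : cofaces U g = {f, u}) :
    cofaces (joinFaces S U f) g = (cofaces S g).image (Equiv.swap f u) := by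
  have huS : u ∉ S := fun hS => hu (h.inter u hS (mem_cofaces.1 (by rw [hug]; simp : u ∈ cofaces U g)).1)
  have key : ∀ y, (y ∈ U ∧ g ∈ y.facets) ↔ (y = f ∨ y = u) := by
    intro y
    rw [← mem_cofaces, hug]; simp
  ext y
  rw [mem_cofaces, mem_joinFaces, mem_image]
  have hk := key y
  have hku := key u
  have := h.mem_left
  constructor
  · rintro ⟨⟨h1, h2⟩, h3⟩
    by_cases hyu : y = u
    · exact ⟨f, mem_cofaces.2 ⟨h.mem_left, hg⟩, by simp [hyu]⟩
    · refine ⟨y, mem_cofaces.2 ⟨by grind, h3⟩, Equiv.swap_apply_of_ne_of_ne h1 hyu⟩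
  · rintro ⟨z, hz, rfl⟩
    rw [mem_cofaces] at hz
    by_cases hzf : z = f
    · subst hzf
      simp only [Equiv.swap_apply_left]
      grind
    · have hzu : z ≠ u := by rintro rfl; exact huS hz.1
      rw [Equiv.swap_apply_of_ne_of_ne hzf hzu]
      exact ⟨⟨hzf, Or.inl hz.1⟩, hz.2⟩

theorem card_cofaces_of_mem (h : Joinable S U f) {g : Cell d} (hg : g ∈ f.facets) :
    (cofaces (joinFaces S U f) g).card = (cofaces S g).card := by
  obtain ⟨u, hu, hug⟩ := h.thin g hg
  rw [h.cofaces_of_mem hg hu hug, card_image_of_injective _ (Equiv.swap f u).injective]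

theorem card_cofaces_right (h : Joinable S U f) {g : Cell d} (hg : g ∈ f.facets) :
    (cofaces U g).card = 2 := by
  obtain ⟨u, hu, hug⟩ := h.thin g hg
  rw [hug, card_pair hu.symm]

theorem cofaces_cases (h : Joinable S U f) (g : Cell d) :
    (g ∈ f.facets) ∨
    (g ∉ f.facets ∧ cofaces (joinFaces S U f) g = cofaces S g ∧ cofaces U g = ∅) ∨
    (g ∉ f.facets ∧ cofaces (joinFaces S U f) g = cofaces U g ∧ cofaces S g = ∅) := by
  by_cases hg : g ∈ f.facets
  · exact Or.inl hg
  right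
  rcases (cofaces S g).eq_empty_or_nonempty with hS | ⟨x, hx⟩
  · rcases (cofaces U g).eq_empty_or_nonempty with hU | ⟨x, hx⟩
    · left
      refine ⟨hg, ?_, hU⟩
      rw [hS, eq_empty_iff_forall_notMem]
      intro y hy
      rw [mem_cofaces, mem_joinFaces] at hy
      rw [eq_empty_iff_forall_notMem] at hS hU
      have h1 := hS y; have h2 := hU y
      rw [mem_cofaces] at h1 h2
      tauto
    · right
      rw [mem_cofaces] at hx
      exact ⟨hg, h.cofaces_of_right hx.1 hx.2 hg, hS⟩
  · left
    rw [mem_cofaces] at hx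
    refine ⟨hg, h.cofaces_of_left hx.1 hx.2 hg, ?_⟩
    rw [eq_empty_iff_forall_notMem]
    intro y hy
    rw [mem_cofaces] at hy
    exact hg (h.edge x hx.1 y hy.1 g hx.2 hy.2)

/-- The seam contributes no change: the exchange of `f` for `u` keeps the number of faces at an edge
of `f`, and `U` alone has two faces there. Every other edge sees only one of `S` and `U`. -/
theorem boundary_eq (h : Joinable S U f) :
    boundary (joinFaces S U f) = boundary S ∪ boundary U := by
  ext g
  rw [mem_union, mem_boundary, mem_boundary, mem_boundary]
  rcases h.cofaces_cases g with hg | ⟨hg, h1, h2⟩ | ⟨hg, h1, h2⟩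
  · rw [h.card_cofaces_of_mem hg, h.card_cofaces_right hg]; simp
  · rw [h1, h2]; simp
  · rw [h1, h2]; simp

theorem selfAvoiding (h : Joinable S U f) (hS : ∀ g, (cofaces S g).card ≤ 2)
    (hU : ∀ g, (cofaces U g).card ≤ 2) (g : Cell d) :
    (cofaces (joinFaces S U f) g).card ≤ 2 := by
  rcases h.cofaces_cases g with hg | ⟨hg, h1, h2⟩ | ⟨hg, h1, h2⟩
  · rw [h.card_cofaces_of_mem hg]; exact hS g
  · rw [h1]; exact hS g
  · rw [h1]; exact hU g

end Joinable

end

/-! ### Boundaries of cubes and their sums mod 2. -/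

section

variable {d : ℕ}

theorem Conn.of_hub {S : Finset (Cell d)} {R : Cell d → Cell d → Prop} {h : Cell d} (hh : h ∈ S)
    (H : ∀ x ∈ S, x = h ∨ R x h) : Conn S R := by
  intro p hp
  have key : ∀ x ∈ S, (p x ↔ p h) := fun x hx => by
    rcases H x hx with rfl | hr
    · rfl
    · exact hp x hx h hh hr
  intro x hx y hy
  rw [key x hx, key y hy]

theorem Conn.insert {S : Finset (Cell d)} {R : Cell d → Cell d → Prop} {v s : Cell d}
    (hS : Conn S R) (hs : s ∈ S) (hvs : R v s) : Conn (insert v S) R := by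
  intro p hp
  have h1 := hS p fun x hx y hy => hp x (mem_insert_of_mem hx) y (mem_insert_of_mem hy)
  have key : ∀ x ∈ Insert.insert v S, (p x ↔ p s) := by
    intro x hx
    rcases mem_insert.1 hx with rfl | hx
    · exact hp x (mem_insert_self _ _) s (mem_insert_of_mem hs) hvs
    · exact h1 x hx s hs
  intro x hx y hy
  rw [key x hx, key y hy]

theorem exists_of_mem_facets_facets {y z g : Cell d} (hz : z ∈ y.facets) (hg : g ∈ z.facets) :
    ∃ a b, a ≠ b ∧ Odd (y a) ∧ Odd (y b) ∧ (g a = y a + 1 ∨ g a = y a - 1) ∧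
      (g b = y b + 1 ∨ g b = y b - 1) ∧ ∀ m, m ≠ a → m ≠ b → g m = y m := by
  obtain ⟨a, ha, ha1, ha2⟩ := Cell.mem_facets_iff.1 hz
  obtain ⟨b, hb, hb1, hb2⟩ := Cell.mem_facets_iff.1 hg
  have hab : a ≠ b := by rintro rfl; grind
  have h1 := ha2 b hab.symm
  have h2 := hb2 a hab
  exact ⟨a, b, hab, ha, h1 ▸ hb, by omega, by omega, fun m hma hmb => by rw [hb2 m hmb, ha2 m hma]⟩

/-- An edge of a cube that agrees with the facet `F` in the direction of `F` lies on `F`. -/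
theorem mem_facets_of_coord {y z g F : Cell d} (hz : z ∈ y.facets) (hg : g ∈ z.facets)
    (hF : F ∈ y.facets) {j : Fin d} (hFj : F j ≠ y j) (hgj : g j = F j) : g ∈ F.facets := by
  obtain ⟨c, hc, hc1, hc2⟩ := Cell.mem_facets_iff.1 hF
  obtain rfl : j = c := by by_contra h; exact hFj (hc2 j h)
  obtain ⟨a, b, hab, ha, hb, ha1, hb1, h⟩ := exists_of_mem_facets_facets hz hg
  rw [Cell.mem_facets_iff]
  by_cases haj : a = j
  · subst haj
    have := hc2 b hab.symm
    refine ⟨b, this ▸ hb, by omega, fun m hm => ?_⟩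
    by_cases hma : m = a
    · rw [hma, hgj]
    · rw [h m hma hm, hc2 m hma]
  · by_cases hbj : b = j
    · subst hbj
      have := hc2 a hab
      refine ⟨a, this ▸ ha, by omega, fun m hm => ?_⟩
      by_cases hma : m = b
      · rw [hma, hgj]
      · rw [h m hm hma, hc2 m hma]
    · have := h j (Ne.symm haj) (Ne.symm hbj)
      omega

theorem shareFacet_of_mem_facets {Q x y : Cell d} (hx : x ∈ Q.facets) (hy : y ∈ Q.facets)
    {j m : Fin d} (hj : x j ≠ Q j) (hm : y m ≠ Q m) (hjm : j ≠ m) : ShareFacet x y := by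
  obtain ⟨a, ha, ha1, ha2⟩ := Cell.mem_facets_iff.1 hx
  obtain ⟨b, hb, hb1, hb2⟩ := Cell.mem_facets_iff.1 hy
  obtain rfl : j = a := by by_contra h; exact hj (ha2 j h)
  obtain rfl : m = b := by by_contra h; exact hm (hb2 m h)
  refine ⟨Function.update x m (y m), ?_, ?_⟩
  · rw [Cell.mem_facets_iff]
    have := ha2 m hjm.symm
    refine ⟨m, by rw [this]; exact hb, ?_, fun i hi => by simp [hi]⟩
    simp; omega
  · rw [Cell.mem_facets_iff]
    have := hb2 j hjm
    refine ⟨j, by rw [this]; exact ha, ?_, ?_⟩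
    · simp [hjm]; omega
    · intro i hi
      by_cases him : i = m
      · subst him; simp
      · simp [him]; rw [ha2 i hi, hb2 i him]

/-- The facet opposite to a given facet of a cube shares an edge with all other facets. -/
theorem eq_or_shareFacet_opposite {Q x : Cell d} {j : Fin d} {s : ℤ} (hj : Odd (Q j))
    (hs : s = 1 ∨ s = -1) (hx : x ∈ Q.facets) (hne : x ≠ Q + Pi.single j s) :
    x = Q + Pi.single j (-s) ∨ ShareFacet x (Q + Pi.single j (-s)) := by
  have hop : Q + Pi.single j (-s) ∈ Q.facets := Cell.add_single_mem_facets hj (by omega)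
  obtain ⟨a, ha, ha1, ha2⟩ := Cell.mem_facets_iff.1 hx
  by_cases haj : a = j
  · subst haj
    left
    ext i
    by_cases hi : i = a
    · subst hi
      simp
      by_contra hcon
      apply hne
      ext m
      by_cases hm : m = i
      · subst hm; simp; omega
      · simp [hm, ha2 m hm]
    · simp [hi, ha2 i hi]
  · right
    refine shareFacet_of_mem_facets hx hop (j := a) (m := j) (by omega) ?_ haj
    simp; omega

/-- Every facet other than `Q + e_a` equals or touches `Q - e_a`. The exception reaches it through
the facet `Q + e_b` in another direction, which exists because the dimension is at least 2. -/
theorem conn_facets {Q : Cell d} (h : 2 ≤ Q.dim) : Conn Q.facets ShareFacet := by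
  obtain ⟨a, ha, b, hb, hab⟩ := one_lt_card.1 (show 1 < Q.halfInt.card from h)
  rw [Cell.mem_halfInt] at ha hb
  have h1 := Cell.add_single_mem_facets ha (Or.inl rfl)
  have h2 := Cell.add_single_mem_facets hb (Or.inl rfl)
  have h3 := Cell.add_single_mem_facets ha (Or.inr rfl)
  intro p hp
  have key : ∀ x ∈ Q.facets, (p x ↔ p (Q + Pi.single a (-1))) := by
    intro x hx
    by_cases hxa : x = Q + Pi.single a 1
    · rw [hxa, hp _ h1 _ h2 (shareFacet_of_mem_facets h1 h2 (j := a) (m := b) (by simp) (by simp)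
        hab), hp _ h2 _ h3 (shareFacet_of_mem_facets h2 h3 (j := b) (m := a) (by simp) (by simp)
        hab.symm)]
    · rcases eq_or_shareFacet_opposite ha (Or.inl rfl) hx hxa with h | h
      · rw [h]
      · exact hp _ hx _ h3 h
  intro x hx y hy
  rw [key x hx, key y hy]

theorem isSAM_facets {k : ℕ} (hk : 1 ≤ k) {Q : Cell d} (hQ : Q.dim = k + 1) :
    IsSAM k (2 * k + 2) Q.facets := by
  refine ⟨⟨?_, ?_, ?_⟩, ?_⟩
  · intro f hf
    have := Cell.dim_of_mem_facets hf
    omega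
  · rw [Cell.card_facets, hQ]; ring
  · rw [isConnectedVia_iff fun _ _ => ShareFacet.symm]
    refine ⟨?_, conn_facets (by omega)⟩
    rw [← card_pos, Cell.card_facets]; omega
  · intro g
    rcases (cofaces Q.facets g).eq_empty_or_nonempty with h | ⟨f, hf⟩
    · simp [h]
    · rw [mem_cofaces] at hf
      obtain ⟨u, hu, h⟩ := exists_cofaces_facets_eq hf.1 hf.2
      rw [h]
      exact card_le_two

theorem boundary_facets (Q : Cell d) : boundary Q.facets = ∅ := by
  rw [eq_empty_iff_forall_notMem]
  intro g hg
  rw [mem_boundary] at hg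
  obtain ⟨f, hf⟩ := card_pos.1 (by omega : 0 < (cofaces Q.facets g).card)
  rw [mem_cofaces] at hf
  obtain ⟨u, hu, h⟩ := exists_cofaces_facets_eq hf.1 hf.2
  rw [h, card_pair hu.symm] at hg
  omega

/-- The patch `U` has to be connected without `f`, since `f` itself disappears; it takes over the
neighbours of `f` because of `thin`. -/
theorem Joinable.isXD {S U : Finset (Cell d)} {f : Cell d} (h : Joinable S U f) {k n m N : ℕ}
    (hS : IsXD k n S) (hU : ∀ x ∈ U, x.dim = k) (hm : U.card = m) (hN : N + 2 = n + m)
    (hne : (U.erase f).Nonempty) (hc : Conn (U.erase f) ShareFacet) :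
    IsXD k N (joinFaces S U f) := by
  refine ⟨?_, ?_, ?_⟩
  · intro x hx
    rw [mem_joinFaces] at hx
    rcases hx.2 with hx | hx
    exacts [hS.dim_eq x hx, hU x hx]
  · have := h.card_eq
    have := hS.card_eq
    omega
  · rw [isConnectedVia_iff fun _ _ => ShareFacet.symm]
    refine ⟨hne.mono subset_union_right, ?_⟩
    have hS' := ((isConnectedVia_iff fun _ _ => ShareFacet.symm).1 hS.connected).2
    refine Conn.glue hS' hc h.mem_left hne (fun _ _ _ _ h => h) (fun _ _ _ _ h => h) ?_
    intro x hx hxf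
    have : ShareFacet x f := hxf.elim id ShareFacet.symm
    obtain ⟨g, hg1, hg2⟩ := this
    obtain ⟨u, hu, hug⟩ := h.thin g hg2
    have : u ∈ cofaces U g := by simp [hug]
    rw [mem_cofaces] at this
    exact ⟨u, mem_erase.2 ⟨hu, this.1⟩, g, hg1, this.2⟩

theorem mem_cubeBoundarySum {K : Finset (Cell d)} {q : Cell d} :
    q ∈ cubeBoundarySum K ↔ Odd (cofaces K q).card := by
  simp only [cubeBoundarySum, mem_filter, mem_biUnion, and_iff_right_iff_imp]
  intro h
  obtain ⟨f, hf⟩ := card_pos.1 h.pos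
  exact ⟨f, (mem_cofaces.1 hf).1, (mem_cofaces.1 hf).2⟩

theorem exists_of_mem_cubeBoundarySum {K : Finset (Cell d)} {q : Cell d}
    (h : q ∈ cubeBoundarySum K) : ∃ c ∈ K, q ∈ c.facets := by
  rw [mem_cubeBoundarySum] at h
  obtain ⟨f, hf⟩ := card_pos.1 h.pos
  exact ⟨f, (mem_cofaces.1 hf).1, (mem_cofaces.1 hf).2⟩

theorem mem_cubeBoundarySum_of_unique {K : Finset (Cell d)} {q c : Cell d} (hc : c ∈ K)
    (hq : q ∈ c.facets) (h : ∀ c' ∈ K, q ∈ c'.facets → c' = c) : q ∈ cubeBoundarySum K := by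
  rw [mem_cubeBoundarySum]
  have : cofaces K q = {c} := by
    ext x
    rw [mem_cofaces, mem_singleton]
    constructor
    · rintro ⟨h1, h2⟩; exact h x h1 h2
    · rintro rfl; exact ⟨hc, hq⟩
  simp [this]

theorem cubeBoundarySum_empty : cubeBoundarySum (∅ : Finset (Cell d)) = ∅ := by
  simp [cubeBoundarySum]

theorem cubeBoundarySum_union {K L : Finset (Cell d)} (h : Disjoint K L) :
    cubeBoundarySum (K ∪ L) = symmDiff (cubeBoundarySum K) (cubeBoundarySum L) := by
  ext q
  rw [mem_symmDiff, mem_cubeBoundarySum, mem_cubeBoundarySum, mem_cubeBoundarySum]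
  have : cofaces (K ∪ L) q = cofaces K q ∪ cofaces L q := filter_union _ _ _
  rw [this, card_union_of_disjoint (s := cofaces K q) (t := cofaces L q)
    (h.mono (filter_subset _ _) (filter_subset _ _)), Nat.odd_add]
  rw [← Nat.not_odd_iff_even]
  tauto

theorem cubeBoundarySum_singleton (Q : Cell d) : cubeBoundarySum {Q} = Q.facets := by
  ext q
  rw [mem_cubeBoundarySum, cofaces, filter_singleton]
  split_ifs with h <;> simp [h]

/-- As `t` is even, a cube centred at `t` does not extend in direction `j`, and one centred at `t -
η` ends exactly at `t`. All cells of such cubes lie on one side of the hyperplane at `t`, so a new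
cube on the side of `η` can meet them only within this hyperplane. -/
theorem slab_of_mem_facets {c f : Cell d} {j : Fin d} {t η : ℤ} (hη : η = 1 ∨ η = -1) (ht : Even t)
    (hc : c j = t ∨ c j = t - η) (hf : f ∈ c.facets) :
    (f j - t) * η ≤ 0 ∧ ∀ g ∈ f.facets, (g j - t) * η ≤ 0 := by
  obtain ⟨a, ha, ha1, ha2⟩ := Cell.mem_facets_iff.1 hf
  have haj : a ≠ j ∨ a = j := ne_or_eq a j
  have hfj : f j = t ∨ f j = t - η ∨ f j = t - 2 * η := by
    rcases haj with haj | rfl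
    · rw [ha2 j haj.symm]; tauto
    · have : c a ≠ t := fun h => by rw [h] at ha; exact (Int.not_even_iff_odd.2 ha) ht
      omega
  have hprod : ∀ v : ℤ, v = t ∨ v = t - η ∨ v = t - 2 * η → (v - t) * η ≤ 0 := by
    rintro v (rfl | rfl | rfl) <;> rcases hη with rfl | rfl <;> ring_nf <;> norm_num
  refine ⟨hprod _ hfj, fun g hg => hprod _ ?_⟩
  obtain ⟨b, hb, hb1, hb2⟩ := Cell.mem_facets_iff.1 hg
  rcases ne_or_eq b j with hbj | rfl
  · rw [hb2 j hbj.symm]; exact hfj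
  · have h1 : f b ≠ t := fun h => by rw [h] at hb; exact (Int.not_even_iff_odd.2 hb) ht
    have h2 : f b ≠ t - 2 * η := fun h => by
      rw [h] at hb; exact (Int.not_even_iff_odd.2 hb) (ht.sub (even_two_mul _))
    omega

theorem erase_erase_joinFaces {S U : Finset (Cell d)} {F l u : Cell d} (hl : l ∉ U.erase F)
    (hu : u ∉ U.erase F) : ((joinFaces S U F).erase l).erase u =
      ((S.erase l).erase u).erase F ∪ U.erase F := by
  ext z
  simp only [mem_erase, mem_joinFaces, mem_union] at *
  by_cases h1 : z = l
  · subst h1; tauto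
  · by_cases h2 : z = u
    · subst h2; tauto
    · tauto

/-- When the top of the tube moves from `u` to the new face `w`, the old top `u` becomes an ordinary
side again. -/
theorem erase_erase_joinFaces' {S U : Finset (Cell d)} {F l u w : Cell d} (hl : l ∉ U.erase F)
    (hu : u ∉ U.erase F) (hw : w ∉ S) (huS : u ∈ S) (hul : u ≠ l) (huF : u ≠ F) :
    ((joinFaces S U F).erase l).erase w =
      insert u (((S.erase l).erase u).erase F ∪ (U.erase F).erase w) := by
  ext z
  simp only [mem_erase, mem_joinFaces, mem_union, mem_insert] at *
  by_cases h1 : z = l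
  · subst h1; simp [hul.symm]; tauto
  · by_cases h2 : z = u
    · subst h2
      have : z ≠ w := fun h => hw (h ▸ huS)
      simp [*]
    · by_cases h3 : z = w
      · subst h3; simp [*]
      · tauto

/-! ### Tubes of cubes in one horizontal layer. -/

section Mid

variable [NeZero d]

/-- A set `K` of `(k+1)`-cubes above the horizontal face `l`, all at the same height, whose boundary
sum is a closed manifold that stays connected without `l` and the top of the cube `x`. -/
structure Tube (k : ℕ) (l : Cell d) (K : Finset (Cell d)) (x : Cell d) : Prop where
  dim : ∀ c ∈ K, c.dim = k + 1
  height : ∀ c ∈ K, c 0 = l 0 + 1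
  base : l + Pi.single 0 1 ∈ K
  top : x ∈ K
  sam : IsSAM k (2 * k * K.card + 2) (cubeBoundarySum K)
  closed : boundary (cubeBoundarySum K) = ∅
  conn : Conn (((cubeBoundarySum K).erase l).erase (x + Pi.single 0 1)) ShareFacet

/-- In a layer of cubes a facet at another height is the top or bottom of its cube and determines
it. Such facets therefore never cancel mod 2. -/
theorem eq_of_top_mem_facets {K : Finset (Cell d)} {t : ℤ} (hK : ∀ c ∈ K, c 0 = t) {c q : Cell d}
    (hc : c ∈ K) (hq : q ∈ c.facets) (hq0 : q 0 ≠ t) : c = Function.update q 0 t := by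
  obtain ⟨a, ha, ha1, ha2⟩ := Cell.mem_facets_iff.1 hq
  have h0 := hK c hc
  have : a = 0 := by
    by_contra h
    exact hq0 (by rw [ha2 0 (Ne.symm h), h0])
  subst this
  ext i
  by_cases hi : i = 0
  · subst hi; simp [h0]
  · simp [hi, ha2 i hi]

namespace Tube

variable {k : ℕ} {l x : Cell d} {K : Finset (Cell d)}

theorem mem_of_horizontal (h : Tube k l K x) (hl : Even (l 0)) {c : Cell d} (hc : c ∈ K) {s : ℤ}
    (hs : s = 1 ∨ s = -1) : c + Pi.single 0 s ∈ cubeBoundarySum K := by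
  have h0 := h.height c hc
  have hodd : Odd (c 0) := by rw [h0]; exact hl.add_one
  refine mem_cubeBoundarySum_of_unique hc (Cell.add_single_mem_facets hodd hs) ?_
  intro c' hc' hq
  rw [eq_of_top_mem_facets h.height hc' hq (by simp; omega)]
  ext i
  by_cases hi : i = 0
  · subst hi; simp [h0]
  · simp [hi]

theorem base_mem (h : Tube k l K x) (hl : Even (l 0)) : l ∈ cubeBoundarySum K := by
  have := h.mem_of_horizontal hl h.base (Or.inr rfl)
  rwa [add_assoc, ← Pi.single_add, add_neg_cancel, Pi.single_zero, add_zero] at this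

theorem top_mem (h : Tube k l K x) (hl : Even (l 0)) : x + Pi.single 0 1 ∈ cubeBoundarySum K :=
  h.mem_of_horizontal hl h.top (Or.inl rfl)

theorem exists_cofaces_eq (h : Tube k l K x) {f g : Cell d} (hf : f ∈ cubeBoundarySum K)
    (hg : g ∈ f.facets) : ∃ u, u ≠ f ∧ cofaces (cubeBoundarySum K) g = {f, u} := by
  have hfm : f ∈ cofaces (cubeBoundarySum K) g := mem_cofaces.2 ⟨hf, hg⟩
  have h1 := h.sam.selfAvoiding g
  have h2 : g ∉ boundary (cubeBoundarySum K) := by simp [h.closed]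
  rw [mem_boundary] at h2
  have h3 := card_pos.2 ⟨f, hfm⟩
  obtain ⟨a, b, hab, he⟩ := card_eq_two.1 (by omega : (cofaces (cubeBoundarySum K) g).card = 2)
  rw [he, mem_insert, mem_singleton] at hfm
  rcases hfm with rfl | rfl
  · exact ⟨b, hab.symm, he⟩
  · exact ⟨a, hab, by rw [he, pair_comm]⟩

theorem singleton (hk : 1 < k) (hl : Even (l 0)) (hd : l.dim = k) :
    Tube k l {l + Pi.single 0 1} (l + Pi.single 0 1) := by
  set Q : Cell d := l + Pi.single 0 1 with hQ
  have hodd : Odd (Q 0) := by simp [hQ, hl.add_one]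
  have hlQ : l = Q + Pi.single 0 (-1) := by
    rw [hQ, add_assoc, ← Pi.single_add, add_neg_cancel, Pi.single_zero, add_zero]
  have hlm : l ∈ Q.facets := by
    rw [hlQ]; exact Cell.add_single_mem_facets hodd (Or.inr rfl)
  have hdim : Q.dim = k + 1 := by rw [Cell.dim_of_mem_facets hlm, hd]
  refine ⟨by simpa using hdim, by simp [hQ], mem_singleton_self _, mem_singleton_self _, ?_, ?_, ?_⟩
  · rw [cubeBoundarySum_singleton]
    simpa using isSAM_facets hk.le hdim
  · rw [cubeBoundarySum_singleton, boundary_facets]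
  · rw [cubeBoundarySum_singleton]
    -- Since `k > 1`, the cube extends in two dimensions besides `0`. The sides in these directions
    -- connect what is left without the bottom and the top.
    obtain ⟨a, ha, b, hb, hab⟩ := one_lt_card.1
      (show 1 < (Q.halfInt.erase 0).card by
        rw [card_erase_of_mem (Cell.mem_halfInt.2 hodd)]
        change 1 < Q.dim - 1
        omega)
    rw [mem_erase, Cell.mem_halfInt] at ha hb
    intro p hp
    have hmem : ∀ y, y ∈ (Q.facets.erase l).erase (Q + Pi.single 0 1) ↔
        (y ∈ Q.facets ∧ y ≠ l ∧ y ≠ Q + Pi.single 0 1) := by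
      intro y; simp only [mem_erase]; tauto
    have hside : ∀ m : Fin d, ∀ s : ℤ, m ≠ 0 → (s = 1 ∨ s = -1) → Odd (Q m) →
        Q + Pi.single m s ∈ (Q.facets.erase l).erase (Q + Pi.single 0 1) := by
      intro m s hm hs ho
      rw [hmem]
      refine ⟨Cell.add_single_mem_facets ho hs, ?_, ?_⟩
      · intro he
        have := congrFun he m
        rw [hlQ] at this
        simp [hm] at this
        omega
      · intro he
        have := congrFun he m
        simp [hm] at this
        omega
    have h1 := hside a 1 ha.1 (Or.inl rfl) ha.2
    have h2 := hside b 1 hb.1 (Or.inl rfl) hb.2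
    have h3 := hside a (-1) ha.1 (Or.inr rfl) ha.2
    have key : ∀ y ∈ (Q.facets.erase l).erase (Q + Pi.single 0 1),
        (p y ↔ p (Q + Pi.single a (-1))) := by
      intro y hy
      have hy' := (hmem y).1 hy
      by_cases hya : y = Q + Pi.single a 1
      · rw [hya, hp _ h1 _ h2 (shareFacet_of_mem_facets ((hmem _).1 h1).1 ((hmem _).1 h2).1
          (j := a) (m := b) (by simp) (by simp) hab), hp _ h2 _ h3 (shareFacet_of_mem_facets
          ((hmem _).1 h2).1 ((hmem _).1 h3).1 (j := b) (m := a) (by simp) (by simp) hab.symm)]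
      · rcases eq_or_shareFacet_opposite ha.2 (Or.inl rfl) hy'.1 hya with h | h
        · rw [h]
        · exact hp _ hy _ h3 h
    intro x hx y hy
    rw [key x hx, key y hy]

set_option maxHeartbeats 1000000 in
/-- Attaching a further cube `F + η e_j` to the side `F` of the cube `x`. -/
theorem step (h : Tube k l K x) (hk : 1 < k) (hl : Even (l 0)) {F : Cell d} {i j : Fin d} {η : ℤ}
    (hi0 : i ≠ 0) (hi : Odd (x i)) (hFi : F i = x i + 1 ∨ F i = x i - 1)
    (hFx : ∀ m, m ≠ i → F m = x m)
    (hj0 : j ≠ 0) (hη : η = 1 ∨ η = -1) (hFj : Even (F j))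
    (hslab : ∀ c ∈ K, c j = F j ∨ c j = F j - η)
    (huniq : ∀ c ∈ K, F ∈ c.facets → c = x) :
    F + Pi.single j η ∉ K ∧ Tube k l (insert (F + Pi.single j η) K) x ∧
      Tube k l (insert (F + Pi.single j η) K) (F + Pi.single j η) := by
  set y : Cell d := F + Pi.single j η with hy
  have hyj : y j = F j + η := by simp [hy]
  have hym : ∀ m, m ≠ j → y m = F m := fun m hm => by simp [hy, hm]
  have hyodd : Odd (y j) := by rw [hyj]; rcases hη with rfl | rfl <;> grind
  have hx0 := h.height x h.top
  have hF0 : F 0 = l 0 + 1 := by rw [hFx 0 hi0.symm, hx0]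
  have hFx' : F ∈ x.facets := Cell.mem_facets_iff.2 ⟨i, hi, hFi, hFx⟩
  have hFy : F = y + Pi.single j (-η) := by
    rw [hy, add_assoc, ← Pi.single_add, add_neg_cancel, Pi.single_zero, add_zero]
  have hFym : F ∈ y.facets := by
    rw [hFy]; exact Cell.add_single_mem_facets hyodd (by omega)
  have hyK : y ∉ K := fun hK => by
    have := hslab y hK
    omega
  have hFdim : F.dim = k := by
    have := Cell.dim_of_mem_facets hFx'
    have := h.dim x h.top
    omega
  have hydim : y.dim = k + 1 := by rw [Cell.dim_of_mem_facets hFym, hFdim]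
  have hFT : F ∈ cubeBoundarySum K := mem_cubeBoundarySum_of_unique h.top hFx' huniq
  -- The old tube lies on one side of the hyperplane of `F` and the new cube on the other, so they
  -- share only `F` and its edges.
  have hcell : ∀ f ∈ cubeBoundarySum K, (f j - F j) * η ≤ 0 ∧
      ∀ g ∈ f.facets, (g j - F j) * η ≤ 0 := by
    intro f hf
    obtain ⟨c, hc, hfc⟩ := exists_of_mem_cubeBoundarySum hf
    exact slab_of_mem_facets hη hFj (hslab c hc) hfc
  have hJ : Joinable (cubeBoundarySum K) y.facets F := by
    refine ⟨hFT, hFym, ?_, ?_, ?_⟩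
    · intro f hf hfy
      obtain ⟨a, ha, ha1, ha2⟩ := Cell.mem_facets_iff.1 hfy
      have h1 := (hcell f hf).1
      have haj : a = j := by
        by_contra hne
        have := ha2 j (Ne.symm hne)
        rcases hη with rfl | rfl <;> omega
      subst haj
      ext m
      by_cases hm : m = a
      · subst hm; rcases hη with rfl | rfl <;> omega
      · rw [ha2 m hm, hym m hm]
    · intro f hf z hz g hgf hgz
      have h1 := (hcell f hf).2 g hgf
      refine mem_facets_of_coord hz hgz hFym (j := j) (by rw [hyj]; omega) ?_
      have h2 : (g j = y j ∨ g j = y j + 1 ∨ g j = y j - 1) := by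
        obtain ⟨a, b, -, -, -, ha1, hb1, h⟩ := exists_of_mem_facets_facets hz hgz
        by_cases hja : j = a
        · subst hja; tauto
        · by_cases hjb : j = b
          · subst hjb; tauto
          · exact Or.inl (h j hja hjb)
      rw [hyj] at h2
      rcases hη with rfl | rfl <;> omega
    · intro g hg
      exact exists_cofaces_facets_eq hFym hg
  have hbd : cubeBoundarySum (insert y K) = joinFaces (cubeBoundarySum K) y.facets F := by
    rw [hJ.joinFaces_eq, insert_eq, cubeBoundarySum_union (by simpa using hyK),
      cubeBoundarySum_singleton, symmDiff_comm]
  set N := y.facets.erase F with hN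
  have hopp : y + Pi.single j η ∈ N := by
    rw [hN, mem_erase]
    refine ⟨?_, Cell.add_single_mem_facets hyodd hη⟩
    intro he
    have := congrFun he j
    simp [hy] at this
    omega
  -- The facet of the new cube opposite to `F` touches all others. It keeps the new cube connected
  -- without `F`, and later also without its top.
  have hhub : ∀ z ∈ N, z = y + Pi.single j η ∨ ShareFacet z (y + Pi.single j η) := by
    intro z hz
    rw [hN, mem_erase] at hz
    have := eq_or_shareFacet_opposite (s := -η) hyodd (by omega) hz.2 (by rw [← hFy]; exact hz.1)
    simpa using this
  have hNc : Conn N ShareFacet := Conn.of_hub hopp hhub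
  have hsam : IsSAM k (2 * k * (insert y K).card + 2) (cubeBoundarySum (insert y K)) := by
    have hy' := isSAM_facets hk.le hydim
    rw [hbd, card_insert_of_notMem hyK]
    exact ⟨hJ.isXD h.sam.toIsXD hy'.dim_eq hy'.card_eq (by ring) ⟨_, hopp⟩ hNc,
      hJ.selfAvoiding h.sam.selfAvoiding hy'.selfAvoiding⟩
  have hclosed : boundary (cubeBoundarySum (insert y K)) = ∅ := by
    rw [hbd, hJ.boundary_eq, h.closed, boundary_facets, union_empty]
  set u := x + Pi.single 0 1 with hu
  have huT : u ∈ cubeBoundarySum K := h.top_mem hl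
  have hlT : l ∈ cubeBoundarySum K := h.base_mem hl
  have hu0 : u 0 = l 0 + 2 := by simp [hu, hx0]; ring
  have hlF : l ≠ F := fun he => by rw [← he] at hF0; omega
  have huF : u ≠ F := fun he => by rw [← he] at hF0; omega
  have hlu : l ≠ u := fun he => by rw [← he] at hu0; omega
  set W := ((cubeBoundarySum K).erase l).erase u with hW
  have hFW : F ∈ W := by simp [hW, hFT, huF.symm, hlF.symm]
  have hlN : l ∉ N := fun hn => by
    rw [hN, mem_erase] at hn
    exact hlF (hJ.inter l hlT hn.2)
  have huN : u ∉ N := fun hn => by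
    rw [hN, mem_erase] at hn
    exact huF (hJ.inter u huT hn.2)
  have hy0 : y 0 = l 0 + 1 := by rw [hym 0 hj0.symm, hF0]
  have hdim' : ∀ c ∈ insert y K, c.dim = k + 1 := by
    intro c hc
    rcases mem_insert.1 hc with rfl | hc
    exacts [hydim, h.dim c hc]
  have hheight' : ∀ c ∈ insert y K, c 0 = l 0 + 1 := by
    intro c hc
    rcases mem_insert.1 hc with rfl | hc
    exacts [hy0, h.height c hc]
  refine ⟨hyK, ⟨hdim', hheight', mem_insert_of_mem h.base, mem_insert_of_mem h.top, hsam, hclosed,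
    ?_⟩, ⟨hdim', hheight', mem_insert_of_mem h.base, mem_insert_self _ _, hsam, hclosed, ?_⟩⟩
  -- The lid stays on `x`: in the connected set `W` the face `F` is exchanged for the rest of the
  -- new cube.
  · have hset : ((cubeBoundarySum (insert y K)).erase l).erase u = W.erase F ∪ N := by
      rw [hbd]; exact erase_erase_joinFaces hlN huN
    rw [hset]
    refine Conn.glue h.conn hNc hFW ⟨_, hopp⟩ (fun _ _ _ _ h => h) (fun _ _ _ _ h => h) ?_
    intro z hz hzF
    obtain ⟨g, hg1, hg2⟩ : ShareFacet z F := hzF.elim id ShareFacet.symm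
    obtain ⟨v, hv, hvg⟩ := exists_cofaces_facets_eq hFym hg2
    have : v ∈ cofaces y.facets g := by simp [hvg]
    rw [mem_cofaces] at this
    exact ⟨v, by rw [hN, mem_erase]; exact ⟨hv, this.1⟩, g, hg1, this.2⟩
  · set w := y + Pi.single 0 1 with hw
    have hwN : w ∈ N := by
      rw [hN, mem_erase]
      refine ⟨?_, Cell.add_single_mem_facets (by rw [hy0]; exact hl.add_one) (Or.inl rfl)⟩
      intro he
      have := congrFun he 0
      simp [hw] at this
      omega
    have hwT : w ∉ cubeBoundarySum K := fun hT => by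
      rw [hN, mem_erase] at hwN
      exact hwN.1 (hJ.inter w hT hwN.2)
    -- The lid moves to `y`: its top `w` is missing from the patch, and `u` has to be connected to
    -- the rest separately.
    have hset : ((cubeBoundarySum (insert y K)).erase l).erase w =
        insert u (W.erase F ∪ N.erase w) := by
      rw [hbd]; exact erase_erase_joinFaces' hlN huN hwT huT hlu.symm huF
    rw [hset]
    have hopp' : y + Pi.single j η ∈ N.erase w := by
      rw [mem_erase]
      refine ⟨?_, hopp⟩
      intro he
      have := congrFun he j
      simp [hw, hj0] at this
      omega
    have hNc' : Conn (N.erase w) ShareFacet :=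
      Conn.of_hub hopp' fun z hz => hhub z (mem_of_mem_erase hz)
    have hc1 : Conn (W.erase F ∪ N.erase w) ShareFacet := by
      refine Conn.glue h.conn hNc' hFW ⟨_, hopp'⟩ (fun _ _ _ _ h => h) (fun _ _ _ _ h => h) ?_
      intro z hz hzF
      obtain ⟨g, hg1, hg2⟩ : ShareFacet z F := hzF.elim id ShareFacet.symm
      obtain ⟨v, hv, hvg⟩ := exists_cofaces_facets_eq hFym hg2
      have hv' : v ∈ cofaces y.facets g := by simp [hvg]
      rw [mem_cofaces] at hv'
      refine ⟨v, ?_, g, hg1, hv'.2⟩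
      rw [mem_erase, hN, mem_erase]
      refine ⟨?_, hv, hv'.1⟩
      rintro rfl
      -- A neighbour `z` of `F` would be cut off only if the face that replaces `F` at `g` were `w`.
      -- Then `g` is the upper edge of `F`, which also belongs to `u`, and the old tube would have
      -- three faces `z`, `F`, `u` at `g`.
      have hg0 : g 0 = l 0 + 2 := by
        obtain ⟨b, hb, hb1, hb2⟩ := Cell.mem_facets_iff.1 hv'.2
        have hw0 : w 0 = l 0 + 2 := by simp [hw, hy0]; ring
        have : b ≠ 0 := by
          rintro rfl
          rw [hw0] at hb
          grind
        rw [hb2 0 this.symm, hw0]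
      have hgu : g ∈ u.facets := by
        obtain ⟨b, hb, hb1, hb2⟩ := Cell.mem_facets_iff.1 hg2
        have hb0 : b = 0 := by
          by_contra hne
          have := hb2 0 (Ne.symm hne)
          omega
        subst hb0
        rw [Cell.mem_facets_iff]
        refine ⟨i, by simp [hu, hi0, hi], ?_, ?_⟩
        · rw [hb2 i hi0]; simp [hu, hi0]; omega
        · intro m hm
          by_cases hm0 : m = 0
          · subst hm0; rw [hg0, hu0]
          · rw [hb2 m hm0, hFx m hm]; simp [hu, hm0]
      have hzW : z ∈ W := mem_of_mem_erase hz
      rw [hW, mem_erase, mem_erase] at hzW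
      have hsub : ({z, F, u} : Finset (Cell d)) ⊆ cofaces (cubeBoundarySum K) g := by
        intro q hq
        simp only [mem_insert, mem_singleton] at hq
        rw [mem_cofaces]
        rcases hq with rfl | rfl | rfl
        exacts [⟨hzW.2.2, hg1⟩, ⟨hFT, hg2⟩, ⟨huT, hgu⟩]
      have hcard : ({z, F, u} : Finset (Cell d)).card = 3 :=
        card_eq_three.2 ⟨z, F, u, ne_of_mem_erase hz, hzW.1, huF.symm, rfl⟩
      have := card_le_card hsub
      have := h.sam.selfAvoiding g
      omega
    -- The cube `x` extends in at least three dimensions, so `u` has an edge in a direction `m`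
    -- other than that of `F`. The second face of the old tube at this edge is neither `l` nor `F`,
    -- and it connects `u` to the rest.
    obtain ⟨m, hm⟩ : ((x.halfInt.erase 0).erase i).Nonempty := by
      rw [← card_pos]
      have h1 : x.halfInt.card = k + 1 := h.dim x h.top
      have := pred_card_le_card_erase (s := x.halfInt) (a := 0)
      have := pred_card_le_card_erase (s := x.halfInt.erase 0) (a := i)
      omega
    rw [mem_erase, mem_erase, Cell.mem_halfInt] at hm
    obtain ⟨hmi, hm0, hmo⟩ := hm
    have hum : u m = x m := by simp [hu, hm0]
    have hg : u + Pi.single m 1 ∈ u.facets :=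
      Cell.add_single_mem_facets (by rw [hum]; exact hmo) (Or.inl rfl)
    obtain ⟨z, hzu, hz⟩ := h.exists_cofaces_eq huT hg
    have hz' : z ∈ cofaces (cubeBoundarySum K) (u + Pi.single m 1) := by simp [hz]
    rw [mem_cofaces] at hz'
    have hzl : z ≠ l := by
      rintro rfl
      obtain ⟨b, hb, hb1, hb2⟩ := Cell.mem_facets_iff.1 hz'.2
      have hb3 := hb2 0
      have e : (u + Pi.single m 1 : Cell d) 0 = z 0 + 2 := by simp [hm0.symm, hu0]
      grind
    have hzF : z ≠ F := by
      rintro rfl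
      obtain ⟨b, hb, hb1, hb2⟩ := Cell.mem_facets_iff.1 hz'.2
      have hb3 := hb2 0
      have hb4 := hb2 i
      have e : (u + Pi.single m 1 : Cell d) 0 = l 0 + 2 := by simp [hm0.symm, hu0]
      have e' : (u + Pi.single m 1 : Cell d) i = x i := by simp [Ne.symm hmi, hu, hi0]
      grind
    exact hc1.insert (s := z) (mem_union_left _ (by simp [hW, hzF, hzu, hzl, hz'.1]))
      ⟨_, hg, hz'.2⟩

end Tube

end Mid

end

/-! ### Tubes between given orientations that encode bits. -/

section

variable {d : ℕ}

/-- The sign encoded by a bit. -/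
def sgn (b : Bool) : ℤ := if b then -1 else 1

theorem sgn_eq (b : Bool) : sgn b = 1 ∨ sgn b = -1 := by cases b <;> simp [sgn]

theorem sgn_injective {b b' : Bool} (h : sgn b = sgn b') : b = b' := by
  cases b <;> cases b' <;> simp [sgn] at h <;> rfl

/-- Each dimension to be given up is matched with one to be gained, and common dimensions with
themselves, so that one cube of the tube can serve each dimension of the lower lid. -/
theorem exists_exchange {I J : Finset (Fin d)} (h : I.card = J.card) :
    ∃ σ : Fin d → Fin d, Set.InjOn σ I ∧ I.image σ = J ∧ ∀ i ∈ I, i ∈ J → σ i = i := by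
  classical
  -- The inclusion of `I ∩ J` extends to a bijection because the cardinalities agree.
  obtain ⟨e, he⟩ := Finset.exists_equiv_extend_of_card_eq (α := I) (t := J) (by simpa using h)
    (s := univ.filter fun i : I => i.1 ∈ J) (f := fun i => i.1)
    (by intro j hj; simp only [mem_image, mem_filter] at hj; obtain ⟨a, ha, rfl⟩ := hj; exact ha.2)
    (fun a _ b _ hab => Subtype.ext hab)
  refine ⟨fun i => if hi : i ∈ I then (e ⟨i, hi⟩).1 else i, ?_, ?_, ?_⟩
  · intro a ha b hb hab
    simp only [mem_coe] at ha hb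
    simp only [ha, hb, dif_pos] at hab
    simpa using e.injective (Subtype.ext hab)
  · ext j
    simp only [mem_image]
    constructor
    · rintro ⟨i, hi, rfl⟩
      simp [hi]
    · intro hj
      refine ⟨(e.symm ⟨j, hj⟩).1, (e.symm ⟨j, hj⟩).2, ?_⟩
      simp
  · intro i hi hj
    simp only [hi, dif_pos]
    exact he ⟨i, hi⟩ (by simpa using hj)

variable [NeZero d]

/-- A tube of `k + 1` cubes from the face `l` to a face with half-integer dimensions `J`, whose shape
encodes the bits `ε` on the half-integer dimensions of `l` and the bits `δ` on `J`. -/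
structure Mid (k : ℕ) (l : Cell d) (J : Finset (Fin d)) (ε δ : Fin d → Bool)
    (K : Finset (Cell d)) (x : Cell d) : Prop extends Tube k l K x where
  card : K.card = k + 1
  lid : (x + Pi.single 0 1).halfInt = J
  code_left : ∀ i ∈ l.halfInt, i ∉ J → x i = l i + sgn (ε i)
  code_right : ∀ j ∈ J, j ∉ l.halfInt → x j = l j + sgn (δ j)
  code_exists : ∀ i ∈ l.halfInt, i ∈ J → ∃ c ∈ K, c i = l i + 2 * sgn (ε i)
  code_forall : ∀ i ∈ l.halfInt, i ∈ J → ∀ c ∈ K, c i ≠ l i - 2 * sgn (ε i)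
  code_move : ∀ i ∈ l.halfInt, i ∈ J → (x i ≠ l i ↔ δ i = true)

/-- A dimension of only one lid shows its bit as the sign of the displacement of the final cube. For
a common dimension, `ε` is the side towards which the tube extends, and `δ` tells whether the lid
was moved there. -/
theorem Mid.code_unique {k : ℕ} {l : Cell d} {J : Finset (Fin d)} {ε δ ε' δ' : Fin d → Bool}
    {K : Finset (Cell d)} {x : Cell d} (h : Mid k l J ε δ K x) (h' : Mid k l J ε' δ' K x) :
    (∀ i ∈ l.halfInt, ε i = ε' i) ∧ ∀ j ∈ J, δ j = δ' j := by
  constructor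
  · intro i hi
    by_cases hJ : i ∈ J
    · obtain ⟨c, hc, e⟩ := h.code_exists i hi hJ
      have := h'.code_forall i hi hJ c hc
      apply sgn_injective
      rcases sgn_eq (ε i) with h1 | h1 <;> rcases sgn_eq (ε' i) with h2 | h2 <;> omega
    · have := h.code_left i hi hJ
      have := h'.code_left i hi hJ
      exact sgn_injective (by omega)
  · intro j hj
    by_cases hI : j ∈ l.halfInt
    · have h1 := h.code_move j hI hj
      rw [h'.code_move j hI hj] at h1
      exact (Bool.eq_iff_iff.2 h1).symm
    · have := h.code_right j hj hI
      have := h'.code_right j hj hI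
      exact sgn_injective (by omega)

/-- Induction on the set `s` of treated dimensions, with one new cube for each. For `i ∉ J` the cube
is attached to the side given by `ε i` and extends along `σ i` with sign `δ (σ i)`, which exchanges
`i` for `σ i`. For `i ∈ J` it goes straight on towards `ε i`, and `δ i` selects the cube that
carries the lid. The invariant that all cubes still agree with `l` in the untreated coordinates `i`
and `σ i` guarantees that the next cube goes into free space. -/
theorem exists_mid_aux {k : ℕ} (hk : 1 < k) {l : Cell d} (hl : Even (l 0)) (hd : l.dim = k)
    {J : Finset (Fin d)} (h0 : 0 ∉ J) (ε δ : Fin d → Bool)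
    {σ : Fin d → Fin d} (hinj : Set.InjOn σ l.halfInt) (himg : l.halfInt.image σ = J)
    (hfix : ∀ i ∈ l.halfInt, i ∈ J → σ i = i) (s : Finset (Fin d)) :
    s ⊆ l.halfInt → ∃ K x, Tube k l K x ∧ K.card = s.card + 1 ∧
      (∀ m, Odd (x m) ↔ m = 0 ∨ (m ∈ l.halfInt ∧ m ∉ s) ∨ m ∈ s.image σ) ∧
      (∀ i ∈ l.halfInt, i ∉ s → ∀ c ∈ K, c i = l i ∧ c (σ i) = l (σ i)) ∧
      (∀ i ∈ s, i ∉ J → x i = l i + sgn (ε i) ∧ x (σ i) = l (σ i) + sgn (δ (σ i))) ∧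
      (∀ i ∈ s, i ∈ J → (∃ c ∈ K, c i = l i + 2 * sgn (ε i)) ∧
        (∀ c ∈ K, c i ≠ l i - 2 * sgn (ε i)) ∧ (x i ≠ l i ↔ δ i = true)) := by
  have hI0 : 0 ∉ l.halfInt := by
    rw [Cell.mem_halfInt]; exact Int.not_odd_iff_even.2 hl
  have hσJ : ∀ i ∈ l.halfInt, σ i ∈ J := fun i hi => himg ▸ mem_image_of_mem σ hi
  induction s using Finset.induction_on with
  | empty =>
    intro _
    refine ⟨{l + Pi.single 0 1}, l + Pi.single 0 1, Tube.singleton hk hl hd, by simp, ?_, ?_,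
      by simp, by simp⟩
    · intro m
      by_cases hm : m = 0
      · subst hm; simp [hl.add_one]
      · simp [hm, Cell.mem_halfInt]
    · intro i hi _ c hc
      rw [mem_singleton] at hc
      subst hc
      have h1 : i ≠ 0 := fun h => hI0 (h ▸ hi)
      have h2 : σ i ≠ 0 := fun h => h0 (h ▸ hσJ i hi)
      simp [h1, h2]
  | insert i s his ih =>
    intro hs
    have hiI : i ∈ l.halfInt := hs (mem_insert_self _ _)
    have hsI : s ⊆ l.halfInt := fun m hm => hs (mem_insert_of_mem hm)
    obtain ⟨K, x, hT, hcard, hodd, hfree, hc1, hc2⟩ := ih hsI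
    have hi0 : i ≠ 0 := fun h => hI0 (h ▸ hiI)
    have hj0 : σ i ≠ 0 := fun h => h0 (h ▸ hσJ i hiI)
    have hio : Odd (l i) := Cell.mem_halfInt.1 hiI
    have hxi : x i = l i := (hfree i hiI his x hT.top).1
    have hxio : Odd (x i) := hxi ▸ hio
    have hne : ∀ i' ∈ l.halfInt, i' ≠ i → σ i' ≠ σ i := fun i' h' hne he => hne (hinj h' hiI he)
    -- All cubes have coordinate `l i` in direction `i`, so the side is a facet in this direction,
    -- and its other coordinates determine the cube.
    have huniq : ∀ c ∈ K, x + Pi.single i (sgn (ε i)) ∈ c.facets → c = x := by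
      intro c hc hF
      obtain ⟨a, ha, ha1, ha2⟩ := Cell.mem_facets_iff.1 hF
      have hci := (hfree i hiI his c hc).1
      have hai : a = i := by
        by_contra hcon
        have := ha2 i (Ne.symm hcon)
        simp at this
        rcases sgn_eq (ε i) with h | h <;> omega
      subst hai
      ext m
      by_cases hm : m = a
      · rw [hm, hci, hxi]
      · have := ha2 m hm
        simp [hm] at this
        exact this.symm
    have hse := sgn_eq (ε i)
    by_cases hiJ : i ∈ J
    · have hσi := hfix i hiI hiJ
      have hFi : (x + Pi.single i (sgn (ε i)) : Cell d) i = l i + sgn (ε i) := by simp [hxi]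
      obtain ⟨hyK, hT1, hT2⟩ := hT.step hk hl (F := x + Pi.single i (sgn (ε i))) (i := i) (j := i)
        (η := sgn (ε i)) hi0 hxio (by rw [hFi]; omega) (fun m hm => by simp [hm]) hi0 hse
        (by rw [hFi]; rcases hse with h | h <;> rw [h] <;> grind)
        (fun c hc => by rw [hFi, (hfree i hiI his c hc).1]; omega) huniq
      set y : Cell d := x + Pi.single i (sgn (ε i)) + Pi.single i (sgn (ε i)) with hy
      have hyi : y i = l i + 2 * sgn (ε i) := by simp [hy, hxi]; ring
      have hym : ∀ m, m ≠ i → y m = x m := fun m hm => by simp [hy, hm]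
      have himg' : ∀ m, m ∈ (insert i s).image σ ↔ m = i ∨ m ∈ s.image σ := by
        intro m; rw [image_insert, mem_insert, hσi]
      have hoddy : ∀ m, Odd (y m) ↔ Odd (x m) := by
        intro m
        by_cases hm : m = i
        · subst hm
          rw [hyi, hxi]
          constructor <;> intro _ <;> grind
        · rw [hym m hm]
      have hodd' : ∀ m, Odd (x m) ↔
          m = 0 ∨ (m ∈ l.halfInt ∧ m ∉ insert i s) ∨ m ∈ (insert i s).image σ := by
        intro m
        rw [hodd, himg', mem_insert]
        by_cases hm : m = i
        · subst hm; simp [hiI, his]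
        · simp [hm]
      have hfree' : ∀ i' ∈ l.halfInt, i' ∉ insert i s → ∀ c ∈ insert y K,
          c i' = l i' ∧ c (σ i') = l (σ i') := by
        intro i' hi' hni c hc
        rw [mem_insert, not_or] at hni
        have h1 := hne i' hi' hni.1
        rw [hσi] at h1
        rcases mem_insert.1 hc with rfl | hc
        · rw [hym _ hni.1, hym _ h1]
          exact hfree i' hi' hni.2 x hT.top
        · exact hfree i' hi' hni.2 c hc
      have hσne : ∀ i' ∈ s, i' ≠ i ∧ σ i' ≠ i := by
        intro i' hi'
        have h1 : i' ≠ i := fun h => his (h ▸ hi')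
        have := hne i' (hsI hi') h1
        rw [hσi] at this
        exact ⟨h1, this⟩
      -- The remaining conditions hold for either position `z` of the lid, provided that it agrees
      -- with `δ i`.
      have hall : ∀ z, (z = x ∨ z = y) → (z i ≠ l i ↔ δ i = true) →
          (∀ i' ∈ insert i s, i' ∉ J →
            z i' = l i' + sgn (ε i') ∧ z (σ i') = l (σ i') + sgn (δ (σ i'))) ∧
          (∀ i' ∈ insert i s, i' ∈ J → (∃ c ∈ insert y K, c i' = l i' + 2 * sgn (ε i')) ∧
            (∀ c ∈ insert y K, c i' ≠ l i' - 2 * sgn (ε i')) ∧ (z i' ≠ l i' ↔ δ i' = true)) := by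
        intro z hz hzi
        have hzm : ∀ m, m ≠ i → z m = x m := by
          intro m hm
          rcases hz with rfl | rfl
          exacts [rfl, hym m hm]
        constructor
        · intro i' hi' hJ'
          rcases mem_insert.1 hi' with rfl | hi'
          · exact absurd hiJ hJ'
          · rw [hzm _ (hσne i' hi').1, hzm _ (hσne i' hi').2]
            exact hc1 i' hi' hJ'
        · intro i' hi' hJ'
          rcases mem_insert.1 hi' with rfl | hi'
          · refine ⟨⟨y, mem_insert_self _ _, hyi⟩, ?_, hzi⟩
            intro c hc
            rcases mem_insert.1 hc with rfl | hc
            · rw [hyi]; omega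
            · rw [(hfree i' hiI his c hc).1]; omega
          · obtain ⟨⟨c, hc, hce⟩, h2, h3⟩ := hc2 i' hi' hJ'
            refine ⟨⟨c, mem_insert_of_mem hc, hce⟩, ?_, ?_⟩
            · intro c hc
              rcases mem_insert.1 hc with rfl | hc
              · rw [hym _ (hσne i' hi').1]; exact h2 x hT.top
              · exact h2 c hc
            · rw [hzm _ (hσne i' hi').1]; exact h3
      have hcard' : (insert y K).card = (insert i s).card + 1 := by
        rw [card_insert_of_notMem hyK, card_insert_of_notMem his, hcard]
      -- Both tubes consist of the same cubes; only the cube under the lid differs.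
      cases hδ : δ i with
      | true =>
        have := hall y (Or.inr rfl) (by rw [hyi, hδ]; simp; omega)
        exact ⟨_, _, hT2, hcard', fun m => (hoddy m).trans (hodd' m), hfree', this⟩
      | false =>
        have := hall x (Or.inl rfl) (by rw [hxi, hδ]; simp)
        exact ⟨_, _, hT1, hcard', hodd', hfree', this⟩
    · have hji : σ i ≠ i := fun h => hiJ (h ▸ hσJ i hiI)
      have hjI : σ i ∉ l.halfInt := fun h => by
        have := hfix _ h (hσJ i hiI)
        exact hji (hinj h hiI this)
      have hje : Even (l (σ i)) := by
        rw [Cell.mem_halfInt] at hjI; exact Int.not_odd_iff_even.1 hjI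
      have hxj : x (σ i) = l (σ i) := (hfree i hiI his x hT.top).2
      have hFi : (x + Pi.single i (sgn (ε i)) : Cell d) i = l i + sgn (ε i) := by simp [hxi]
      have hFj : (x + Pi.single i (sgn (ε i)) : Cell d) (σ i) = l (σ i) := by simp [hxj, hji]
      have hsd := sgn_eq (δ (σ i))
      obtain ⟨hyK, -, hT2⟩ := hT.step hk hl (F := x + Pi.single i (sgn (ε i))) (i := i) (j := σ i)
        (η := sgn (δ (σ i))) hi0 hxio (by rw [hFi]; omega) (fun m hm => by simp [hm]) hj0 hsd
        (by rw [hFj]; exact hje)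
        (fun c hc => Or.inl (by rw [hFj, (hfree i hiI his c hc).2])) huniq
      -- The corner: the centre is displaced by one in both `i` and `σ i`, so parity is lost in the
      -- first dimension and gained in the second.
      set y : Cell d := x + Pi.single i (sgn (ε i)) + Pi.single (σ i) (sgn (δ (σ i))) with hy
      have hyi : y i = l i + sgn (ε i) := by simp [hy, hxi, hji.symm]
      have hyj : y (σ i) = l (σ i) + sgn (δ (σ i)) := by simp [hy, hxj, hji]
      have hym : ∀ m, m ≠ i → m ≠ σ i → y m = x m := fun m hm hm' => by simp [hy, hm, hm']
      have hσ' : ∀ i' ∈ l.halfInt, i' ≠ i → i' ≠ σ i ∧ σ i' ≠ i ∧ σ i' ≠ σ i := by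
        intro i' hi' hni
        refine ⟨fun h => hjI (h ▸ hi'), fun h => hiJ (h ▸ hσJ i' hi'), hne i' hi' hni⟩
      refine ⟨_, _, hT2, ?_, ?_, ?_, ?_, ?_⟩
      · rw [card_insert_of_notMem hyK, card_insert_of_notMem his, hcard]
      · intro m
        rw [image_insert, mem_insert, mem_insert]
        by_cases hm : m = i
        · subst hm
          have h1 : ¬ Odd (y m) := by
            rw [hyi, Int.not_odd_iff_even]
            rcases hse with h | h <;> rw [h] <;> grind
          have h2 : m ∉ s.image σ := fun h => by
            obtain ⟨i', hi', he⟩ := mem_image.1 h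
            exact hiJ (he ▸ hσJ i' (hsI hi'))
          simp [h1, h2, hi0, hji.symm]
        · by_cases hm' : m = σ i
          · subst hm'
            have h1 : Odd (y (σ i)) := by
              rw [hyj]
              rcases hsd with h | h <;> rw [h] <;> grind
            simp [h1]
          · rw [hym m hm hm', hodd]
            simp [hm, hm']
      · intro i' hi' hni c hc
        rw [mem_insert, not_or] at hni
        have h1 := hσ' i' hi' hni.1
        rcases mem_insert.1 hc with rfl | hc
        · rw [hym _ hni.1 h1.1, hym _ h1.2.1 h1.2.2]
          exact hfree i' hi' hni.2 x hT.top
        · exact hfree i' hi' hni.2 c hc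
      · intro i' hi' hJ'
        rcases mem_insert.1 hi' with rfl | hi'
        · exact ⟨hyi, hyj⟩
        · have hni : i' ≠ i := fun h => his (h ▸ hi')
          have h1 := hσ' i' (hsI hi') hni
          rw [hym _ hni h1.1, hym _ h1.2.1 h1.2.2]
          exact hc1 i' hi' hJ'
      · intro i' hi' hJ'
        rcases mem_insert.1 hi' with rfl | hi'
        · exact absurd hJ' hiJ
        · have hni : i' ≠ i := fun h => his (h ▸ hi')
          have h1 := hσ' i' (hsI hi') hni
          obtain ⟨⟨c, hc, hce⟩, h2, h3⟩ := hc2 i' hi' hJ'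
          refine ⟨⟨c, mem_insert_of_mem hc, hce⟩, ?_, ?_⟩
          · intro c hc
            rcases mem_insert.1 hc with rfl | hc
            · rw [hym _ hni h1.1]; exact h2 x hT.top
            · exact h2 c hc
          · rw [hym _ hni h1.1]; exact h3

theorem exists_mid {k : ℕ} (hk : 1 < k) {l : Cell d} (hl : Even (l 0)) (hd : l.dim = k)
    {J : Finset (Fin d)} (hJ : J.card = k) (h0 : 0 ∉ J) (ε δ : Fin d → Bool) :
    ∃ K x, Mid k l J ε δ K x := by
  obtain ⟨σ, hinj, himg, hfix⟩ := exists_exchange (I := l.halfInt) (J := J) (by rw [hJ]; exact hd)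
  obtain ⟨K, x, hT, hcard, hodd, -, hc1, hc2⟩ :=
    exists_mid_aux hk hl hd h0 ε δ hinj himg hfix l.halfInt subset_rfl
  have hlid : (x + Pi.single 0 1).halfInt = J := by
    ext m
    rw [Cell.mem_halfInt]
    by_cases hm : m = 0
    · subst hm
      have : ¬ Odd ((x + Pi.single 0 1 : Cell d) 0) := by
        rw [Int.not_odd_iff_even, Pi.add_apply, Pi.single_eq_same, hT.height x hT.top]
        grind
      simp only [this, h0]
    · have : (x + Pi.single 0 1 : Cell d) m = x m := by simp [hm]
      rw [this, hodd, himg]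
      simp [hm]
  refine ⟨K, x, ⟨hT, ?_, hlid, fun i hi hiJ => (hc1 i hi hiJ).1, ?_,
    fun i hi hiJ => (hc2 i hi hiJ).1, fun i hi hiJ => (hc2 i hi hiJ).2.1,
    fun i hi hiJ => (hc2 i hi hiJ).2.2⟩⟩
  · rw [hcard]
    change l.dim + 1 = k + 1
    rw [hd]
  · intro j hj hjI
    rw [← himg] at hj
    obtain ⟨i, hi, rfl⟩ := mem_image.1 hj
    refine (hc1 i hi fun hiJ => hjI ?_).2
    rw [hfix i hi hiJ]; exact hi

end

/-! ### Invariance under translations and point reflections. -/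

section

variable {d : ℕ}

namespace Cell

/-- The translations by integer vectors (`u = 1`) and the point reflections (`u = -1`) of the
lattice, in doubled coordinates. -/
def affine (u : ℤˣ) (w : Fin d → ℤ) : Cell d ≃ Cell d where
  toFun c i := u * c i + 2 * w i
  invFun c i := u * (c i - 2 * w i)
  left_inv c := by
    ext i; rcases Int.units_eq_one_or u with rfl | rfl <;> simp
  right_inv c := by
    ext i; rcases Int.units_eq_one_or u with rfl | rfl <;> simp

theorem affine_apply (u : ℤˣ) (w : Fin d → ℤ) (c : Cell d) (i : Fin d) :
    affine u w c i = u * c i + 2 * w i := rfl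

theorem affine_one (w : Fin d → ℤ) : ⇑(affine 1 w) = translate w := by
  ext c i; simp [affine_apply, translate]

theorem affine_neg (c : Cell d) : affine (-1) 0 c = -c := by
  ext i; simp [affine_apply]

variable (u : ℤˣ) (w : Fin d → ℤ)

theorem odd_affine {c : Cell d} {i : Fin d} : Odd (affine u w c i) ↔ Odd (c i) := by
  rw [affine_apply]
  rcases Int.units_eq_one_or u with rfl | rfl <;> simp [Int.odd_add]

theorem halfInt_affine (c : Cell d) : (affine u w c).halfInt = c.halfInt := by
  ext i; rw [mem_halfInt, mem_halfInt, odd_affine]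

theorem dim_affine (c : Cell d) : (affine u w c).dim = c.dim := by
  rw [dim, dim, halfInt_affine]

theorem affine_mem_facets {c g : Cell d} : affine u w g ∈ (affine u w c).facets ↔ g ∈ c.facets := by
  rw [mem_facets_iff, mem_facets_iff]
  refine exists_congr fun j => ?_
  rw [odd_affine]
  refine and_congr_right fun _ => ?_
  simp only [affine_apply]
  rcases Int.units_eq_one_or u with rfl | rfl
  · simp only [Units.val_one, one_mul]
    refine and_congr (by omega) (forall₂_congr fun m _ => by omega)
  · simp only [Units.val_neg, Units.val_one, neg_mul, one_mul]
    refine and_congr (by omega) (forall₂_congr fun m _ => by omega)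

end Cell

open Cell

section Invariance

variable (u : ℤˣ) (w : Fin d → ℤ)

theorem mem_image_affine {S : Finset (Cell d)} {x : Cell d} :
    affine u w x ∈ S.image (affine u w) ↔ x ∈ S := by
  rw [mem_image]
  exact ⟨fun ⟨y, hy, he⟩ => (affine u w).injective he ▸ hy, fun h => ⟨x, h, rfl⟩⟩

theorem cofaces_image (S : Finset (Cell d)) (g : Cell d) :
    cofaces (S.image (affine u w)) (affine u w g) = (cofaces S g).image (affine u w) := by
  ext y
  obtain ⟨x, rfl⟩ := (affine u w).surjective y
  rw [mem_cofaces, mem_image_affine, mem_image_affine, mem_cofaces, affine_mem_facets]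

theorem card_cofaces_image (S : Finset (Cell d)) (g : Cell d) :
    (cofaces (S.image (affine u w)) (affine u w g)).card = (cofaces S g).card := by
  rw [cofaces_image, card_image_of_injective _ (affine u w).injective]

theorem shareFacet_affine {x y : Cell d} :
    ShareFacet (affine u w x) (affine u w y) ↔ ShareFacet x y := by
  constructor
  · rintro ⟨g, h1, h2⟩
    obtain ⟨g, rfl⟩ := (affine u w).surjective g
    exact ⟨g, (affine_mem_facets u w).1 h1, (affine_mem_facets u w).1 h2⟩
  · rintro ⟨g, h1, h2⟩
    exact ⟨_, (affine_mem_facets u w).2 h1, (affine_mem_facets u w).2 h2⟩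

theorem Conn.image {S : Finset (Cell d)} {R R' : Cell d → Cell d → Prop} (hS : Conn S R)
    (h : ∀ x ∈ S, ∀ y ∈ S, R x y → R' (affine u w x) (affine u w y)) :
    Conn (S.image (affine u w)) R' := by
  intro p hp x hx y hy
  obtain ⟨x, hx', rfl⟩ := mem_image.1 hx
  obtain ⟨y, hy', rfl⟩ := mem_image.1 hy
  exact hS (fun z => p (affine u w z)) (fun a ha b hb hab =>
    hp _ (mem_image_of_mem _ ha) _ (mem_image_of_mem _ hb) (h a ha b hb hab)) x hx' y hy'

theorem IsXD.image {k n : ℕ} {S : Finset (Cell d)} (h : IsXD k n S) :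
    IsXD k n (S.image (affine u w)) := by
  have hc := (isConnectedVia_iff fun _ _ => ShareFacet.symm).1 h.connected
  refine ⟨?_, ?_, (isConnectedVia_iff fun _ _ => ShareFacet.symm).2 ⟨hc.1.image _,
    hc.2.image u w fun x _ y _ hxy => (shareFacet_affine u w).2 hxy⟩⟩
  · intro f hf
    obtain ⟨f, hf', rfl⟩ := mem_image.1 hf
    rw [dim_affine, h.dim_eq f hf']
  · rw [card_image_of_injective _ (affine u w).injective, h.card_eq]

theorem IsSAM.image {k n : ℕ} {S : Finset (Cell d)} (h : IsSAM k n S) :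
    IsSAM k n (S.image (affine u w)) := by
  refine ⟨h.toIsXD.image u w, fun g => ?_⟩
  obtain ⟨g, rfl⟩ := (affine u w).surjective g
  rw [card_cofaces_image]; exact h.selfAvoiding g

theorem boundary_image (S : Finset (Cell d)) :
    boundary (S.image (affine u w)) = (boundary S).image (affine u w) := by
  ext g
  obtain ⟨g, rfl⟩ := (affine u w).surjective g
  rw [mem_boundary, card_cofaces_image, mem_image_affine, mem_boundary]

theorem facets_image (c : Cell d) : (affine u w c).facets = c.facets.image (affine u w) := by
  ext g
  obtain ⟨g, rfl⟩ := (affine u w).surjective g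
  rw [affine_mem_facets, mem_image_affine]

theorem cubeBoundarySum_image (K : Finset (Cell d)) :
    cubeBoundarySum (K.image (affine u w)) = (cubeBoundarySum K).image (affine u w) := by
  ext g
  obtain ⟨g, rfl⟩ := (affine u w).surjective g
  rw [mem_cubeBoundarySum, card_cofaces_image, mem_image_affine, mem_cubeBoundarySum]

end Invariance

/-! ### Components of the boundary under disjoint union and replacement. -/

section Components

/-- The number of connected components of a set of cells, two of them being adjacent if they
neighbour a common cell. -/
noncomputable def numComp (V : Finset (Cell d)) : ℕ :=
  Nat.card (SimpleGraph.fromRel fun g g' : V => ShareFacet g.1 g'.1).ConnectedComponent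

theorem numBoundaryComponents_eq (S : Finset (Cell d)) :
    numBoundaryComponents S = numComp (boundary S) := rfl

theorem numComp_image (u : ℤˣ) (w : Fin d → ℤ) (V : Finset (Cell d)) :
    numComp (V.image (affine u w)) = numComp V := by
  refine (Nat.card_congr (SimpleGraph.Iso.connectedComponentEquiv ⟨(affine u w).subtypeEquiv
    fun x => (mem_image_affine u w).symm, ?_⟩)).symm
  intro a b
  simp only [SimpleGraph.fromRel_adj, Equiv.subtypeEquiv_apply, shareFacet_affine, ne_eq,
    EmbeddingLike.apply_eq_iff_eq, Subtype.ext_iff]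

theorem SimpleGraph.ConnectedComponent.exists_lift {V β : Type*} {G : SimpleGraph V} (f : V → β)
    (h : ∀ v w, G.Adj v w → f v = f w) :
    ∃ F : G.ConnectedComponent → β, ∀ v, F (G.connectedComponentMk v) = f v := by
  refine ⟨SimpleGraph.ConnectedComponent.lift f fun v w p _ => ?_, fun v => rfl⟩
  induction p with
  | nil => rfl
  | cons hadj _ ih => exact (h _ _ hadj).trans (ih (by simp_all [SimpleGraph.Walk.isPath_def]))

/-- The vertex maps need to be inverse to each other only on components, so a vertex may be
collapsed or represented by an arbitrary member of a connected set. -/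
theorem card_connectedComponent_eq {V W : Type*} {G : SimpleGraph V} {H : SimpleGraph W}
    (f : V → H.ConnectedComponent) (f' : W → G.ConnectedComponent)
    (hf : ∀ v w, G.Adj v w → f v = f w) (hf' : ∀ v w, H.Adj v w → f' v = f' w)
    (h1 : ∀ v, ∃ w, f v = H.connectedComponentMk w ∧ f' w = G.connectedComponentMk v)
    (h2 : ∀ w, ∃ v, f' w = G.connectedComponentMk v ∧ f v = H.connectedComponentMk w) :
    Nat.card G.ConnectedComponent = Nat.card H.ConnectedComponent := by
  obtain ⟨F, hF⟩ := SimpleGraph.ConnectedComponent.exists_lift f hf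
  obtain ⟨F', hF'⟩ := SimpleGraph.ConnectedComponent.exists_lift f' hf'
  refine Nat.card_congr ⟨F, F', ?_, ?_⟩
  · intro c
    induction c using SimpleGraph.ConnectedComponent.ind with
    | h v =>
      obtain ⟨w, h3, h4⟩ := h1 v
      rw [hF, h3, hF', h4]
  · intro c
    induction c using SimpleGraph.ConnectedComponent.ind with
    | h v =>
      obtain ⟨w, h3, h4⟩ := h2 v
      rw [hF', h3, hF, h4]

theorem numComp_union {V W : Finset (Cell d)} (hd : Disjoint V W)
    (h : ∀ x ∈ V, ∀ y ∈ W, ¬ ShareFacet x y) : numComp (V ∪ W) = numComp V + numComp W := by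
  rw [numComp, numComp, numComp, ← Nat.card_sum]
  set G := SimpleGraph.fromRel fun g g' : (V ∪ W : Finset (Cell d)) => ShareFacet g.1 g'.1
  set GV := SimpleGraph.fromRel fun g g' : V => ShareFacet g.1 g'.1
  set GW := SimpleGraph.fromRel fun g g' : W => ShareFacet g.1 g'.1
  have hW : ∀ x : (V ∪ W : Finset (Cell d)), x.1 ∉ V → x.1 ∈ W := fun x hx =>
    (mem_union.1 x.2).resolve_left hx
  obtain ⟨F, hF⟩ := SimpleGraph.ConnectedComponent.exists_lift (G := G)
    (fun x => if hx : x.1 ∈ V then (Sum.inl (GV.connectedComponentMk ⟨x.1, hx⟩) :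
      GV.ConnectedComponent ⊕ GW.ConnectedComponent)
      else Sum.inr (GW.connectedComponentMk ⟨x.1, hW x hx⟩)) (by
    intro v w hvw
    simp only [G, SimpleGraph.fromRel_adj, ne_eq, Subtype.ext_iff] at hvw
    have hs : ShareFacet v.1 w.1 := hvw.2.elim id ShareFacet.symm
    by_cases hv : v.1 ∈ V <;> by_cases hw : w.1 ∈ V
    · simp only [hv, hw, dif_pos, Sum.inl.injEq]
      refine SimpleGraph.ConnectedComponent.eq.2 (SimpleGraph.Adj.reachable ?_)
      simp only [GV, SimpleGraph.fromRel_adj, ne_eq, Subtype.ext_iff]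
      exact hvw
    · exact absurd hs (h _ hv _ (hW w hw))
    · exact absurd hs.symm (h _ hw _ (hW v hv))
    · simp only [hv, hw, dif_neg, not_false_eq_true, Sum.inr.injEq]
      refine SimpleGraph.ConnectedComponent.eq.2 (SimpleGraph.Adj.reachable ?_)
      simp only [GW, SimpleGraph.fromRel_adj, ne_eq, Subtype.ext_iff]
      exact hvw)
  obtain ⟨FV, hFV⟩ := SimpleGraph.ConnectedComponent.exists_lift (G := GV)
    (fun x => G.connectedComponentMk ⟨x.1, mem_union_left _ x.2⟩) (by
    intro v w hvw
    simp only [GV, SimpleGraph.fromRel_adj, ne_eq, Subtype.ext_iff] at hvw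
    refine SimpleGraph.ConnectedComponent.eq.2 (SimpleGraph.Adj.reachable ?_)
    simp only [G, SimpleGraph.fromRel_adj, ne_eq, Subtype.ext_iff]
    exact hvw)
  obtain ⟨FW, hFW⟩ := SimpleGraph.ConnectedComponent.exists_lift (G := GW)
    (fun x => G.connectedComponentMk ⟨x.1, mem_union_right _ x.2⟩) (by
    intro v w hvw
    simp only [GW, SimpleGraph.fromRel_adj, ne_eq, Subtype.ext_iff] at hvw
    refine SimpleGraph.ConnectedComponent.eq.2 (SimpleGraph.Adj.reachable ?_)
    simp only [G, SimpleGraph.fromRel_adj, ne_eq, Subtype.ext_iff]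
    exact hvw)
  refine Nat.card_congr ⟨F, Sum.elim FV FW, ?_, ?_⟩
  · intro c
    induction c using SimpleGraph.ConnectedComponent.ind with
    | h v =>
      rw [hF]
      by_cases hv : v.1 ∈ V
      · simp only [hv, dif_pos, Sum.elim_inl, hFV]
      · simp only [hv, dif_neg, not_false_eq_true, Sum.elim_inr, hFW]
  · rintro (c | c)
    · induction c using SimpleGraph.ConnectedComponent.ind with
      | h v => simp only [Sum.elim_inl, hFV, hF, v.2, dif_pos]
    · induction c using SimpleGraph.ConnectedComponent.ind with
      | h v =>
        have : v.1 ∉ V := fun hv => Finset.disjoint_left.1 hd hv v.2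
        simp only [Sum.elim_inr, hFW, hF, this, dif_neg, not_false_eq_true]

/-- Replacing a cell `g` by a connected set `P` with the same adjacent cells. -/
theorem numComp_replace {V P : Finset (Cell d)} {g : Cell d} (hg : g ∈ V) (hP : P.Nonempty)
    (hc : Conn P ShareFacet) (hd : ∀ x ∈ V.erase g, x ∉ P)
    (h1 : ∀ x ∈ V.erase g, ShareFacet x g → ∃ q ∈ P, ShareFacet x q)
    (h2 : ∀ x ∈ V.erase g, ∀ q ∈ P, ShareFacet x q → ShareFacet x g) :
    numComp (V.erase g ∪ P) = numComp V := by
  rw [numComp, numComp]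
  set G := SimpleGraph.fromRel fun g' g'' : (V.erase g ∪ P : Finset (Cell d)) =>
    ShareFacet g'.1 g''.1
  set H := SimpleGraph.fromRel fun g g' : V => ShareFacet g.1 g'.1
  have hG : ∀ a b : (V.erase g ∪ P : Finset (Cell d)), ShareFacet a.1 b.1 →
      G.connectedComponentMk a = G.connectedComponentMk b := by
    intro a b hab
    by_cases he : a = b
    · rw [he]
    · exact SimpleGraph.ConnectedComponent.eq.2 (SimpleGraph.Adj.reachable
        (by simp only [G, SimpleGraph.fromRel_adj]; exact ⟨he, Or.inl hab⟩))
  have hH : ∀ a b : V, ShareFacet a.1 b.1 →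
      H.connectedComponentMk a = H.connectedComponentMk b := by
    intro a b hab
    by_cases he : a = b
    · rw [he]
    · exact SimpleGraph.ConnectedComponent.eq.2 (SimpleGraph.Adj.reachable
        (by simp only [H, SimpleGraph.fromRel_adj]; exact ⟨he, Or.inl hab⟩))
  have hP' : ∀ q, ∀ hq : q ∈ P, ∀ r, ∀ hr : r ∈ P,
      G.connectedComponentMk ⟨q, mem_union_right _ hq⟩ =
        G.connectedComponentMk ⟨r, mem_union_right _ hr⟩ := by
    intro q hq r hr
    have := hc (fun z => ∃ hz : z ∈ P, G.connectedComponentMk ⟨z, mem_union_right _ hz⟩ =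
      G.connectedComponentMk ⟨r, mem_union_right _ hr⟩) ?_ r hr q hq
    · obtain ⟨_, h⟩ := this.1 ⟨hr, rfl⟩
      exact h
    · intro x hx y hy hxy
      have e := hG ⟨x, mem_union_right _ hx⟩ ⟨y, mem_union_right _ hy⟩ hxy
      constructor
      · rintro ⟨_, h⟩; exact ⟨hy, e ▸ h⟩
      · rintro ⟨_, h⟩; exact ⟨hx, e.symm ▸ h⟩
  obtain ⟨q₀, hq₀⟩ := hP
  have hV : ∀ x : (V.erase g ∪ P : Finset (Cell d)), x.1 ∉ P → x.1 ∈ V := fun x hx =>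
    mem_of_mem_erase ((mem_union.1 x.2).resolve_right hx)
  have hV' : ∀ x : (V.erase g ∪ P : Finset (Cell d)), x.1 ∉ P → x.1 ∈ V.erase g := fun x hx =>
    (mem_union.1 x.2).resolve_right hx
  refine card_connectedComponent_eq
    -- One map collapses `P` to `g`, the other sends `g` to an arbitrary cell of `P`.
    (fun x => if hx : x.1 ∈ P then H.connectedComponentMk ⟨g, hg⟩
      else H.connectedComponentMk ⟨x.1, hV x hx⟩)
    (fun x => if hx : x.1 = g then G.connectedComponentMk ⟨q₀, mem_union_right _ hq₀⟩
      else G.connectedComponentMk ⟨x.1, mem_union_left _ (mem_erase.2 ⟨hx, x.2⟩)⟩) ?_ ?_ ?_ ?_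
  · intro v w hvw
    simp only [G, SimpleGraph.fromRel_adj] at hvw
    have hs : ShareFacet v.1 w.1 := hvw.2.elim id ShareFacet.symm
    by_cases hv : v.1 ∈ P <;> by_cases hw : w.1 ∈ P
    · simp only [hv, hw, dif_pos]
    · simp only [hv, hw, dif_pos, dif_neg, not_false_eq_true]
      exact (hH ⟨w.1, hV w hw⟩ ⟨g, hg⟩ (h2 w.1 (hV' w hw) v.1 hv hs.symm)).symm
    · simp only [hv, hw, dif_pos, dif_neg, not_false_eq_true]
      exact hH ⟨v.1, hV v hv⟩ ⟨g, hg⟩ (h2 v.1 (hV' v hv) w.1 hw hs)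
    · simp only [hv, hw, dif_neg, not_false_eq_true]
      exact hH ⟨v.1, hV v hv⟩ ⟨w.1, hV w hw⟩ hs
  · intro v w hvw
    simp only [H, SimpleGraph.fromRel_adj] at hvw
    have hs : ShareFacet v.1 w.1 := hvw.2.elim id ShareFacet.symm
    by_cases hv : v.1 = g <;> by_cases hw : w.1 = g
    · simp only [hv, hw, dif_pos]
    · simp only [hv, hw, dif_pos, dif_neg, not_false_eq_true]
      obtain ⟨q, hq, hwq⟩ := h1 w.1 (mem_erase.2 ⟨hw, w.2⟩) (hv ▸ hs.symm)
      rw [hP' q₀ hq₀ q hq]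
      exact (hG ⟨w.1, mem_union_left _ (mem_erase.2 ⟨hw, w.2⟩)⟩ ⟨q, mem_union_right _ hq⟩ hwq).symm
    · simp only [hv, hw, dif_pos, dif_neg, not_false_eq_true]
      obtain ⟨q, hq, hwq⟩ := h1 v.1 (mem_erase.2 ⟨hv, v.2⟩) (hw ▸ hs)
      rw [hP' q₀ hq₀ q hq]
      exact hG ⟨v.1, mem_union_left _ (mem_erase.2 ⟨hv, v.2⟩)⟩ ⟨q, mem_union_right _ hq⟩ hwq
    · simp only [hv, hw, dif_neg, not_false_eq_true]
      exact hG ⟨v.1, mem_union_left _ (mem_erase.2 ⟨hv, v.2⟩)⟩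
        ⟨w.1, mem_union_left _ (mem_erase.2 ⟨hw, w.2⟩)⟩ hs
  · intro v
    by_cases hv : v.1 ∈ P
    · refine ⟨⟨g, hg⟩, by simp only [hv, dif_pos], ?_⟩
      simp only [dif_pos]
      exact hP' q₀ hq₀ v.1 hv
    · refine ⟨⟨v.1, hV v hv⟩, by simp only [hv, dif_neg, not_false_eq_true], ?_⟩
      have : v.1 ≠ g := (mem_erase.1 (hV' v hv)).1
      simp only [this, dif_neg, not_false_eq_true]
  · intro v
    by_cases hv : v.1 = g
    · refine ⟨⟨q₀, mem_union_right _ hq₀⟩, by simp only [hv, dif_pos], ?_⟩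
      simp only [hq₀, dif_pos]
      congr 1
      exact Subtype.ext hv.symm
    · refine ⟨⟨v.1, mem_union_left _ (mem_erase.2 ⟨hv, v.2⟩)⟩,
        by simp only [hv, dif_neg, not_false_eq_true], ?_⟩
      have : v.1 ∉ P := hd _ (mem_erase.2 ⟨hv, v.2⟩)
      simp only [this, dif_neg, not_false_eq_true]

end Components

end

/-! ### Attaching single faces, and capping the highest face. -/

section

open Cell

variable {d : ℕ}

/-- The face `f` meets `S` in the single edge `g`, which is neighboured by the single face `c`
of `S`. -/
structure Attachable (S : Finset (Cell d)) (f g c : Cell d) : Prop where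
  mem : c ∈ S
  left : g ∈ c.facets
  right : g ∈ f.facets
  notMem : f ∉ S
  edge : ∀ x ∈ S, ∀ e, e ∈ x.facets → e ∈ f.facets → x = c ∧ e = g
  ridge : ∀ x ∈ S, ∀ e ∈ x.facets, ∀ e' ∈ f.facets, ∀ v ∈ e.facets, v ∈ e'.facets → v ∈ g.facets

namespace Attachable

variable {S : Finset (Cell d)} {f g c : Cell d}

theorem cofaces_self (h : Attachable S f g c) : cofaces (insert f S) g = {c, f} := by
  ext x
  rw [mem_cofaces, mem_insert, mem_insert, mem_singleton]
  constructor
  · rintro ⟨rfl | hx, hg⟩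
    · exact Or.inr rfl
    · exact Or.inl (h.edge x hx g hg h.right).1
  · rintro (rfl | rfl)
    · exact ⟨Or.inr h.mem, h.left⟩
    · exact ⟨Or.inl rfl, h.right⟩

theorem cofaces_left (h : Attachable S f g c) : cofaces S g = {c} := by
  ext x
  rw [mem_cofaces, mem_singleton]
  constructor
  · rintro ⟨hx, hg⟩; exact (h.edge x hx g hg h.right).1
  · rintro rfl; exact ⟨h.mem, h.left⟩

theorem cofaces_of_mem (h : Attachable S f g c) {e : Cell d} (he : e ∈ f.facets) (hne : e ≠ g) :
    cofaces S e = ∅ ∧ cofaces (insert f S) e = {f} := by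
  constructor
  · rw [eq_empty_iff_forall_notMem]
    intro x hx
    rw [mem_cofaces] at hx
    exact hne (h.edge x hx.1 e hx.2 he).2
  · ext x
    rw [mem_cofaces, mem_insert, mem_singleton]
    constructor
    · rintro ⟨rfl | hx, hg⟩
      · rfl
      · exact absurd (h.edge x hx e hg he).2 hne
    · rintro rfl; exact ⟨Or.inl rfl, he⟩

theorem cofaces_of_notMem {e : Cell d} (he : e ∉ f.facets) :
    cofaces (insert f S) e = cofaces S e := by
  ext x
  rw [mem_cofaces, mem_cofaces, mem_insert]
  constructor
  · rintro ⟨rfl | hx, hg⟩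
    exacts [absurd hg he, ⟨hx, hg⟩]
  · rintro ⟨hx, hg⟩; exact ⟨Or.inr hx, hg⟩

theorem ne (h : Attachable S f g c) : c ≠ f := fun e => h.notMem (e ▸ h.mem)

theorem isXD (h : Attachable S f g c) {k n : ℕ} (hS : IsXD k n S) (hf : f.dim = k) :
    IsXD k (n + 1) (insert f S) := by
  have hc := (isConnectedVia_iff fun _ _ => ShareFacet.symm).1 hS.connected
  refine ⟨?_, by rw [card_insert_of_notMem h.notMem, hS.card_eq],
    (isConnectedVia_iff fun _ _ => ShareFacet.symm).2 ⟨insert_nonempty _ _,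
      hc.2.insert h.mem ⟨g, h.right, h.left⟩⟩⟩
  intro x hx
  rcases mem_insert.1 hx with rfl | hx
  exacts [hf, hS.dim_eq x hx]

theorem selfAvoiding (h : Attachable S f g c) (hS : ∀ e, (cofaces S e).card ≤ 2) (e : Cell d) :
    (cofaces (insert f S) e).card ≤ 2 := by
  by_cases he : e ∈ f.facets
  · by_cases heg : e = g
    · rw [heg, h.cofaces_self]; exact card_le_two
    · rw [(h.cofaces_of_mem he heg).2]; simp
  · rw [cofaces_of_notMem he]; exact hS e

/-- In the boundary, `g` is replaced by the other edges of `f`. These are connected, each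
`(k-2)`-cell of `g` lies on one of them, and by `ridge` they meet the old boundary only where `g`
did. -/
theorem numBoundaryComponents_eq (h : Attachable S f g c) :
    numBoundaryComponents (insert f S) = numBoundaryComponents S := by
  have hb : boundary (insert f S) = (boundary S).erase g ∪ f.facets.erase g := by
    ext e
    rw [mem_union, mem_erase, mem_erase, mem_boundary, mem_boundary]
    by_cases he : e ∈ f.facets
    · by_cases heg : e = g
      · subst heg; rw [h.cofaces_self, card_pair h.ne]; simp
      · rw [(h.cofaces_of_mem he heg).2]; simp [he, heg]
    · have heg : e ≠ g := fun h' => he (h' ▸ h.right)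
      rw [cofaces_of_notMem he]; simp [he, heg]
  rw [_root_.numBoundaryComponents_eq, _root_.numBoundaryComponents_eq, hb]
  obtain ⟨j, s, hj, hs, hg⟩ := exists_of_mem_facets h.right
  -- The edge of `f` opposite to `g` touches all remaining edges of `f`.
  have hop : f + Pi.single j (-s) ∈ f.facets.erase g := by
    rw [mem_erase]
    refine ⟨fun he => ?_, add_single_mem_facets hj (by omega)⟩
    have := congrFun he j
    rw [hg] at this
    simp at this
    omega
  have hbd : ∀ x ∈ (boundary S).erase g, ∃ y ∈ S, x ∈ y.facets ∧ x ≠ g := by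
    intro x hx
    rw [mem_erase, mem_boundary] at hx
    obtain ⟨y, hy⟩ := card_pos.1 (by omega : 0 < (cofaces S x).card)
    rw [mem_cofaces] at hy
    exact ⟨y, hy.1, hy.2, hx.1⟩
  refine numComp_replace ?_ ⟨_, hop⟩ (Conn.of_hub hop ?_) ?_ ?_ ?_
  · rw [mem_boundary, h.cofaces_left, card_singleton]
  · intro x hx
    rw [mem_erase] at hx
    exact eq_or_shareFacet_opposite hj hs hx.2 (hg ▸ hx.1)
  · intro x hx hxf
    obtain ⟨y, hy, hxy, hne⟩ := hbd x hx
    exact hne (h.edge y hy x hxy (mem_of_mem_erase hxf)).2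
  · rintro x - ⟨v, hv1, hv2⟩
    obtain ⟨q, hq, he⟩ := exists_cofaces_facets_eq h.right hv2
    have : q ∈ cofaces f.facets v := by simp [he]
    rw [mem_cofaces] at this
    exact ⟨q, mem_erase.2 ⟨hq, this.1⟩, v, hv1, this.2⟩
  · rintro x hx q hq ⟨v, hv1, hv2⟩
    obtain ⟨y, hy, hxy, hne⟩ := hbd x hx
    exact ⟨v, hv1, h.ridge y hy x hxy q (mem_of_mem_erase hq) v hv1 hv2⟩

end Attachable

variable [NeZero d]

/-- The face `a` is the lexicographically largest face of `A`. -/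
def IsTopFace (A : Finset (Cell d)) (a : Cell d) : Prop := a ∈ A ∧ ∀ f ∈ A, toLex f ≤ toLex a

theorem height_le_of_toLex_le {f a : Cell d} (h : toLex f ≤ toLex a) : f 0 ≤ a 0 := by
  rcases h.eq_or_lt with h | ⟨i, hi, hlt⟩
  · rw [toLex.injective h]
  · rcases eq_or_ne i 0 with rfl | hne
    · exact le_of_lt hlt
    · exact le_of_eq (hi 0 (Fin.pos_iff_ne_zero.2 hne))

theorem IsTopFace.height_le {A : Finset (Cell d)} {a f : Cell d} (h : IsTopFace A a) (hf : f ∈ A) :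
    f 0 ≤ a 0 := height_le_of_toLex_le (h.2 f hf)

theorem exists_isTopFace {A : Finset (Cell d)} (h : A.Nonempty) : ∃ a, IsTopFace A a := by
  obtain ⟨a, ha, hm⟩ := A.exists_max_image (fun f => toLex f) h
  exact ⟨a, ha, hm⟩

/-- `l` is a horizontal face of `S`, all other faces of `S` are lower, and all edges of `S` at the
height of `l` are edges of `l`. -/
structure Lidded (S : Finset (Cell d)) (l : Cell d) : Prop where
  mem : l ∈ S
  even : Even (l 0)
  lt : ∀ x ∈ S, x ≠ l → x 0 < l 0
  edge : ∀ x ∈ S, ∀ g ∈ x.facets, l 0 ≤ g 0 → g ∈ l.facets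

theorem height_of_mem_facets {c g : Cell d} (h : g ∈ c.facets) :
    (g 0 = c 0 ∨ Odd (c 0) ∧ (g = c + Pi.single 0 1 ∨ g = c + Pi.single 0 (-1))) := by
  obtain ⟨j, s, hj, hs, rfl⟩ := exists_of_mem_facets h
  rcases eq_or_ne j 0 with rfl | hne
  · right; exact ⟨hj, by rcases hs with rfl | rfl <;> simp⟩
  · left; simp [hne.symm]

theorem height_bounds {c g : Cell d} (h : g ∈ c.facets) : c 0 - 1 ≤ g 0 ∧ g 0 ≤ c 0 + 1 := by
  rcases height_of_mem_facets h with h | ⟨-, rfl | rfl⟩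
  · omega
  · simp; omega
  · simp

theorem height_bounds' {c g v : Cell d} (h : g ∈ c.facets) (h' : v ∈ g.facets) :
    c 0 - 1 ≤ v 0 ∧ v 0 ≤ c 0 + 1 := by
  obtain ⟨a, b, -, -, -, ha, hb, hm⟩ := exists_of_mem_facets_facets h h'
  by_cases h0 : 0 = a
  · subst h0; omega
  · by_cases h1 : 0 = b
    · subst h1; omega
    · have := hm 0 h0 h1; omega

theorem height_eq_of_even {c g : Cell d} (h : g ∈ c.facets) (hc : Even (c 0)) : g 0 = c 0 := by
  rcases height_of_mem_facets h with h | ⟨h, -⟩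
  · exact h
  · exact absurd hc (Int.not_even_iff_odd.2 h)

theorem eq_top_of_height {c g : Cell d} (h : g ∈ c.facets) (hg : c 0 < g 0) :
    g = c + Pi.single 0 1 := by
  rcases height_of_mem_facets h with h | ⟨-, rfl | rfl⟩
  · omega
  · rfl
  · simp at hg

theorem top_mem_facets {c : Cell d} (hc : Odd (c 0)) : c + Pi.single 0 1 ∈ c.facets :=
  add_single_mem_facets hc (Or.inl rfl)

/-- No face of `S` is higher than `c`, so an edge of `S` at height `c 0 + 1` is the top of a face at
the height of `c`. The new face reaches down exactly to this height, where it has the single edge `c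
+ e_0`. -/
theorem attachable_up {S : Finset (Cell d)} {c : Cell d} (hc : c ∈ S) (hodd : Odd (c 0))
    (hS : ∀ x ∈ S, x 0 ≤ c 0) :
    Attachable S (c + Pi.single 0 2) (c + Pi.single 0 1) c := by
  have h0 : (c + Pi.single 0 2 : Cell d) 0 = c 0 + 2 := by simp
  have hg0 : (c + Pi.single 0 1 : Cell d) 0 = c 0 + 1 := by simp
  have hg : (c + Pi.single 0 1 : Cell d) = c + Pi.single 0 2 + Pi.single 0 (-1) := by
    rw [add_assoc, ← Pi.single_add]; rfl
  have hgf : (c + Pi.single 0 1 : Cell d) ∈ (c + Pi.single 0 2 : Cell d).facets := by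
    rw [hg]; exact add_single_mem_facets (by rw [h0]; grind) (Or.inr rfl)
  refine ⟨hc, top_mem_facets hodd, hgf, fun h => by have := hS _ h; omega, ?_, ?_⟩
  · intro x hx e hex hef
    have h1 := height_bounds hef
    have h2 := hS x hx
    have h3 := height_bounds hex
    have h4 := eq_top_of_height hex (by omega)
    rcases height_of_mem_facets hef with h5 | ⟨-, h5 | h5⟩
    · omega
    · have := congrFun h5 0
      rw [Pi.add_apply, h0, Pi.single_eq_same] at this
      omega
    · rw [← hg] at h5
      refine ⟨?_, h5⟩
      rw [h4] at h5
      exact add_right_cancel h5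
  · intro x hx e hex e' hef v hv hv'
    have h1 := height_bounds' hex hv
    have h2 := height_bounds' hef hv'
    have h3 := hS x hx
    exact mem_facets_of_coord hef hv' hgf (j := 0) (by omega) (by omega)

/-- All edges of the horizontal face are at height `c 0 + 1`, where `S` has only the top edge of
`c`. This needs `c` to be the only face at its height, unlike a further vertical step. -/
theorem attachable_lid {S : Finset (Cell d)} {c : Cell d} (hc : c ∈ S) (hodd : Odd (c 0))
    (hS : ∀ x ∈ S, x ≠ c → x 0 < c 0) {i : Fin d} (hi0 : i ≠ 0) (hi : ¬ Odd (c i)) :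
    Attachable S (c + Pi.single 0 1 + Pi.single i 1) (c + Pi.single 0 1) c ∧
      Lidded (insert (c + Pi.single 0 1 + Pi.single i 1) S) (c + Pi.single 0 1 + Pi.single i 1) ∧
      (c + Pi.single 0 1 + Pi.single i 1).dim = c.dim := by
  set g : Cell d := c + Pi.single 0 1 with hg
  set f : Cell d := g + Pi.single i 1 with hf
  have hg0 : g 0 = c 0 + 1 := by simp [hg]
  have hf0 : f 0 = c 0 + 1 := by simp [hf, hi0.symm, hg0]
  have hfi : f i = c i + 1 := by simp [hf, hg, hi0]
  have hfe : Even (f 0) := by rw [hf0]; grind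
  have hgf : g ∈ f.facets := by
    have : g = f + Pi.single i (-1) := by
      rw [hf, add_assoc, ← Pi.single_add, add_neg_cancel, Pi.single_zero, add_zero]
    rw [this]
    exact add_single_mem_facets (by rw [hfi]; grind) (Or.inr rfl)
  have hgc : g ∈ c.facets := top_mem_facets hodd
  have hx : ∀ x ∈ S, c 0 ≤ x 0 → x = c := fun x hx h => by
    by_contra hne
    have := hS x hx hne
    omega
  have hle : ∀ x ∈ S, x 0 ≤ c 0 := fun x hx => by
    by_cases h : x = c
    · rw [h]
    · exact (hS x hx h).le
  have hfS : f ∉ S := fun h => by have := hle f h; omega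
  refine ⟨⟨hc, hgc, hgf, hfS, ?_, ?_⟩, ⟨mem_insert_self _ _, hfe, ?_, ?_⟩, ?_⟩
  · intro x hxS e hex hef
    have h1 := height_eq_of_even hef hfe
    have h2 := height_bounds hex
    obtain rfl := hx x hxS (by omega)
    exact ⟨rfl, eq_top_of_height hex (by omega)⟩
  · intro x hxS e hex e' hef v hv hv'
    have h1 := height_eq_of_even hef hfe
    have h2 := height_eq_of_even hv' (h1 ▸ hfe)
    have h3 := height_bounds' hex hv
    obtain rfl := hx x hxS (by omega)
    exact mem_facets_of_coord hex hv hgc (j := 0) (by omega) (by omega)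
  · intro x hxS hne
    rcases mem_insert.1 hxS with rfl | hxS
    · exact absurd rfl hne
    · have := hle x hxS; omega
  · intro x hxS e he hle'
    rcases mem_insert.1 hxS with rfl | hxS
    · exact he
    · have h1 := height_bounds he
      obtain rfl := hx x hxS (by omega)
      rw [eq_top_of_height he (by omega)]
      exact hgf
  · have h1 := dim_of_mem_facets hgf
    have h2 := dim_of_mem_facets hgc
    omega

open Classical in
/-- A dimension other than the first that is not a half-integer dimension of `a`. -/
noncomputable def freeDim (a : Cell d) : Fin d :=
  if h : ∃ i, i ≠ 0 ∧ i ∉ a.halfInt then h.choose else 0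

/-- The horizontal face on top of the cube or of the buffer faces that are put on `a`. -/
noncomputable def lowLid (k : ℕ) (a : Cell d) : Cell d :=
  if a.Vertical then a + Pi.single 0 (2 * (2 * k - 1 : ℕ) : ℤ) + Pi.single 0 1 +
    Pi.single (freeDim a) 1 else a + Pi.single 0 2

/-- The stack of the first `t` faces above `a`. -/
def stack (a : Cell d) (t : ℕ) : Finset (Cell d) :=
  (range t).image fun s : ℕ => a + Pi.single 0 (2 * (s + 1 : ℕ) : ℤ)

/-- The cube put on `a` if `a` is horizontal. -/
def lowCubes (a : Cell d) : Finset (Cell d) := if a.Vertical then ∅ else {a + Pi.single 0 1}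

/-- The buffer faces put on `a` if `a` is vertical. -/
noncomputable def lowBuffer (k : ℕ) (a : Cell d) : Finset (Cell d) :=
  if a.Vertical then insert (lowLid k a) (stack a (2 * k - 1)) else ∅

/-- The faces to be added mod 2 at the face `a`. -/
noncomputable def low (k : ℕ) (a : Cell d) : Finset (Cell d) :=
  symmDiff (cubeBoundarySum (lowCubes a)) (lowBuffer k a)

theorem low_of_vertical {k : ℕ} {a : Cell d} (h : a.Vertical) :
    low k a = insert (lowLid k a) (stack a (2 * k - 1)) := by
  rw [low, lowCubes, lowBuffer, if_pos h, if_pos h, cubeBoundarySum_empty, ← bot_eq_empty,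
    bot_symmDiff]

theorem low_of_horizontal {k : ℕ} {a : Cell d} (h : ¬ a.Vertical) :
    low k a = (a + Pi.single 0 1).facets := by
  rw [low, lowCubes, lowBuffer, if_neg h, if_neg h, cubeBoundarySum_singleton, ← bot_eq_empty,
    symmDiff_bot]

theorem even_of_not_vertical {a : Cell d} (h : ¬ a.Vertical) : Even (a 0) :=
  Int.not_odd_iff_even.1 h

/-- The assumption `k < d` leaves a dimension that the vertical face does not span, so the default
value `0` of `freeDim` does not occur. -/
theorem freeDim_spec {k : ℕ} {a : Cell d} (ha : a.dim = k) (hkd : k < d) (h : a.Vertical) :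
    freeDim a ≠ 0 ∧ freeDim a ∉ a.halfInt := by
  have : ∃ i, i ≠ 0 ∧ i ∉ a.halfInt := by
    by_contra hcon
    push Not at hcon
    have : a.halfInt = univ := by
      ext i
      simp only [mem_univ, iff_true]
      rcases eq_or_ne i 0 with rfl | hi
      · exact mem_halfInt.2 h
      · exact hcon i hi
    rw [Cell.dim, this, card_univ, Fintype.card_fin] at ha
    omega
  rw [freeDim, dif_pos this]
  exact this.choose_spec

theorem mem_stack_height {a x : Cell d} {t : ℕ} (h : x ∈ stack a t) :
    a 0 + 2 ≤ x 0 ∧ x 0 ≤ a 0 + 2 * t := by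
  simp only [stack, mem_image, mem_range] at h
  obtain ⟨s, hs, rfl⟩ := h
  simp
  omega

theorem stack_succ (a : Cell d) (t : ℕ) :
    stack a (t + 1) = insert (a + Pi.single 0 (2 * (t + 1 : ℕ) : ℤ)) (stack a t) := by
  rw [stack, range_add_one, image_insert]; rfl

/-- Putting the buffer faces on a vertical top face one by one. -/
theorem low_induction {k : ℕ} (hk : 1 < k) (hkd : k < d) {A : Finset (Cell d)} {a : Cell d}
    (hA : IsTopFace A a) (hv : a.Vertical) (hd : a.dim = k) (M : Finset (Cell d) → ℕ → Prop)
    (h0 : M A 0)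
    (hs : ∀ S f g c t, Attachable S f g c → A ⊆ S → f.dim = k →
      (∀ x ∈ A, g ∈ x.facets → g = a + Pi.single 0 1) → M S t → M (insert f S) (t + 1)) :
    M (symmDiff A (low k a)) (2 * k) ∧ Lidded (symmDiff A (low k a)) (lowLid k a) ∧
      (lowLid k a).dim = k ∧ symmDiff A (low k a) = A ∪ low k a ∧
      ∀ x ∈ low k a, a 0 + 2 ≤ x 0 := by
  have hodd : Odd (a 0) := hv
  have hle := fun x hx => hA.height_le (f := x) hx
  have hdim : ∀ t : ℕ, (a + Pi.single 0 (2 * (t : ℕ) : ℤ)).dim = k := by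
    intro t
    have : (a + Pi.single 0 (2 * (t : ℕ) : ℤ)) = affine 1 (Pi.single 0 (t : ℤ)) a := by
      ext i
      rcases eq_or_ne i 0 with rfl | hi
      · simp [affine_apply]
      · simp [affine_apply, hi]
    rw [this, dim_affine, hd]
  have hz : ∀ t : ℕ, (a + Pi.single 0 (2 * (t : ℕ) : ℤ) : Cell d) 0 = a 0 + 2 * t := by
    intro t; simp
  have hstep : ∀ t, ∀ x ∈ A ∪ stack a t, x 0 ≤ a 0 + 2 * t := by
    intro t x hx
    rcases mem_union.1 hx with hx | hx
    · have := hle x hx; omega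
    · exact (mem_stack_height hx).2
  have hmem : ∀ t, a + Pi.single 0 (2 * (t : ℕ) : ℤ) ∈ A ∪ stack a t := by
    intro t
    cases t with
    | zero => simp [hA.1]
    | succ t => rw [stack_succ]; simp
  -- The property `M` is arbitrary, so that the same stacking serves sizes, boundary components and
  -- links.
  have hM : ∀ t, M (A ∪ stack a t) t := by
    intro t
    induction t with
    | zero => simpa [stack] using h0
    | succ t ih =>
      have hat := attachable_up (hmem t) (by rw [hz]; grind)
        (fun x hx => by rw [hz]; exact hstep t x hx)
      have e : a + Pi.single 0 (2 * (t : ℕ) : ℤ) + Pi.single 0 2 =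
          a + Pi.single 0 (2 * (t + 1 : ℕ) : ℤ) := by
        rw [add_assoc, ← Pi.single_add]; congr 2
      rw [e] at hat
      have := hs _ _ _ _ _ hat subset_union_left (hdim (t + 1)) ?_ ih
      · rwa [stack_succ, union_insert]
      · intro x hx hg
        have h1 := height_bounds hg
        have h2 := hle x hx
        have h3 : (a + Pi.single 0 (2 * (t : ℕ) : ℤ) + Pi.single 0 1 : Cell d) 0 =
          -- Only the first face of the column is attached at an edge of `A`.
          a 0 + 2 * t + 1 := by simp
        have : t = 0 := by omega
        subst this
        simp
  -- The column of `2k - 1` faces and the lid add `2k` faces, as many as a cube that replaces a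
  -- horizontal face.
  obtain ⟨r, hr⟩ : ∃ r, 2 * k - 1 = r + 1 := ⟨2 * k - 2, by omega⟩
  set c : Cell d := a + Pi.single 0 (2 * (2 * k - 1 : ℕ) : ℤ) with hc
  have hcz : c 0 = a 0 + 2 * (2 * k - 1 : ℕ) := hz _
  have hfree := freeDim_spec hd hkd hv
  have hci : ¬ Odd (c (freeDim a)) := by
    have : c (freeDim a) = a (freeDim a) := by simp [hc, hfree.1]
    rw [this]
    exact fun h => hfree.2 (mem_halfInt.2 h)
  -- The column is not empty, so its last face is alone at its height even if `A` has several faces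
  -- at the height of `a`.
  have hlt : ∀ x ∈ A ∪ stack a (2 * k - 1), x ≠ c → x 0 < c 0 := by
    intro x hx hne
    rw [hr, stack_succ, union_insert, mem_insert, ← hr] at hx
    rcases hx with rfl | hx
    · exact absurd rfl hne
    · have := hstep r x hx
      rw [hcz]
      omega
  obtain ⟨h1, h2, h3⟩ := attachable_lid (hmem (2 * k - 1)) (by rw [← hc, hcz]; grind) hlt
    hfree.1 hci
  have hlid : c + Pi.single 0 1 + Pi.single (freeDim a) 1 = lowLid k a := by
    rw [lowLid, if_pos hv]
  rw [← hc, hlid] at h1 h2 h3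
  have hlow : ∀ x ∈ low k a, a 0 + 2 ≤ x 0 := by
    intro x hx
    rw [low_of_vertical hv, mem_insert] at hx
    rcases hx with rfl | hx
    · rw [← hlid]
      have : (c + Pi.single 0 1 + Pi.single (freeDim a) 1 : Cell d) 0 = c 0 + 1 := by
        simp [hfree.1.symm]
      omega
    · exact (mem_stack_height hx).1
  have hsd : symmDiff A (low k a) = A ∪ low k a := by
    rw [Disjoint.symmDiff_eq_sup]
    · rfl
    · rw [Finset.disjoint_left]
      intro x hx hx'
      have := hle x hx
      have := hlow x hx'
      omega
  have hset : symmDiff A (low k a) = insert (lowLid k a) (A ∪ stack a (2 * k - 1)) := by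
    rw [hsd, low_of_vertical hv, union_insert]
  refine ⟨?_, hset ▸ h2, h3.trans (hdim _), hsd, hlow⟩
  rw [hset]
  have := hs _ _ _ _ _ h1 subset_union_left (h3.trans (hdim _)) ?_ (hM (2 * k - 1))
  · rwa [show 2 * k - 1 + 1 = 2 * k by omega] at this
  · intro x hx hg
    have h1 := height_bounds hg
    have h2 := hle x hx
    have h3 : (c + Pi.single 0 1 : Cell d) 0 = c 0 + 1 := by simp
    omega

/-- Putting a cube on a horizontal top face. -/
theorem low_joinable {k : ℕ} {A : Finset (Cell d)} {a : Cell d}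
    (hA : IsTopFace A a) (hv : ¬ a.Vertical) (hd : a.dim = k) :
    Joinable A (low k a) a ∧ Lidded (symmDiff A (low k a)) (lowLid k a) ∧
      (lowLid k a).dim = k ∧ (a + Pi.single 0 1).dim = k + 1 ∧
      (∀ x ∈ (low k a).erase a, a 0 + 1 ≤ x 0) ∧
      (∀ x ∈ A, ∀ g ∈ x.facets, g 0 ≤ a 0) := by
  have he := even_of_not_vertical hv
  have hle := fun x hx => hA.height_le (f := x) hx
  set Q : Cell d := a + Pi.single 0 1 with hQ
  have hQ0 : Q 0 = a 0 + 1 := by simp [hQ]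
  have hlow : low k a = Q.facets := low_of_horizontal hv
  have hQo : Odd (Q 0) := by rw [hQ0]; exact he.add_one
  have haQ : a = Q + Pi.single 0 (-1) := by
    rw [hQ, add_assoc, ← Pi.single_add, add_neg_cancel, Pi.single_zero, add_zero]
  have hamem : a ∈ Q.facets := by rw [haQ]; exact add_single_mem_facets hQo (Or.inr rfl)
  -- The height of `a` is even, while faces extending vertically have odd height. They are therefore
  -- strictly below `a`, and no edge is above it.
  have hedge : ∀ x ∈ A, ∀ g ∈ x.facets, g 0 ≤ a 0 := by
    intro x hx g hg
    have h1 := hle x hx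
    rcases height_of_mem_facets hg with h | ⟨h, -⟩
    · omega
    · have := height_bounds hg
      have : x 0 ≠ a 0 := fun h' => by
        rw [h'] at h; exact (Int.not_even_iff_odd.2 h) he
      omega
  have hl : lowLid k a = Q + Pi.single 0 1 := by
    rw [lowLid, if_neg hv, hQ, add_assoc, ← Pi.single_add]; rfl
  have hl0 : lowLid k a 0 = a 0 + 2 := by rw [hl]; simp [hQ0]; ring
  have hlm : lowLid k a ∈ Q.facets := by rw [hl]; exact top_mem_facets hQo
  have hQd : Q.dim = k + 1 := by rw [dim_of_mem_facets hamem, hd]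
  have hbot : ∀ x ∈ Q.facets, x 0 ≤ a 0 → x = a := by
    intro x hx hx0
    rcases height_of_mem_facets hx with h | ⟨-, h | h⟩
    · omega
    · rw [h] at hx0; simp [hQ0] at hx0
    · rw [h, ← haQ]
  have hJ : Joinable A (low k a) a := by
    rw [hlow]
    refine ⟨hA.1, hamem, fun x hx hxQ => hbot x hxQ (hle x hx), ?_, fun g hg =>
      exists_cofaces_facets_eq hamem hg⟩
    intro x hx y hy g hgx hgy
    have h1 := hedge x hx g hgx
    have h2 := height_bounds' hy hgy
    exact mem_facets_of_coord hy hgy hamem (j := 0) (by omega) (by omega)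
  refine ⟨hJ, ⟨?_, by rw [hl0]; exact he.add even_two, ?_, ?_⟩, ?_, hQd, ?_, hedge⟩
  · rw [← hJ.joinFaces_eq, mem_joinFaces, hlow]
    exact ⟨fun h => by rw [h] at hl0; omega, Or.inr hlm⟩
  · intro x hx hne
    rw [← hJ.joinFaces_eq, mem_joinFaces, hlow] at hx
    rw [hl0]
    rcases hx.2 with h | h
    · have := hle x h; omega
    · rcases height_of_mem_facets h with h | ⟨-, h | h⟩
      · omega
      · exact absurd (h.trans hl.symm) hne
      · rw [h]; simp [hQ0]
  · intro x hx g hg hg0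
    rw [← hJ.joinFaces_eq, mem_joinFaces, hlow] at hx
    rcases hx.2 with h | h
    · have := hedge x h g hg; omega
    · have := height_bounds' h hg
      exact mem_facets_of_coord h hg hlm (j := 0) (by omega) (by omega)
  · have := dim_of_mem_facets hlm; omega
  · intro x hx
    rw [low_of_horizontal hv, mem_erase] at hx
    by_contra hcon
    exact hx.1 (hbot x hx.2 (by omega))

end

/-! ### Reflection of the upper end, and the bridge between two lids. -/

section

open Cell

variable {d : ℕ}

/-- The point reflection of a set of cells. -/
def mirror (S : Finset (Cell d)) : Finset (Cell d) := S.image (affine (-1) 0)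

theorem neg_mem_mirror {S : Finset (Cell d)} {x : Cell d} : -x ∈ mirror S ↔ x ∈ S := by
  rw [← affine_neg, mirror, mem_image_affine]

theorem mem_mirror {S : Finset (Cell d)} {x : Cell d} : x ∈ mirror S ↔ -x ∈ S := by
  rw [← neg_mem_mirror (S := S) (x := -x), neg_neg]

theorem mirror_mirror (S : Finset (Cell d)) : mirror (mirror S) = S := by
  ext x; rw [mem_mirror, mem_mirror, neg_neg]

theorem neg_mem_facets {c g : Cell d} : -g ∈ (-c).facets ↔ g ∈ c.facets := by
  rw [← affine_neg, ← affine_neg, affine_mem_facets]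

theorem mirror_symmDiff (S T : Finset (Cell d)) :
    mirror (symmDiff S T) = symmDiff (mirror S) (mirror T) :=
  image_symmDiff _ _ (affine (-1) 0).injective

theorem dim_neg (c : Cell d) : (-c).dim = c.dim := by rw [← affine_neg, dim_affine]

variable [NeZero d]

section Low

variable {k : ℕ} {A : Finset (Cell d)} {a : Cell d}

theorem lidded_low (hk : 1 < k) (hkd : k < d) (hA : IsTopFace A a) (hd : a.dim = k) :
    Lidded (symmDiff A (low k a)) (lowLid k a) ∧ (lowLid k a).dim = k := by
  by_cases hv : a.Vertical
  · have := low_induction hk hkd hA hv hd (fun _ _ => True) trivial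
      (fun _ _ _ _ _ _ _ _ _ _ => trivial)
    exact ⟨this.2.1, this.2.2.1⟩
  · have := low_joinable (k := k) hA hv hd
    exact ⟨this.2.1, this.2.2.1⟩

theorem low_height (hk : 1 < k) (hkd : k < d) (hd : a.dim = k) {q : Cell d} (hq : q ∈ low k a) :
    q = a ∨ a 0 + 1 ≤ q 0 := by
  -- The cap depends on `a` alone, so its heights can be read off from the set `{a}`.
  have hA : IsTopFace {a} a := ⟨by simp, by simp⟩
  by_cases hv : a.Vertical
  · have := (low_induction hk hkd hA hv hd (fun _ _ => True) trivial
      (fun _ _ _ _ _ _ _ _ _ _ => trivial)).2.2.2.2 q hq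
    right; omega
  · by_cases h : q = a
    · exact Or.inl h
    · exact Or.inr ((low_joinable (k := k) hA hv hd).2.2.2.2.1 q (mem_erase.2 ⟨h, hq⟩))

theorem low_height_le (hk : 1 < k) (hkd : k < d) (hd : a.dim = k) :
    a 0 + 1 ≤ lowLid k a 0 ∧ ∀ q ∈ low k a, q 0 ≤ lowLid k a 0 := by
  have hA : IsTopFace {a} a := ⟨by simp, by simp⟩
  have hL := (lidded_low hk hkd hA hd).1
  have h1 : a 0 + 1 ≤ lowLid k a 0 := by
    by_cases hv : a.Vertical
    · have hh := low_induction hk hkd hA hv hd (fun _ _ => True) trivial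
        (fun _ _ _ _ _ _ _ _ _ _ => trivial)
      have hm : a ∈ symmDiff {a} (low k a) := by rw [hh.2.2.2.1]; simp
      have := hh.2.2.2.2 (lowLid k a) (by rw [low_of_vertical hv]; simp)
      omega
    · rw [lowLid, if_neg hv]; simp
  refine ⟨h1, fun q hq => ?_⟩
  by_cases hqa : q = a
  · rw [hqa]; omega
  · by_cases hql : q = lowLid k a
    · rw [hql]
    · exact (hL.lt q (by rw [mem_symmDiff]; right; exact ⟨hq, by simpa using hqa⟩) hql).le

theorem low_isXD (hk : 1 < k) (hkd : k < d) (hA : IsTopFace A a) {n : ℕ} (hX : IsXD k n A) :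
    IsXD k (n + 2 * k) (symmDiff A (low k a)) := by
  have hd := hX.dim_eq a hA.1
  by_cases hv : a.Vertical
  · exact (low_induction hk hkd hA hv hd (fun S t => IsXD k (n + t) S) hX
      (fun S f g c t h _ hf _ hS => h.isXD hS hf)).1
  · obtain ⟨hJ, -, -, hQ, -⟩ := low_joinable (k := k) hA hv hd
    have hS := isSAM_facets hk.le hQ
    rw [← hJ.joinFaces_eq]
    rw [low_of_horizontal hv] at hJ ⊢
    obtain ⟨j, s, hj, hs, hg⟩ := exists_of_mem_facets hJ.mem_right
    have hop : a + Pi.single 0 1 + Pi.single j (-s) ∈ (a + Pi.single 0 1).facets.erase a := by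
      rw [mem_erase]
      refine ⟨fun he => ?_, add_single_mem_facets hj (by omega)⟩
      have h1 := congrFun hg j
      have h2 := congrFun he j
      rw [Pi.add_apply, Pi.single_eq_same] at h1 h2
      omega
    refine hJ.isXD hX hS.dim_eq hS.card_eq (by ring) ⟨_, hop⟩ (Conn.of_hub hop fun x hx => ?_)
    rw [mem_erase] at hx
    exact eq_or_shareFacet_opposite hj hs hx.2 (hg ▸ hx.1)

theorem low_isSAM (hk : 1 < k) (hkd : k < d) (hA : IsTopFace A a) {n : ℕ} (hX : IsSAM k n A) :
    IsSAM k (n + 2 * k) (symmDiff A (low k a)) ∧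
      numBoundaryComponents (symmDiff A (low k a)) = numBoundaryComponents A := by
  have hd := hX.dim_eq a hA.1
  by_cases hv : a.Vertical
  · exact (low_induction hk hkd hA hv hd
      (fun S t => IsSAM k (n + t) S ∧ numBoundaryComponents S = numBoundaryComponents A)
      ⟨hX, rfl⟩ (fun S f g c t h _ hf _ hS =>
        ⟨⟨h.isXD hS.1.toIsXD hf, h.selfAvoiding hS.1.selfAvoiding⟩,
          h.numBoundaryComponents_eq.trans hS.2⟩)).1
  · have hXD := low_isXD hk hkd hA hX.toIsXD
    obtain ⟨hJ, -, -, hQ, -⟩ := low_joinable (k := k) hA hv hd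
    have hS := isSAM_facets hk.le hQ
    rw [← hJ.joinFaces_eq] at hXD ⊢
    refine ⟨⟨hXD, hJ.selfAvoiding hX.selfAvoiding ?_⟩, ?_⟩
    · rw [low_of_horizontal hv]; exact hS.selfAvoiding
    · rw [numBoundaryComponents_eq, hJ.boundary_eq, low_of_horizontal hv, boundary_facets,
        union_empty, numBoundaryComponents_eq]

theorem lowBuffer_spec (hk : 1 < k) (hkd : k < d) (hd : a.dim = k) :
    (lowBuffer k a).card = (if a.Vertical then 2 * k else 0) ∧
      (∀ f ∈ lowBuffer k a, f.dim = k ∧ a 0 + 1 ≤ f 0 ∧ f 0 ≤ lowLid k a 0) ∧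
      (∀ c ∈ lowCubes a, c.dim = k + 1 ∧ a 0 < c 0 ∧ c 0 < lowLid k a 0) := by
  have hA : IsTopFace {a} a := ⟨by simp, by simp⟩
  have hX : IsXD k 1 {a} := ⟨by simpa using hd, by simp, (isConnectedVia_iff fun _ _ =>
    ShareFacet.symm).2 ⟨by simp, Conn.of_hub (mem_singleton_self a) fun x hx =>
      Or.inl (mem_singleton.1 hx)⟩⟩
  by_cases hv : a.Vertical
  · have hh := low_induction hk hkd hA hv hd (fun _ _ => True) trivial
      (fun _ _ _ _ _ _ _ _ _ _ => trivial)
    have h1 := low_isXD hk hkd hA hX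
    rw [hh.2.2.2.1] at h1
    have hb : lowBuffer k a = low k a := by rw [low_of_vertical hv, lowBuffer, if_pos hv]
    have hnot : a ∉ low k a := fun h => by have := hh.2.2.2.2 a h; omega
    rw [hb, if_pos hv, lowCubes, if_pos hv]
    refine ⟨?_, ?_, by simp⟩
    · have := h1.card_eq
      rw [← insert_eq, card_insert_of_notMem hnot] at this
      omega
    · intro f hf
      have := hh.2.2.2.2 f hf
      exact ⟨h1.dim_eq f (mem_union_right _ hf), by omega, (low_height_le hk hkd hd).2 f hf⟩
  · obtain ⟨hJ, -, -, hQ, -⟩ := low_joinable (k := k) hA hv hd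
    rw [lowBuffer, if_neg hv, lowCubes, if_neg hv, if_neg hv]
    refine ⟨by simp, by simp, ?_⟩
    intro c hc
    rw [mem_singleton] at hc
    subst hc
    refine ⟨hQ, by simp, ?_⟩
    rw [lowLid, if_neg hv]
    simp

end Low

theorem Lidded.edge_height {S : Finset (Cell d)} {l x g : Cell d} (h : Lidded S l) (hx : x ∈ S)
    (hg : g ∈ x.facets) : g 0 ≤ l 0 := by
  by_contra hcon
  have := height_eq_of_even (h.edge x hx g hg (by omega)) h.even
  omega

theorem Lidded.ridge_height {S : Finset (Cell d)} {l x g v : Cell d} (h : Lidded S l) (hx : x ∈ S)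
    (hg : g ∈ x.facets) (hv : v ∈ g.facets) : v 0 ≤ l 0 := by
  have h1 := h.edge_height hx hg
  have h2 := height_bounds hv
  rcases h1.eq_or_lt with h3 | h3
  · have := height_eq_of_even hv (h3 ▸ h.even)
    omega
  · omega

/-- Two sets of faces, one above the other, with horizontal faces `l` and `x + e₀` that are joined
by a tube of cubes. -/
structure Bridge (k : ℕ) (A : Finset (Cell d)) (l : Cell d) (K : Finset (Cell d)) (x : Cell d)
    (B : Finset (Cell d)) (l' : Cell d) : Prop where
  lower : Lidded A l
  upper : Lidded (mirror B) (-l')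
  tube : Tube k l K x
  lid : l' = x + Pi.single 0 1

theorem Lidded.cofaces_subset {S : Finset (Cell d)} {l g x : Cell d} (h : Lidded S l)
    (hg : g ∈ l.facets) (hx : x ∈ cofaces S g) : x = l ∨ x = g + Pi.single 0 (-1) := by
  rw [mem_cofaces] at hx
  by_cases hxl : x = l
  · exact Or.inl hxl
  · right
    have h1 := h.lt x hx.1 hxl
    have h2 := height_eq_of_even hg h.even
    rw [eq_top_of_height hx.2 (by omega), add_assoc, ← Pi.single_add, add_neg_cancel,
      Pi.single_zero, add_zero]

theorem Lidded.card_cofaces_le {S : Finset (Cell d)} {l g : Cell d} (h : Lidded S l)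
    (hg : g ∈ l.facets) : (cofaces S g).card ≤ 2 := by
  refine (card_le_card (t := {l, g + Pi.single 0 (-1)}) fun x hx => ?_).trans card_le_two
  have := h.cofaces_subset hg hx
  simpa using this

namespace Bridge

variable {k : ℕ} {A B K : Finset (Cell d)} {l l' x : Cell d}

theorem height_lid (h : Bridge k A l K x B l') : l' 0 = l 0 + 2 := by
  rw [h.lid, Pi.add_apply, h.tube.height x h.tube.top, Pi.single_eq_same]; ring

theorem height (h : Bridge k A l K x B l') {f : Cell d} (hf : f ∈ cubeBoundarySum K) :
    (l 0 ≤ f 0 ∧ f 0 ≤ l 0 + 2) ∧ ∀ g ∈ f.facets, l 0 ≤ g 0 ∧ g 0 ≤ l 0 + 2 := by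
  obtain ⟨c, hc, hfc⟩ := exists_of_mem_cubeBoundarySum hf
  have h1 := h.tube.height c hc
  have h2 := height_bounds hfc
  refine ⟨by omega, fun g hg => ?_⟩
  have := height_bounds' hfc hg
  omega

theorem upper_gt (h : Bridge k A l K x B l') {f : Cell d} (hf : f ∈ B) (hne : f ≠ l') :
    l' 0 < f 0 := by
  have := h.upper.lt (-f) (neg_mem_mirror.2 hf) (fun he => hne (neg_injective he))
  simpa using this

theorem upper_edge (h : Bridge k A l K x B l') {f g : Cell d} (hf : f ∈ B) (hg : g ∈ f.facets)
    (hle : g 0 ≤ l' 0) : g ∈ l'.facets :=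
  neg_mem_facets.1 (h.upper.edge (-f) (neg_mem_mirror.2 hf) (-g) (neg_mem_facets.2 hg)
    (by simpa using hle))

theorem upper_edge_height (h : Bridge k A l K x B l') {f g : Cell d} (hf : f ∈ B)
    (hg : g ∈ f.facets) : l' 0 ≤ g 0 := by
  have := h.upper.edge_height (neg_mem_mirror.2 hf) (neg_mem_facets.2 hg)
  simpa using this

theorem upper_ridge_height (h : Bridge k A l K x B l') {f g v : Cell d} (hf : f ∈ B)
    (hg : g ∈ f.facets) (hv : v ∈ g.facets) : l' 0 ≤ v 0 := by
  have := h.upper.ridge_height (neg_mem_mirror.2 hf) (neg_mem_facets.2 hg) (neg_mem_facets.2 hv)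
  simpa using this

theorem lid_mem (h : Bridge k A l K x B l') : l' ∈ cubeBoundarySum K := by
  rw [h.lid]; exact h.tube.top_mem h.lower.even

theorem joinable_lower (h : Bridge k A l K x B l') : Joinable A (cubeBoundarySum K) l := by
  have hlT := h.tube.base_mem h.lower.even
  refine ⟨h.lower.mem, hlT, ?_, ?_, fun g hg => h.tube.exists_cofaces_eq hlT hg⟩
  · intro y hy hyT
    by_contra hne
    have h1 := h.lower.lt y hy hne
    have h2 := (h.height hyT).1
    omega
  · intro y hy z hz g hgy hgz
    exact h.lower.edge y hy g hgy ((h.height hz).2 g hgz).1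

theorem even_lid (h : Bridge k A l K x B l') : Even (l' 0) := by
  rw [h.height_lid]; exact h.lower.even.add even_two

theorem joinable_upper (h : Bridge k A l K x B l') :
    Joinable B (joinFaces A (cubeBoundarySum K) l) l' := by
  have hl := h.height_lid
  have hll : l' ≠ l := fun e => by rw [e] at hl; omega
  refine ⟨?_, mem_joinFaces.2 ⟨hll, Or.inr h.lid_mem⟩, ?_, ?_, ?_⟩
  · exact neg_mem_mirror.1 h.upper.mem
  · intro y hy hyT
    by_contra hne
    have h1 := h.upper_gt hy hne
    rw [mem_joinFaces] at hyT
    rcases hyT.2 with h2 | h2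
    · have := h.lower.lt y h2 hyT.1; omega
    · have := (h.height h2).1; omega
  · intro y hy z hz g hgy hgz
    have h1 := h.upper_edge_height hy hgy
    rw [mem_joinFaces] at hz
    rcases hz.2 with h2 | h2
    · have := h.lower.edge_height h2 hgz; omega
    · have := (h.height h2).2 g hgz
      exact h.upper_edge hy hgy (by omega)
  · intro g hg
    have hg0 := height_eq_of_even hg h.even_lid
    have hgl : g ∉ l.facets := fun h' => by
      have := height_eq_of_even h' h.lower.even; omega
    -- The lower part does not reach the height of `l'`, so the faces at its edges are those of the
    -- tube.
    rw [h.joinable_lower.cofaces_of_right h.lid_mem hg hgl]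
    exact h.tube.exists_cofaces_eq h.lid_mem hg

theorem joinFaces_eq (h : Bridge k A l K x B l') :
    joinFaces B (joinFaces A (cubeBoundarySum K) l) l' =
      symmDiff (symmDiff A (cubeBoundarySum K)) B := by
  rw [h.joinable_upper.joinFaces_eq, h.joinable_lower.joinFaces_eq, symmDiff_comm]

theorem erase_eq (h : Bridge k A l K x B l') :
    (joinFaces A (cubeBoundarySum K) l).erase l' =
      A.erase l ∪ ((cubeBoundarySum K).erase l).erase l' := by
  have hlA : l' ∉ A.erase l := fun hm => by
    rw [mem_erase] at hm
    have := h.lower.lt l' hm.2 hm.1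
    have := h.height_lid
    omega
  rw [joinFaces, erase_union_distrib, erase_eq_of_notMem hlA]

/-- Arbitrary relations are allowed so that the argument covers both adjacency of faces and links.
The tube without its two lids is the patch for both gluings. -/
theorem conn (h : Bridge k A l K x B l') {RA RB R : Cell d → Cell d → Prop}
    (hA : Conn A RA) (hB : Conn B RB)
    (hRA : ∀ y ∈ A.erase l, ∀ z ∈ A.erase l, RA y z → R y z)
    (hRB : ∀ y ∈ B.erase l', ∀ z ∈ B.erase l', RB y z → R y z)
    (hRT : ∀ y ∈ ((cubeBoundarySum K).erase l).erase l',
      ∀ z ∈ ((cubeBoundarySum K).erase l).erase l', ShareFacet y z → R y z)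
    (hA' : ∀ y ∈ A.erase l, RA y l ∨ RA l y →
      ∃ u ∈ ((cubeBoundarySum K).erase l).erase l', R y u)
    (hB' : ∀ y ∈ B.erase l', RB y l' ∨ RB l' y →
      ∃ u ∈ ((cubeBoundarySum K).erase l).erase l', R y u)
    (hne : (((cubeBoundarySum K).erase l).erase l').Nonempty) :
    Conn (joinFaces B (joinFaces A (cubeBoundarySum K) l) l') R := by
  have hT : Conn (((cubeBoundarySum K).erase l).erase l') ShareFacet := by
    rw [h.lid]; exact h.tube.conn
  have h1 : Conn (A.erase l ∪ ((cubeBoundarySum K).erase l).erase l') R :=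
    hA.glue hT h.lower.mem hne hRA hRT hA'
  rw [joinFaces, h.erase_eq]
  refine hB.glue h1 h.joinable_upper.mem_left (hne.mono subset_union_right) hRB
    (fun _ _ _ _ h => h) ?_
  intro y hy hyl
  obtain ⟨u, hu, hyu⟩ := hB' y hy hyl
  exact ⟨u, mem_union_right _ hu, hyu⟩

/-- Each edge of `l` or `l'` is neighboured by a further face of the tube. -/
theorem exists_tube_face (h : Bridge k A l K x B l') {g : Cell d}
    (hg : g ∈ l.facets ∨ g ∈ l'.facets) :
    ∃ u ∈ ((cubeBoundarySum K).erase l).erase l', g ∈ u.facets := by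
  have hl := h.height_lid
  have hlT := h.tube.base_mem h.lower.even
  rcases hg with hg | hg
  · obtain ⟨u, hu, he⟩ := h.tube.exists_cofaces_eq hlT hg
    have hm : u ∈ cofaces (cubeBoundarySum K) g := by simp [he]
    rw [mem_cofaces] at hm
    refine ⟨u, ?_, hm.2⟩
    rw [mem_erase, mem_erase]
    refine ⟨?_, hu, hm.1⟩
    rintro rfl
    have := height_eq_of_even hg h.lower.even
    have := height_eq_of_even hm.2 h.even_lid
    omega
  · obtain ⟨u, hu, he⟩ := h.tube.exists_cofaces_eq h.lid_mem hg
    have hm : u ∈ cofaces (cubeBoundarySum K) g := by simp [he]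
    rw [mem_cofaces] at hm
    refine ⟨u, ?_, hm.2⟩
    rw [mem_erase, mem_erase]
    refine ⟨hu, ?_, hm.1⟩
    rintro rfl
    have := height_eq_of_even hg h.even_lid
    have := height_eq_of_even hm.2 h.lower.even
    omega

theorem nonempty_tube (h : Bridge k A l K x B l') (hd : l.dim = k) (hk : 1 < k) :
    (((cubeBoundarySum K).erase l).erase l').Nonempty := by
  obtain ⟨g, hg⟩ : l.facets.Nonempty := by
    rw [← card_pos, card_facets, hd]; omega
  obtain ⟨u, hu, -⟩ := h.exists_tube_face (Or.inl hg)
  exact ⟨u, hu⟩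

theorem card (h : Bridge k A l K x B l') :
    (joinFaces B (joinFaces A (cubeBoundarySum K) l) l').card + 4 =
      A.card + B.card + (2 * k * K.card + 2) := by
  have h1 := h.joinable_lower.card_eq
  have h2 := h.joinable_upper.card_eq
  have h3 := h.tube.sam.card_eq
  omega

theorem isXD (h : Bridge k A l K x B l') {n m N : ℕ} (hk : 1 < k) (hd : l.dim = k)
    (hA : IsXD k n A) (hB : IsXD k m B)
    (hN : N + 4 = n + m + (2 * k * K.card + 2)) :
    IsXD k N (joinFaces B (joinFaces A (cubeBoundarySum K) l) l') := by
  have hne := h.nonempty_tube hd hk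
  refine ⟨?_, ?_, (isConnectedVia_iff fun _ _ => ShareFacet.symm).2 ⟨?_, ?_⟩⟩
  · intro f hf
    rw [mem_joinFaces, mem_joinFaces] at hf
    rcases hf.2 with hf | ⟨-, hf | hf⟩
    exacts [hB.dim_eq f hf, hA.dim_eq f hf, h.tube.sam.dim_eq f hf]
  · have := h.card
    rw [hA.card_eq, hB.card_eq] at this
    omega
  · rw [joinFaces, h.erase_eq]
    exact hne.mono (subset_union_right.trans subset_union_right)
  · refine h.conn ((isConnectedVia_iff fun _ _ => ShareFacet.symm).1 hA.connected).2
      ((isConnectedVia_iff fun _ _ => ShareFacet.symm).1 hB.connected).2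
      (fun _ _ _ _ h => h) (fun _ _ _ _ h => h) (fun _ _ _ _ h => h) ?_ ?_ hne
    · intro y _ hyl
      obtain ⟨g, hg1, hg2⟩ : ShareFacet y l := hyl.elim id ShareFacet.symm
      obtain ⟨u, hu, hug⟩ := h.exists_tube_face (Or.inl hg2)
      exact ⟨u, hu, g, hg1, hug⟩
    · intro y _ hyl
      obtain ⟨g, hg1, hg2⟩ : ShareFacet y l' := hyl.elim id ShareFacet.symm
      obtain ⟨u, hu, hug⟩ := h.exists_tube_face (Or.inr hg2)
      exact ⟨u, hu, g, hg1, hug⟩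

theorem selfAvoiding (h : Bridge k A l K x B l') (hA : ∀ g, (cofaces A g).card ≤ 2)
    (hB : ∀ g, (cofaces B g).card ≤ 2) (g : Cell d) :
    (cofaces (joinFaces B (joinFaces A (cubeBoundarySum K) l) l') g).card ≤ 2 :=
  h.joinable_upper.selfAvoiding hB
    (h.joinable_lower.selfAvoiding hA h.tube.sam.selfAvoiding) g

theorem exists_of_mem_boundary {S : Finset (Cell d)} {g : Cell d} (hg : g ∈ boundary S) :
    ∃ f ∈ S, g ∈ f.facets := by
  rw [mem_boundary] at hg
  obtain ⟨y, hy⟩ := card_pos.1 (by omega : 0 < (cofaces S g).card)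
  exact ⟨y, (mem_cofaces.1 hy).1, (mem_cofaces.1 hy).2⟩

/-- The tube is closed, and edges and `(k-2)`-cells of the lower part are at height at most `l 0`,
those of the upper part at height at least `l 0 + 2`. The two boundaries are thus disjoint and not
linked. -/
theorem numBoundaryComponents_eq (h : Bridge k A l K x B l') :
    numBoundaryComponents (joinFaces B (joinFaces A (cubeBoundarySum K) l) l') =
      numBoundaryComponents A + numBoundaryComponents B := by
  have hl := h.height_lid
  rw [_root_.numBoundaryComponents_eq, h.joinable_upper.boundary_eq, h.joinable_lower.boundary_eq,
    h.tube.closed, union_empty, union_comm]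
  refine numComp_union ?_ ?_
  · rw [Finset.disjoint_left]
    intro g hgA hgB
    obtain ⟨f, hf, hgf⟩ := exists_of_mem_boundary hgA
    obtain ⟨f', hf', hgf'⟩ := exists_of_mem_boundary hgB
    have := h.lower.edge_height hf hgf
    have := h.upper_edge_height hf' hgf'
    omega
  · rintro g hgA g' hgB ⟨v, hv, hv'⟩
    obtain ⟨f, hf, hgf⟩ := exists_of_mem_boundary hgA
    obtain ⟨f', hf', hgf'⟩ := exists_of_mem_boundary hgB
    have := h.lower.ridge_height hf hgf hv
    have := h.upper_ridge_height hf' hgf' hv'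
    omega

end Bridge

end

/-! ### Recovering the parts, and joins of sets of faces. -/

section

open Cell

variable {d : ℕ}

theorem toLex_le_iff {f a : Cell d} :
    toLex f ≤ toLex a ↔ f = a ∨ ∃ i, (∀ j < i, f j = a j) ∧ f i < a i := by
  rw [le_iff_eq_or_lt, toLex_inj]; rfl

variable [NeZero d]

section Bottom

/-- `A` is the bottom part of `C`, up to its lexicographically largest face `a`. -/
structure Bottom (A : Finset (Cell d)) (a : Cell d) (C : Finset (Cell d)) : Prop where
  top : IsTopFace A a
  vertical : a.Vertical → A ⊆ C ∧ ∀ f ∈ C, f ∉ A → a 0 + 2 ≤ f 0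
  horizontal : ¬ a.Vertical → A.erase a ⊆ C ∧ (∀ f ∈ C, f ∉ A.erase a → a 0 + 1 ≤ f 0) ∧
    ∀ f : Cell d, f 0 = a 0 + 1 → (f ∈ C ↔ f ∈ (a + Pi.single 0 1).facets)

theorem isTopFace_translate {A : Finset (Cell d)} {a : Cell d} (h : IsTopFace A a)
    (v : Fin d → ℤ) : IsTopFace (A.image (affine 1 v)) (affine 1 v a) := by
  refine ⟨mem_image_of_mem _ h.1, ?_⟩
  intro f hf
  obtain ⟨f, hf', rfl⟩ := mem_image.1 hf
  have := h.2 f hf'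
  rw [toLex_le_iff] at this ⊢
  simpa [affine_apply] using this

theorem affine_one_add (v : Fin d → ℤ) (a e : Cell d) : affine 1 v (a + e) = affine 1 v a + e := by
  ext i; simp [affine_apply]; ring

theorem vertical_affine {u : ℤˣ} {v : Fin d → ℤ} {a : Cell d} :
    (affine u v a).Vertical ↔ a.Vertical := odd_affine u v

theorem Bottom.translate {A C : Finset (Cell d)} {a : Cell d} (h : Bottom A a C) (v : Fin d → ℤ) :
    Bottom (A.image (affine 1 v)) (affine 1 v a) (C.image (affine 1 v)) := by
  have e0 : ∀ f : Cell d, affine 1 v f 0 = f 0 + 2 * v 0 := fun f => by simp [affine_apply]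
  refine ⟨isTopFace_translate h.top v, fun hv => ?_, fun hv => ?_⟩
  · rw [vertical_affine] at hv
    obtain ⟨h1, h2⟩ := h.vertical hv
    refine ⟨image_subset_image h1, fun f hf hfA => ?_⟩
    obtain ⟨f, rfl⟩ := (affine 1 v).surjective f
    rw [mem_image_affine] at hf hfA
    have := h2 f hf hfA
    rw [e0, e0]; omega
  · rw [vertical_affine] at hv
    obtain ⟨h1, h2, h3⟩ := h.horizontal hv
    rw [← image_erase (affine 1 v).injective]
    refine ⟨image_subset_image h1, fun f hf hfA => ?_, fun f hf => ?_⟩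
    · obtain ⟨f, rfl⟩ := (affine 1 v).surjective f
      rw [mem_image_affine] at hf hfA
      have := h2 f hf hfA
      rw [e0, e0]; omega
    · obtain ⟨f, rfl⟩ := (affine 1 v).surjective f
      rw [e0, e0] at hf
      rw [mem_image_affine, ← affine_one_add, affine_mem_facets]
      exact h3 f (by omega)

theorem bottom_symmDiff {k : ℕ} (hk : 1 < k) (hkd : k < d) {A R : Finset (Cell d)} {a : Cell d}
    (hA : IsTopFace A a) (hd : a.dim = k) (hR : ∀ f ∈ R, lowLid k a 0 ≤ f 0) :
    Bottom A a (symmDiff (symmDiff A (low k a)) R) := by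
  refine ⟨hA, fun hv => ?_, fun hv => ?_⟩
  · obtain ⟨-, -, -, h1, h2⟩ := low_induction hk hkd hA hv hd (fun _ _ => True) trivial
      (fun _ _ _ _ _ _ _ _ _ _ => trivial)
    have hl : a 0 + 2 ≤ lowLid k a 0 := h2 _ (by rw [low_of_vertical hv]; simp)
    rw [h1]
    constructor
    · intro f hf
      rw [mem_symmDiff, mem_union]
      refine Or.inl ⟨Or.inl hf, fun hfR => ?_⟩
      have := hR f hfR
      have := hA.height_le hf
      omega
    · intro f hf hfA
      rw [mem_symmDiff, mem_union] at hf
      rcases hf with ⟨h | h, -⟩ | ⟨h, -⟩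
      · exact absurd h hfA
      · exact h2 f h
      · have := hR f h; omega
  · obtain ⟨hJ, -, -, -, h1, -⟩ := low_joinable (k := k) hA hv hd
    have hl : lowLid k a 0 = a 0 + 2 := by rw [lowLid, if_neg hv]; simp
    rw [← hJ.joinFaces_eq]
    refine ⟨?_, ?_, ?_⟩
    · intro f hf
      rw [mem_erase] at hf
      rw [mem_symmDiff, mem_joinFaces]
      refine Or.inl ⟨⟨hf.1, Or.inl hf.2⟩, fun hfR => ?_⟩
      have := hR f hfR
      have := hA.height_le hf.2
      omega
    · intro f hf hfA
      rw [mem_symmDiff, mem_joinFaces] at hf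
      rcases hf with ⟨⟨hne, h | h⟩, -⟩ | ⟨h, -⟩
      · exact absurd (mem_erase.2 ⟨hne, h⟩) hfA
      · exact h1 f (mem_erase.2 ⟨hne, h⟩)
      · have := hR f h; omega
    · intro f hf
      have h2 : f ∉ R := fun h => by have := hR f h; omega
      have h3 : f ∉ A := fun h => by have := hA.height_le h; omega
      have h4 : f ≠ a := fun h => by rw [h] at hf; omega
      rw [mem_symmDiff, mem_joinFaces, low_of_horizontal hv]
      tauto

theorem side_height {a : Cell d} {i : Fin d} {s : ℤ} (hi : i ≠ 0) :
    (a + Pi.single 0 1 + Pi.single i s : Cell d) 0 = a 0 + 1 := by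
  simp [hi.symm]

theorem side_mem {a : Cell d} {i : Fin d} {s : ℤ} (hi : i ≠ 0) (ho : Odd (a i))
    (hs : s = 1 ∨ s = -1) :
    a + Pi.single 0 1 + Pi.single i s ∈ (a + Pi.single 0 1).facets :=
  add_single_mem_facets (by simpa [hi] using ho) hs

theorem exists_two_sides {k : ℕ} {a : Cell d} (hk : 1 < k) (hd : a.dim = k) :
    ∃ i, i ≠ 0 ∧ Odd (a i) := by
  have h : 1 < a.halfInt.card := by rw [← hd] at hk; exact hk
  obtain ⟨i, hi, hne⟩ := exists_mem_ne h 0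
  exact ⟨i, hne, mem_halfInt.1 hi⟩

/-- Two opposite sides of the cube above `a` show its coordinate in their direction as the midpoint,
and all other coordinates directly. -/
theorem eq_of_sides {k : ℕ} {a a' : Cell d} (hk : 1 < k) (hd : a.dim = k)
    (h : ∀ f : Cell d, f 0 = a 0 + 1 → f ∈ (a + Pi.single 0 1).facets →
      f ∈ (a' + Pi.single 0 1).facets) : a = a' := by
  obtain ⟨i, hi, ho⟩ := exists_two_sides hk hd
  have h1 := h _ (side_height hi) (side_mem hi ho (Or.inl rfl))
  have h2 := h _ (side_height hi) (side_mem hi ho (Or.inr rfl))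
  obtain ⟨m, -, hm, hm'⟩ := mem_facets_iff.1 h1
  obtain ⟨n, -, hn, hn'⟩ := mem_facets_iff.1 h2
  -- Opposite sides differ by 2 in direction `i`. Both can be facets of the second cube only if they
  -- are its facets in the same direction.
  have him : m = i := by
    by_contra hne
    have e1 := hm' i (Ne.symm hne)
    by_cases hin : i = n
    · subst hin
      simp at e1 hn
      omega
    · have e2 := hn' i hin
      simp at e1 e2
      omega
  subst him
  have hmn : n = m := by
    by_contra hne
    have e2 := hn' m (Ne.symm hne)
    simp at e2 hm
    omega
  subst hmn
  have e : a n = a' n := by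
    simp [hi] at hm hn
    omega
  ext j
  by_cases hj : j = n
  · rw [hj, e]
  · have := hm' j hj
    simpa [hj] using this

/-- Each candidate consists of all faces of `C` up to a certain height, apart from the replaced face
`a` in the horizontal case. Two candidates are therefore nested up to this face, and equal
cardinality leaves no room for a difference. In the horizontal case the sides of the cube then
determine the missing face. -/
theorem Bottom.unique {k : ℕ} (hk : 1 < k) {A A' C : Finset (Cell d)} {a a' : Cell d}
    (h : Bottom A a C) (h' : Bottom A' a' C) (hd : a.dim = k) (hd' : a'.dim = k)
    (hc : A.card = A'.card) : A = A' ∧ a = a' := by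
  have hfin : A = A' → A = A' ∧ a = a' := fun e => by
    subst e
    exact ⟨rfl, toLex.injective (le_antisymm (h'.top.2 a h.top.1) (h.top.2 a' h'.top.1))⟩
  -- a vertical and a horizontal top face cannot both occur
  have key : ∀ {A A' : Finset (Cell d)} {a a' : Cell d}, Bottom A a C → Bottom A' a' C →
      a'.dim = k → A.card = A'.card → a.Vertical → ¬ a'.Vertical → False := by
    intro A A' a a' h h' hd' hc hv hv'
    obtain ⟨h1, h2⟩ := h.vertical hv
    obtain ⟨h3, h4, h5⟩ := h'.horizontal hv'
    obtain ⟨i, hi, ho⟩ := exists_two_sides hk hd'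
    have hs : ∀ s : ℤ, (s = 1 ∨ s = -1) → a' + Pi.single 0 1 + Pi.single i s ∈ C ∧
        a' + Pi.single 0 1 + Pi.single i s ∉ A'.erase a' := by
      intro s hs
      refine ⟨(h5 _ (side_height hi)).2 (side_mem hi ho hs), fun hm => ?_⟩
      have := h'.top.height_le (mem_of_mem_erase hm)
      rw [side_height hi] at this
      omega
    -- Otherwise all of `A` lies below the new faces at `a'`, so it is contained in `A'` without
    -- `a'` and is too small.
    have hlt : a' 0 + 1 ≤ a 0 := by
      by_contra hcon
      have hsub : A ⊆ A'.erase a' := fun f hf => by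
        by_contra hf'
        have := h4 f (h1 hf) hf'
        have := h.top.height_le hf
        omega
      have := card_le_card hsub
      rw [card_erase_of_mem h'.top.1] at this
      have := card_pos.2 ⟨a', h'.top.1⟩
      omega
    have hin : ∀ f ∈ C, f 0 ≤ a 0 → f ∈ A := fun f hf hle => by
      by_contra hfA
      have := h2 f hf hfA
      omega
    have hsub : A'.erase a' ⊆ A := fun f hf => hin f (h3 hf) (by
      have := h'.top.height_le (mem_of_mem_erase hf); omega)
    -- Now `A` contains `A'` without `a'` and two opposite sides of the cube above `a'`: one face is
    -- lost and two are gained, so `A` is too large.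
    have hsub2 : insert (a' + Pi.single 0 1 + Pi.single i 1)
        (insert (a' + Pi.single 0 1 + Pi.single i (-1)) (A'.erase a')) ⊆ A := by
      intro f hf
      rw [mem_insert, mem_insert] at hf
      rcases hf with rfl | rfl | hf
      · exact hin _ (hs 1 (Or.inl rfl)).1 (by rw [side_height hi]; exact hlt)
      · exact hin _ (hs (-1) (Or.inr rfl)).1 (by rw [side_height hi]; exact hlt)
      · exact hsub hf
    have hcard := card_le_card hsub2
    rw [card_insert_of_notMem, card_insert_of_notMem (hs (-1) (Or.inr rfl)).2,
      card_erase_of_mem h'.top.1] at hcard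
    · have := card_pos.2 ⟨a', h'.top.1⟩
      omega
    · rw [mem_insert, not_or]
      refine ⟨fun he => ?_, (hs 1 (Or.inl rfl)).2⟩
      have := congrFun he i
      simp at this
  by_cases hv : a.Vertical <;> by_cases hv' : a'.Vertical
  · apply hfin
    obtain ⟨h1, h2⟩ := h.vertical hv
    obtain ⟨h3, h4⟩ := h'.vertical hv'
    rcases le_total (a 0) (a' 0) with hle | hle
    · refine eq_of_subset_of_card_le (fun f hf => ?_) hc.ge
      by_contra hf'
      have := h4 f (h1 hf) hf'
      have := h.top.height_le hf
      omega
    · refine (eq_of_subset_of_card_le (fun f hf => ?_) hc.le).symm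
      by_contra hf'
      have := h2 f (h3 hf) hf'
      have := h'.top.height_le hf
      omega
  · exact (key h h' hd' hc hv hv').elim
  · exact (key h' h hd hc.symm hv' hv).elim
  · obtain ⟨h1, h2, h3⟩ := h.horizontal hv
    obtain ⟨h4, h5, h6⟩ := h'.horizontal hv'
    have hcard : (A.erase a).card = (A'.erase a').card := by
      rw [card_erase_of_mem h.top.1, card_erase_of_mem h'.top.1, hc]
    have he : A.erase a = A'.erase a' := by
      rcases le_total (a 0) (a' 0) with hle | hle
      · refine eq_of_subset_of_card_le (fun f hf => ?_) hcard.ge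
        by_contra hf'
        have := h5 f (h1 hf) hf'
        have := h.top.height_le (mem_of_mem_erase hf)
        omega
      · refine (eq_of_subset_of_card_le (fun f hf => ?_) hcard.le).symm
        by_contra hf'
        have := h2 f (h4 hf) hf'
        have := h'.top.height_le (mem_of_mem_erase hf)
        omega
    -- A side of the cube above `a` is in `C` but not in the common set of remaining faces, so it
    -- belongs to the new faces above `a'` and is at least as high as these.
    have hge : ∀ {A A' : Finset (Cell d)} {a a' : Cell d}, Bottom A a C → Bottom A' a' C →
        a.dim = k → ¬ a.Vertical → ¬ a'.Vertical → A.erase a = A'.erase a' → a' 0 ≤ a 0 := by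
      intro A A' a a' h h' hd hv hv' he
      obtain ⟨h1, h2, h3⟩ := h.horizontal hv
      obtain ⟨h4, h5, h6⟩ := h'.horizontal hv'
      obtain ⟨i, hi, ho⟩ := exists_two_sides hk hd
      have hm := (h3 _ (side_height hi)).2 (side_mem hi ho (Or.inl rfl))
      have hn : a + Pi.single 0 1 + Pi.single i 1 ∉ A'.erase a' := by
        rw [← he]
        intro hm
        have := h.top.height_le (mem_of_mem_erase hm)
        rw [side_height hi] at this
        omega
      have := h5 _ hm hn
      rw [side_height hi] at this
      omega
    have h0 : a 0 = a' 0 := le_antisymm (hge h' h hd' hv' hv he.symm) (hge h h' hd hv hv' he)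
    have haa : a = a' := eq_of_sides hk hd fun f hf hfa =>
      (h6 f (h0 ▸ hf)).1 ((h3 f hf).2 hfa)
    refine ⟨?_, haa⟩
    rw [← insert_erase h.top.1, ← insert_erase h'.top.1, he, haa]

end Bottom

theorem freeDim_affine (u : ℤˣ) (v : Fin d → ℤ) (a : Cell d) :
    freeDim (affine u v a) = freeDim a := by
  unfold freeDim; rw [halfInt_affine]

theorem lowLid_translate (k : ℕ) (v : Fin d → ℤ) (a : Cell d) :
    lowLid k (affine 1 v a) = affine 1 v (lowLid k a) := by
  unfold lowLid
  simp only [vertical_affine, freeDim_affine]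
  split_ifs <;> simp only [affine_one_add]

open Classical in
/-- A tube of shape `Mid`, if there is one. -/
noncomputable def tubeData (k : ℕ) (l : Cell d) (J : Finset (Fin d)) (ε δ : Fin d → Bool) :
    Finset (Cell d) × Cell d :=
  Classical.epsilon fun p => Mid k l J ε δ p.1 p.2

/-- `C` arises from `A`, whose top face `a` has coordinates `0` and `1` only, and `B` with lowest
face `b` by joining them with the tube `K` that encodes the bits `ε` and `δ`. -/
structure FaceJoin (k : ℕ) (ε δ : Fin d → Bool) (A B C : Finset (Cell d)) (a b : Cell d)
    (K : Finset (Cell d)) (x : Cell d) : Prop where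
  top : IsTopFace A a
  bot : IsTopFace (mirror B) (-b)
  normal : ∀ i, a i = 0 ∨ a i = 1
  data : (K, x) = tubeData k (lowLid k a) (lowLid k (-b)).halfInt ε δ
  lid : -lowLid k (-b) = x + Pi.single 0 1
  eq : C = symmDiff (symmDiff (symmDiff A (low k a)) (cubeBoundarySum K))
    (symmDiff B (mirror (low k (-b))))

/-- The chosen tube depends only on the lower lid, the orientation of the upper lid and the bits,
hence not on the position of the upper part. -/
theorem tubeData_spec {k : ℕ} (hk : 1 < k) {l : Cell d} (hl : Even (l 0)) (hd : l.dim = k)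
    {l' : Cell d} (hl' : Even (l' 0)) (hd' : l'.dim = k) (ε δ : Fin d → Bool) :
    Mid k l l'.halfInt ε δ (tubeData k l l'.halfInt ε δ).1 (tubeData k l l'.halfInt ε δ).2 := by
  obtain ⟨K, x, h⟩ := exists_mid hk hl hd (J := l'.halfInt) hd'
    (by rw [mem_halfInt]; exact Int.not_odd_iff_even.2 hl') ε δ
  exact Classical.epsilon_spec (p := fun p : Finset (Cell d) × Cell d =>
    Mid k l l'.halfInt ε δ p.1 p.2) ⟨(K, x), h⟩

theorem numBoundaryComponents_image (u : ℤˣ) (w : Fin d → ℤ) (S : Finset (Cell d)) :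
    numBoundaryComponents (S.image (affine u w)) = numBoundaryComponents S := by
  rw [numBoundaryComponents_eq, numBoundaryComponents_eq, boundary_image, numComp_image]

theorem numBoundaryComponents_mirror (S : Finset (Cell d)) :
    numBoundaryComponents (mirror S) = numBoundaryComponents S :=
  numBoundaryComponents_image (-1) 0 S

namespace FaceJoin

variable {k : ℕ} {ε δ : Fin d → Bool} {A B C K : Finset (Cell d)} {a b x : Cell d}

theorem mem_bot (h : FaceJoin k ε δ A B C a b K x) : b ∈ B := neg_mem_mirror.1 h.bot.1

theorem mid (h : FaceJoin k ε δ A B C a b K x) (hk : 1 < k) (hkd : k < d) (ha : a.dim = k)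
    (hb : b.dim = k) : Mid k (lowLid k a) (lowLid k (-b)).halfInt ε δ K x := by
  have h1 := lidded_low hk hkd h.top ha
  have h2 := lidded_low hk hkd h.bot (by rw [dim_neg, hb])
  have := tubeData_spec hk h1.1.even h1.2 h2.1.even h2.2 ε δ
  rwa [← h.data] at this

theorem bridge (h : FaceJoin k ε δ A B C a b K x) (hk : 1 < k) (hkd : k < d) (ha : a.dim = k)
    (hb : b.dim = k) : Bridge k (symmDiff A (low k a)) (lowLid k a) K x
      (symmDiff B (mirror (low k (-b)))) (-lowLid k (-b)) := by
  have h1 := lidded_low hk hkd h.top ha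
  have h2 := lidded_low hk hkd h.bot (by rw [dim_neg, hb])
  refine ⟨h1.1, ?_, (h.mid hk hkd ha hb).toTube, h.lid⟩
  rw [mirror_symmDiff, mirror_mirror, neg_neg]
  exact h2.1

theorem eq_joinFaces (h : FaceJoin k ε δ A B C a b K x) (hk : 1 < k) (hkd : k < d)
    (ha : a.dim = k) (hb : b.dim = k) :
    C = joinFaces (symmDiff B (mirror (low k (-b)))) (joinFaces (symmDiff A (low k a))
      (cubeBoundarySum K) (lowLid k a)) (-lowLid k (-b)) := by
  rw [(h.bridge hk hkd ha hb).joinFaces_eq, h.eq]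

theorem isXD_upper {n : ℕ} (hk : 1 < k) (hkd : k < d) (hb : IsTopFace (mirror B) (-b))
    (hB : IsXD k n B) : IsXD k (n + 2 * k) (symmDiff B (mirror (low k (-b)))) := by
  have := (low_isXD hk hkd hb (hB.image (-1) 0)).image (-1) 0
  change IsXD k (n + 2 * k) (mirror (symmDiff (mirror B) (low k (-b)))) at this
  rwa [mirror_symmDiff, mirror_mirror] at this

theorem isSAM_upper {n : ℕ} (hk : 1 < k) (hkd : k < d) (hb : IsTopFace (mirror B) (-b))
    (hB : IsSAM k n B) : IsSAM k (n + 2 * k) (symmDiff B (mirror (low k (-b)))) ∧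
      numBoundaryComponents (symmDiff B (mirror (low k (-b)))) = numBoundaryComponents B := by
  have h1 := low_isSAM hk hkd hb (hB.image (-1) 0)
  have h2 := h1.1.image (-1) 0
  change IsSAM k (n + 2 * k) (mirror (symmDiff (mirror B) (low k (-b)))) at h2
  rw [mirror_symmDiff, mirror_mirror] at h2
  refine ⟨h2, ?_⟩
  rw [← numBoundaryComponents_mirror, mirror_symmDiff, mirror_mirror, h1.2,
    numBoundaryComponents_mirror]

/-- Each cap adds `2k` faces and the tube has `2k(k + 1) + 2`; the 4 counts the two lids, each of
which is removed from both sides of its seam. -/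
theorem card_count (hk : 1 < k) (n m : ℕ) :
    n + m + extraFaces k + 4 = (n + 2 * k) + (m + 2 * k) + (2 * k * (k + 1) + 2) := by
  have h : 1 ≤ k ^ 2 + 3 * k := by nlinarith
  unfold extraFaces
  zify [h]
  ring

theorem isXD (h : FaceJoin k ε δ A B C a b K x) (hk : 1 < k) (hkd : k < d) {n m : ℕ}
    (hA : IsXD k n A) (hB : IsXD k m B) : IsXD k (n + m + extraFaces k) C := by
  have ha := hA.dim_eq a h.top.1
  have hb := hB.dim_eq b h.mem_bot
  rw [h.eq_joinFaces hk hkd ha hb]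
  refine (h.bridge hk hkd ha hb).isXD hk (lidded_low hk hkd h.top ha).2
    (low_isXD hk hkd h.top hA) (isXD_upper hk hkd h.bot hB) ?_
  rw [(h.mid hk hkd ha hb).card]
  exact card_count hk n m

theorem isSAM (h : FaceJoin k ε δ A B C a b K x) (hk : 1 < k) (hkd : k < d) {n m : ℕ}
    (hA : IsSAM k n A) (hB : IsSAM k m B) : IsSAM k (n + m + extraFaces k) C ∧
      numBoundaryComponents C = numBoundaryComponents A + numBoundaryComponents B := by
  have ha := hA.dim_eq a h.top.1
  have hb := hB.dim_eq b h.mem_bot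
  have h1 := low_isSAM hk hkd h.top hA
  have h2 := isSAM_upper hk hkd h.bot hB
  have hbr := h.bridge hk hkd ha hb
  refine ⟨⟨h.isXD hk hkd hA.toIsXD hB.toIsXD, ?_⟩, ?_⟩
  · rw [h.eq_joinFaces hk hkd ha hb]
    exact hbr.selfAvoiding h1.1.selfAvoiding h2.1.selfAvoiding
  · rw [h.eq_joinFaces hk hkd ha hb, hbr.numBoundaryComponents_eq, h1.2, h2.2]

theorem bottom (h : FaceJoin k ε δ A B C a b K x) (hk : 1 < k) (hkd : k < d) (ha : a.dim = k)
    (hb : b.dim = k) : Bottom A a C := by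
  have hbr := h.bridge hk hkd ha hb
  rw [h.eq, symmDiff_assoc]
  refine bottom_symmDiff hk hkd h.top ha fun f hf => ?_
  rw [mem_symmDiff] at hf
  rcases hf with ⟨hf, -⟩ | ⟨hf, -⟩
  · exact (hbr.height hf).1.1
  · have h1 := hbr.height_lid
    by_cases he : f = -lowLid k (-b)
    · rw [he, h1]; omega
    · have := hbr.upper_gt hf he
      omega

theorem bottom_mirror (h : FaceJoin k ε δ A B C a b K x) (hk : 1 < k) (hkd : k < d)
    (ha : a.dim = k) (hb : b.dim = k) : Bottom (mirror B) (-b) (mirror C) := by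
  have hbr := h.bridge hk hkd ha hb
  rw [h.eq, mirror_symmDiff, mirror_symmDiff B, mirror_mirror, symmDiff_comm]
  refine bottom_symmDiff hk hkd h.bot (by rw [dim_neg, hb]) fun f hf => ?_
  rw [mem_mirror, mem_symmDiff] at hf
  have h1 := hbr.height_lid
  simp only [Pi.neg_apply] at h1
  rcases hf with ⟨hf, -⟩ | ⟨hf, -⟩
  · by_cases he : -f = lowLid k a
    · have := congrFun he 0
      simp only [Pi.neg_apply] at this
      omega
    · have := hbr.lower.lt _ hf he
      simp only [Pi.neg_apply] at this
      omega
  · have := (hbr.height hf).1.2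
    simp only [Pi.neg_apply] at this
    omega

/-- The cubes are those of the tube and of the horizontal caps, the single faces those of the
vertical caps. Caps and tube occupy separate ranges of heights, so the sets are disjoint and their
sums mod 2 add up. -/
theorem isConcatenation (h : FaceJoin k ε δ A B C a b K x) (hk : 1 < k) (hkd : k < d)
    (ha : a.dim = k) (hb : b.dim = k) : IsConcatenation k A B C := by
  have hb' : (-b).dim = k := by rw [dim_neg, hb]
  have hbr := h.bridge hk hkd ha hb
  obtain ⟨a1, a2, a3⟩ := lowBuffer_spec hk hkd ha
  obtain ⟨b1, b2, b3⟩ := lowBuffer_spec hk hkd hb'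
  obtain ⟨a4, a5⟩ := low_height_le hk hkd ha
  obtain ⟨b4, b5⟩ := low_height_le hk hkd hb'
  have hl := hbr.height_lid
  simp only [Pi.neg_apply] at hl b4 b3 b2
  have hbv : (-b).Vertical ↔ b.Vertical := by rw [← affine_neg, vertical_affine]
  have hKd : Disjoint (lowCubes a ∪ K) (mirror (lowCubes (-b))) := by
    rw [Finset.disjoint_left]
    intro c hc hc'
    rw [mem_mirror] at hc'
    have h1 := b3 _ hc'
    simp only [Pi.neg_apply] at h1
    rcases mem_union.1 hc with hc | hc
    · have := a3 c hc; omega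
    · have := hbr.tube.height c hc; omega
  have hKd' : Disjoint (lowCubes a) K := by
    rw [Finset.disjoint_left]
    intro c hc hc'
    have := a3 c hc
    have := hbr.tube.height c hc'
    omega
  have hEd : Disjoint (lowBuffer k a) (mirror (lowBuffer k (-b))) := by
    rw [Finset.disjoint_left]
    intro f hf hf'
    rw [mem_mirror] at hf'
    have h1 := b2 _ hf'
    have h2 := a2 _ hf
    simp only [Pi.neg_apply] at h1
    omega
  have hE : lowBuffer k a ∪ mirror (lowBuffer k (-b)) =
      symmDiff (lowBuffer k a) (mirror (lowBuffer k (-b))) := hEd.symmDiff_eq_sup.symm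
  have hsum : symmDiff (cubeBoundarySum (lowCubes a ∪ K ∪ mirror (lowCubes (-b))))
      (lowBuffer k a ∪ mirror (lowBuffer k (-b))) =
      symmDiff (symmDiff (low k a) (cubeBoundarySum K)) (mirror (low k (-b))) := by
    rw [cubeBoundarySum_union hKd, cubeBoundarySum_union hKd', hE, low, low, mirror_symmDiff]
    rw [show cubeBoundarySum (mirror (lowCubes (-b))) = mirror (cubeBoundarySum (lowCubes (-b)))
      from cubeBoundarySum_image (-1) 0 _]
    simp only [symmDiff_assoc, symmDiff_left_comm, symmDiff_comm]
  refine ⟨a, h.top.1, b, h.mem_bot, lowCubes a ∪ K ∪ mirror (lowCubes (-b)),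
    lowBuffer k a ∪ mirror (lowBuffer k (-b)), h.top.2, ?_, by omega, ?_, ?_, ?_, ?_, ?_⟩
  · intro f hf
    have := h.bot.2 (-f) (neg_mem_mirror.2 hf)
    rw [toLex_le_iff] at this ⊢
    rcases this with h1 | ⟨i, h1, h2⟩
    · exact Or.inl (neg_injective h1.symm)
    · right
      refine ⟨i, fun j hj => ?_, ?_⟩
      · have := h1 j hj; simp only [Pi.neg_apply] at this; omega
      · simp only [Pi.neg_apply] at h2; omega
  · intro c hc
    rw [mem_union, mem_union, mem_mirror] at hc
    rcases hc with (hc | hc) | hc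
    · exact (a3 c hc).1
    · exact hbr.tube.dim c hc
    · rw [← dim_neg]; exact (b3 _ hc).1
  · intro f hf
    rw [mem_union, mem_mirror] at hf
    rcases hf with hf | hf
    · exact (a2 f hf).1
    · rw [← dim_neg]; exact (b2 _ hf).1
  · rw [card_union_of_disjoint hEd, a1, mirror, card_image_of_injective _ (affine _ _).injective,
      b1]
    simp only [hbv]
  · rw [hsum]
    intro q hq
    have hq' : q ∈ low k a ∨ q ∈ cubeBoundarySum K ∨ -q ∈ low k (-b) := by
      rw [← mem_mirror]
      simp only [mem_symmDiff] at hq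
      tauto
    rcases hq' with hq | hq | hq
    · rcases low_height hk hkd ha hq with h1 | h1
      · exact Or.inl h1
      · have := a5 q hq
        right; right; omega
    · have := (hbr.height hq).1
      right; right; omega
    · rcases low_height hk hkd hb' hq with h1 | h1
      · exact Or.inr (Or.inl (neg_injective h1))
      · have := b5 _ hq
        simp only [Pi.neg_apply] at h1 this
        right; right; omega
  · rw [hsum, h.eq]
    simp only [symmDiff_assoc, symmDiff_left_comm, symmDiff_comm]

end FaceJoin

end

/-! ### Joins of translation classes of face sets, and injectivity. -/

section

open Cell

variable {d : ℕ} [NeZero d]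

theorem mirror_translate (S : Finset (Cell d)) (w : Fin d → ℤ) :
    mirror (S.image (affine 1 w)) = (mirror S).image (affine 1 (-w)) := by
  ext f
  obtain ⟨f, rfl⟩ := (affine 1 (-w)).surjective f
  have : -affine 1 (-w) f = affine 1 w (-f) := by ext i; simp [affine_apply]; ring
  rw [mem_image_affine, mem_mirror, mem_mirror, this, mem_image_affine]

theorem IsTopFace.unique {A : Finset (Cell d)} {a a' : Cell d} (h : IsTopFace A a)
    (h' : IsTopFace A a') : a = a' :=
  toLex.injective (le_antisymm (h'.2 a h.1) (h.2 a' h'.1))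

theorem affine_one_zero (c : Cell d) : affine 1 0 c = c := by ext i; simp [affine_apply]

theorem image_affine_one_zero (S : Finset (Cell d)) : S.image (affine 1 0) = S := by
  ext f
  conv_lhs => rw [← affine_one_zero f]
  rw [mem_image_affine]

theorem eq_zero_of_normal {v : Fin d → ℤ} {a : Cell d} (h : ∀ i, a i = 0 ∨ a i = 1)
    (h' : ∀ i, affine 1 v a i = 0 ∨ affine 1 v a i = 1) : v = 0 := by
  ext i
  have h1 := h i
  have h2 := h' i
  simp only [affine_apply, Units.val_one, one_mul] at h2
  simp only [Pi.zero_apply]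
  omega

/-- The top facets of the cubes survive in the sum mod 2, and each of them determines its cube. -/
theorem Tube.cubes_eq {k : ℕ} {l x x' : Cell d} {K K' : Finset (Cell d)} (h : Tube k l K x)
    (h' : Tube k l K' x') (hl : Even (l 0)) (he : cubeBoundarySum K = cubeBoundarySum K') :
    K = K' := by
  have key : ∀ {K K' : Finset (Cell d)} {x x' : Cell d}, Tube k l K x → Tube k l K' x' →
      cubeBoundarySum K = cubeBoundarySum K' → K ⊆ K' := by
    intro K K' x x' h h' he c hc
    have hc0 := h.height c hc
    have ho : Odd (c 0) := by rw [hc0]; exact hl.add_one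
    have hq : c + Pi.single 0 1 ∈ c.facets := add_single_mem_facets ho (Or.inl rfl)
    have hne : (c + Pi.single 0 1 : Cell d) 0 ≠ l 0 + 1 := by simp [hc0]
    have hm : c + Pi.single 0 1 ∈ cubeBoundarySum K := by
      refine mem_cubeBoundarySum_of_unique hc hq fun c' hc' hq' => ?_
      rw [eq_of_top_mem_facets h.height hc hq hne, eq_of_top_mem_facets h.height hc' hq' hne]
    rw [he] at hm
    obtain ⟨c', hc', hq'⟩ := exists_of_mem_cubeBoundarySum hm
    have e : c' = c := by
      exact (eq_of_top_mem_facets h'.height hc' hq' hne).trans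
        (eq_of_top_mem_facets h.height hc hq hne).symm
    exact e ▸ hc'
  exact (key h h' he).antisymm (key h' h he.symm)

theorem exists_faceJoin {k : ℕ} (hk : 1 < k) (hkd : k < d) {A B : Finset (Cell d)}
    (hA : A.Nonempty) (hB : B.Nonempty) (hAd : ∀ f ∈ A, f.dim = k) (hBd : ∀ f ∈ B, f.dim = k)
    (ε δ : Fin d → Bool) : ∃ v w C a b K x,
      FaceJoin k ε δ (A.image (affine 1 v)) (B.image (affine 1 w)) C a b K x := by
  obtain ⟨a, ha⟩ := exists_isTopFace hA
  obtain ⟨b, hb⟩ := exists_isTopFace (hB.image (affine (-1) 0))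
  change IsTopFace (mirror B) b at hb
  -- Floor division leaves the remainders 0 and 1, that is, the normal position of `a`.
  set v : Fin d → ℤ := fun i => -(a i / 2) with hv
  have hb1 : b.dim = k := by
    have := hBd (-b) (mem_mirror.1 hb.1); rwa [dim_neg] at this
  have ha' := isTopFace_translate ha v
  have ha1 : (affine 1 v a).dim = k := by rw [dim_affine]; exact hAd a ha.1
  have h1 := lidded_low hk hkd ha' ha1
  have h2 := lidded_low hk hkd hb hb1
  set p := tubeData k (lowLid k (affine 1 v a)) (lowLid k b).halfInt ε δ with hp
  have hm := tubeData_spec hk h1.1.even h1.2 h2.1.even h2.2 ε δ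
  rw [← hp] at hm
  -- The translation that puts the reflected upper lid on top of the final cube. It is integral
  -- because both have the same half-integer dimensions.
  set w : Fin d → ℤ := fun i => ((p.2 + Pi.single 0 1 : Cell d) i + lowLid k b i) / 2 with hw
  have hw2 : ∀ i, 2 * w i = (p.2 + Pi.single 0 1 : Cell d) i + lowLid k b i := by
    intro i
    have h3 := congrArg (i ∈ ·) hm.lid
    simp only [mem_halfInt, eq_iff_iff] at h3
    apply Int.mul_ediv_cancel'
    rw [← even_iff_two_dvd, Int.even_add, ← Int.not_odd_iff_even, ← Int.not_odd_iff_even, h3]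
  refine ⟨v, w, _, affine 1 v a, -affine 1 (-w) b, p.1, p.2, ha', ?_, ?_, ?_, ?_, rfl⟩
  · rw [neg_neg, mirror_translate]
    exact isTopFace_translate hb _
  · intro i
    simp only [affine_apply, Units.val_one, one_mul, hv]
    omega
  · rw [neg_neg, lowLid_translate k (-w), halfInt_affine]
  · rw [neg_neg, lowLid_translate]
    ext i
    have := hw2 i
    simp only [affine_apply, Pi.neg_apply, Units.val_one, one_mul]
    omega

namespace FaceJoin

variable {k : ℕ} {ε δ ε' δ' : Fin d → Bool} {A B C K A' B' C' K' : Finset (Cell d)}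
  {a b x a' b' x' : Cell d}

/-- The normal position of `a` forces `v = 0`. Then both tubes are the same choice, because
translating `B` does not change the orientation of its lid, and the position of the lid forces `w =
0`. -/
theorem eq_of_translate {v w : Fin d → ℤ} (h : FaceJoin k ε δ A B C a b K x)
    (h' : FaceJoin k ε δ (A.image (affine 1 v)) (B.image (affine 1 w)) C' a' b' K' x') :
    C = C' := by
  have h1 := (isTopFace_translate h.top v).unique h'.top
  have hv : v = 0 := eq_zero_of_normal h.normal (h1 ▸ h'.normal)
  subst hv
  rw [affine_one_zero] at h1
  subst h1
  have h2 := (isTopFace_translate h.bot (-w)).unique (mirror_translate B w ▸ h'.bot)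
  have h3 := h'.data
  rw [← h2, lowLid_translate, halfInt_affine, ← h.data, Prod.mk.injEq] at h3
  obtain ⟨rfl, rfl⟩ := h3
  have hw : w = 0 := by
    have h4 := h'.lid
    rw [← h.lid, ← h2, lowLid_translate] at h4
    ext i
    have := congrFun h4 i
    simp only [affine_apply, Pi.neg_apply, Units.val_one, one_mul] at this
    simp only [Pi.zero_apply]
    omega
  subst hw
  rw [neg_zero, affine_one_zero] at h2
  rw [h.eq, h'.eq, ← h2, image_affine_one_zero, image_affine_one_zero]

theorem decode {v : Fin d → ℤ} (hk : 1 < k) (hkd : k < d) (h : FaceJoin k ε δ A B C a b K x)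
    (h' : FaceJoin k ε' δ' A' B' (C.image (affine 1 v)) a' b' K' x')
    (ha : a.dim = k) (hb : b.dim = k) (ha' : a'.dim = k) (hb' : b'.dim = k)
    (hA : A.card = A'.card) (hB : B.card = B'.card) :
    v = 0 ∧ A = A' ∧ B = B' ∧ a = a' ∧ b = b' ∧ (∀ i ∈ (lowLid k a).halfInt, ε i = ε' i) ∧
      ∀ i ∈ (lowLid k (-b)).halfInt, δ i = δ' i := by
  obtain ⟨h1, h2⟩ := ((h.bottom hk hkd ha hb).translate v).unique hk (h'.bottom hk hkd ha' hb')
    (by rw [dim_affine, ha]) ha'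
    (by rw [card_image_of_injective _ (affine 1 v).injective, hA])
  have hv : v = 0 := eq_zero_of_normal h.normal (h2 ▸ h'.normal)
  subst hv
  rw [image_affine_one_zero] at h1 h'
  rw [affine_one_zero] at h2
  subst h1 h2
  obtain ⟨h3, h4⟩ := (h.bottom_mirror hk hkd ha hb).unique hk (h'.bottom_mirror hk hkd ha' hb')
    (by rw [dim_neg, hb]) (by rw [dim_neg, hb'])
    (by rw [mirror, mirror, card_image_of_injective _ (affine _ _).injective,
      card_image_of_injective _ (affine _ _).injective, hB])
  have h3' : B = B' := by rw [← mirror_mirror B, h3, mirror_mirror]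
  have h4' : b = b' := neg_injective h4
  subst h3' h4'
  have hx : x = x' := add_right_cancel (h.lid.symm.trans h'.lid)
  subst hx
  have hm := h.mid hk hkd ha hb
  have hm' := h'.mid hk hkd ha hb
  -- The two capped parts are known by now and cancel mod 2.
  have hT : cubeBoundarySum K = cubeBoundarySum K' :=
    symmDiff_right_injective _ (symmDiff_left_injective _ (h.eq.symm.trans h'.eq))
  have hK : K = K' := hm.toTube.cubes_eq hm'.toTube (lidded_low hk hkd h.top ha).1.even hT
  subst hK
  exact ⟨rfl, rfl, rfl, rfl, rfl, hm.code_unique hm'⟩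

end FaceJoin

theorem faceClass_eq_iff {A B : Finset (Cell d)} :
    (⟦A⟧ : FaceClass d) = ⟦B⟧ ↔ ∃ v, B = A.image (affine 1 v) := by
  rw [Quotient.eq]
  simp only [affine_one]
  rfl

theorem mk_image_affine (A : Finset (Cell d)) (v : Fin d → ℤ) :
    (⟦A.image (affine 1 v)⟧ : FaceClass d) = ⟦A⟧ := (faceClass_eq_iff.2 ⟨v, rfl⟩).symm

/-- `Z` is the join of `X` and `Y` by a tube encoding only zeros. -/
def ClassJoin (k : ℕ) (X Y Z : FaceClass d) : Prop :=
  ∃ A B C a b K x, X = ⟦A⟧ ∧ Y = ⟦B⟧ ∧ Z = ⟦C⟧ ∧ (∃ n, IsXD k n A) ∧ (∃ m, IsXD k m B) ∧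
    FaceJoin k (fun _ => false) (fun _ => false) A B C a b K x

namespace ClassJoin

variable {k : ℕ} {X Y Z X' Y' Z' : FaceClass d}

theorem exists_of_mem {n m : ℕ} (hk : 1 < k) (hkd : k < d) (hX : X ∈ XD d k n)
    (hY : Y ∈ XD d k m) : ∃ Z, ClassJoin k X Y Z := by
  obtain ⟨A, rfl, hA⟩ := hX
  obtain ⟨B, rfl, hB⟩ := hY
  obtain ⟨v, w, C, a, b, K, x, h⟩ := exists_faceJoin hk hkd hA.connected.1 hB.connected.1
    hA.dim_eq hB.dim_eq (fun _ => false) (fun _ => false)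
  exact ⟨⟦C⟧, _, _, C, a, b, K, x, (mk_image_affine A v).symm, (mk_image_affine B w).symm, rfl,
    ⟨n, hA.image 1 v⟩, ⟨m, hB.image 1 w⟩, h⟩

theorem unique (h : ClassJoin k X Y Z) (h' : ClassJoin k X Y Z') : Z = Z' := by
  obtain ⟨A, B, C, a, b, K, x, hA, hB, rfl, -, -, h⟩ := h
  obtain ⟨A', B', C', a', b', K', x', hA', hB', rfl, -, -, h'⟩ := h'
  obtain ⟨v, rfl⟩ := faceClass_eq_iff.1 (hA.symm.trans hA')
  obtain ⟨w, rfl⟩ := faceClass_eq_iff.1 (hB.symm.trans hB')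
  rw [h.eq_of_translate h']

theorem isXD_of_mem {n : ℕ} {A : Finset (Cell d)} (h : (⟦A⟧ : FaceClass d) ∈ XD d k n) :
    IsXD k n A := by
  obtain ⟨A', e, hA'⟩ := h
  obtain ⟨v, rfl⟩ := faceClass_eq_iff.1 e.symm
  exact hA'.image 1 v

theorem isSAM_of_mem {n : ℕ} {A : Finset (Cell d)} (h : (⟦A⟧ : FaceClass d) ∈ SAM d k n) :
    IsSAM k n A := by
  obtain ⟨A', e, hA'⟩ := h
  obtain ⟨v, rfl⟩ := faceClass_eq_iff.1 e.symm
  exact hA'.image 1 v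

theorem isSAM_of_mem_SAMh {n r : ℕ} {A : Finset (Cell d)} (h : (⟦A⟧ : FaceClass d) ∈ SAMh d k n r) :
    IsSAM k n A ∧ numBoundaryComponents A = r := by
  obtain ⟨A', e, hA', hr⟩ := h
  obtain ⟨v, rfl⟩ := faceClass_eq_iff.1 e.symm
  exact ⟨hA'.image 1 v, by rw [numBoundaryComponents_image, hr]⟩

theorem mem_XD {n m : ℕ} (hk : 1 < k) (hkd : k < d) (h : ClassJoin k X Y Z)
    (hX : X ∈ XD d k n) (hY : Y ∈ XD d k m) : Z ∈ XD d k (n + m + extraFaces k) := by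
  obtain ⟨A, B, C, a, b, K, x, rfl, rfl, rfl, -, -, h⟩ := h
  exact ⟨C, rfl, h.isXD hk hkd (isXD_of_mem hX) (isXD_of_mem hY)⟩

theorem mem_SAMh {n m r s : ℕ} (hk : 1 < k) (hkd : k < d) (h : ClassJoin k X Y Z)
    (hX : X ∈ SAMh d k n r) (hY : Y ∈ SAMh d k m s) :
    Z ∈ SAMh d k (n + m + extraFaces k) (r + s) := by
  obtain ⟨A, B, C, a, b, K, x, rfl, rfl, rfl, -, -, h⟩ := h
  obtain ⟨hA, rfl⟩ := isSAM_of_mem_SAMh hX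
  obtain ⟨hB, rfl⟩ := isSAM_of_mem_SAMh hY
  obtain ⟨h1, h2⟩ := h.isSAM hk hkd hA hB
  exact ⟨C, rfl, h1, h2⟩

theorem isConcatenation (hk : 1 < k) (hkd : k < d) (h : ClassJoin k X Y Z) :
    FaceClass.IsConcatenation k X Y Z := by
  obtain ⟨A, B, C, a, b, K, x, rfl, rfl, rfl, ⟨n, hA⟩, ⟨m, hB⟩, h⟩ := h
  exact ⟨A, B, C, rfl, rfl, rfl, h.isConcatenation hk hkd (hA.dim_eq a h.top.1)
    (hB.dim_eq b h.mem_bot)⟩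

theorem injective {n m : ℕ} (hk : 1 < k) (hkd : k < d) (h : ClassJoin k X Y Z)
    (h' : ClassJoin k X' Y' Z) (hX : X ∈ XD d k n) (hY : Y ∈ XD d k m)
    (hX' : X' ∈ XD d k n) (hY' : Y' ∈ XD d k m) : X = X' ∧ Y = Y' := by
  obtain ⟨A, B, C, a, b, K, x, rfl, rfl, rfl, -, -, h⟩ := h
  obtain ⟨A', B', C', a', b', K', x', rfl, rfl, hC, -, -, h'⟩ := h'
  obtain ⟨v, rfl⟩ := faceClass_eq_iff.1 hC
  have hA := isXD_of_mem hX
  have hB := isXD_of_mem hY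
  have hA' := isXD_of_mem hX'
  have hB' := isXD_of_mem hY'
  obtain ⟨-, h1, h2, -⟩ := h.decode hk hkd h' (hA.dim_eq a h.top.1) (hB.dim_eq b h.mem_bot)
    (hA'.dim_eq a' h'.top.1) (hB'.dim_eq b' h'.mem_bot) (hA.card_eq.trans hA'.card_eq.symm)
    (hB.card_eq.trans hB'.card_eq.symm)
  rw [h1, h2]
  exact ⟨rfl, rfl⟩

end ClassJoin

theorem SAMh_subset (d k n r : ℕ) : SAMh d k n r ⊆ SAM d k n :=
  fun _ ⟨S, h1, h2, _⟩ => ⟨S, h1, h2⟩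

theorem SAM_subset (d k n : ℕ) : SAM d k n ⊆ XD d k n :=
  fun _ ⟨S, h1, h2⟩ => ⟨S, h1, h2.toIsXD⟩

theorem mem_SAM_iff {d k n : ℕ} {X : FaceClass d} : X ∈ SAM d k n ↔ ∃ r, X ∈ SAMh d k n r :=
  ⟨fun ⟨S, h1, h2⟩ => ⟨_, S, h1, h2, rfl⟩, fun ⟨r, h⟩ => SAMh_subset d k n r h⟩

end

/-! ### Pairings of faces at an edge, and the osculating condition. -/

section

open Cell

variable {d : ℕ}

/-- `P` pairs off the elements of `D`, up to at most one. -/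
structure IsPairing (D : Finset (Cell d)) (P : Finset (Sym2 (Cell d))) : Prop where
  mem : ∀ {x y}, s(x, y) ∈ P → x ∈ D
  ne : ∀ {x y}, s(x, y) ∈ P → x ≠ y
  unique : ∀ {x y z}, s(x, y) ∈ P → s(x, z) ∈ P → y = z
  lone : ∀ {x y}, x ∈ D → y ∈ D → (∀ z, s(x, z) ∉ P) → (∀ z, s(y, z) ∉ P) → x = y

/-- The osculating condition for the faces `D` at `g` that are paired by `P`, in terms of antipodal
pairs. -/
def Osc (g : Cell d) (D : Finset (Cell d)) (P : Finset (Sym2 (Cell d))) : Prop :=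
  (∀ x y z w, s(x, y) ∈ P → s(z, w) ∈ P → x + y = 2 • g → z + w = 2 • g → s(x, y) = s(z, w)) ∧
  (Odd D.card → ∃ l ∈ D, (∀ z, s(l, z) ∉ P) ∧ ∃ f : Cell d, g ∈ f.facets ∧ f ∉ D ∧
    (l + f = 2 • g → ∀ x y, s(x, y) ∈ P → x + y ≠ 2 • g))

theorem sym2_mem_swap {P : Finset (Sym2 (Cell d))} {x y : Cell d} :
    s(x, y) ∈ P ↔ s(y, x) ∈ P := by rw [Sym2.eq_swap]

theorem sym2_finset_ext {P Q : Finset (Sym2 (Cell d))} (h : ∀ x y, s(x, y) ∈ P ↔ s(x, y) ∈ Q) :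
    P = Q := by
  ext p
  induction p with
  | _ x y => exact h x y

theorem mem_image_sym2_map {P : Finset (Sym2 (Cell d))} (σ : Equiv.Perm (Cell d)) {x y : Cell d} :
    s(σ x, σ y) ∈ P.image (Sym2.map σ) ↔ s(x, y) ∈ P := by
  rw [mem_image]
  constructor
  · rintro ⟨p, hp, he⟩
    have : p = s(x, y) := Sym2.map.injective σ.injective (by rw [he, Sym2.map_mk])
    exact this ▸ hp
  · intro h; exact ⟨_, h, Sym2.map_mk ..⟩

theorem IsPairing.image {D : Finset (Cell d)} {P : Finset (Sym2 (Cell d))} (h : IsPairing D P)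
    (σ : Equiv.Perm (Cell d)) : IsPairing (D.image σ) (P.image (Sym2.map σ)) := by
  have hm : ∀ x, σ x ∈ D.image σ ↔ x ∈ D := fun x => by simp
  refine ⟨?_, ?_, ?_, ?_⟩
  · intro x y
    obtain ⟨x, rfl⟩ := σ.surjective x
    obtain ⟨y, rfl⟩ := σ.surjective y
    rw [mem_image_sym2_map, hm]; exact h.mem
  · intro x y
    obtain ⟨x, rfl⟩ := σ.surjective x
    obtain ⟨y, rfl⟩ := σ.surjective y
    rw [mem_image_sym2_map, σ.injective.ne_iff]; exact h.ne
  · intro x y z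
    obtain ⟨x, rfl⟩ := σ.surjective x
    obtain ⟨y, rfl⟩ := σ.surjective y
    obtain ⟨z, rfl⟩ := σ.surjective z
    rw [mem_image_sym2_map, mem_image_sym2_map]
    intro h1 h2; rw [h.unique h1 h2]
  · intro x y
    obtain ⟨x, rfl⟩ := σ.surjective x
    obtain ⟨y, rfl⟩ := σ.surjective y
    rw [hm, hm]
    intro h1 h2 h3 h4
    rw [h.lone h1 h2 (fun z hz => h3 (σ z) ((mem_image_sym2_map σ).2 hz))
      (fun z hz => h4 (σ z) ((mem_image_sym2_map σ).2 hz))]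

-- Passing to the partner is an involution without fixed points on the paired elements, so their
-- number is even; at most one element is left over.
open Classical in
theorem IsPairing.card_lone {D : Finset (Cell d)} {P : Finset (Sym2 (Cell d))}
    (h : IsPairing D P) : (D.filter fun x => ∀ z, s(x, z) ∉ P).card = D.card % 2 := by
  have h1 : (D.filter fun x => ∀ z, s(x, z) ∉ P).card ≤ 1 := by
    rw [card_le_one]
    intro x hx y hy
    rw [mem_filter] at hx hy
    exact h.lone hx.1 hy.1 hx.2 hy.2
  have h2 := card_filter_add_card_filter_not (s := D) fun x => ∀ z, s(x, z) ∉ P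
  -- In `ZMod 2` each element cancels against its partner.
  have h3 : Even (D.filter fun x => ¬ ∀ z, s(x, z) ∉ P).card := by
    rw [← ZMod.natCast_eq_zero_iff_even, card_eq_sum_ones, Nat.cast_sum]
    have hex : ∀ x ∈ D.filter fun x => ¬ ∀ z, s(x, z) ∉ P, ∃ z, s(x, z) ∈ P := by
      intro x hx
      rw [mem_filter] at hx
      push Not at hx
      exact hx.2
    choose! q hq using hex
    have hq' : ∀ x ∈ D.filter fun x => ¬ ∀ z, s(x, z) ∉ P,
        q x ∈ D.filter fun x => ¬ ∀ z, s(x, z) ∉ P := by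
      intro x hx
      have := sym2_mem_swap.1 (hq x hx)
      rw [mem_filter]
      exact ⟨h.mem this, fun hn => hn _ this⟩
    refine Finset.sum_involution (fun x _ => q x) ?_ ?_ hq' ?_
    · intro x hx; decide
    · intro x hx _; exact (h.ne (hq x hx)).symm
    · intro x hx
      exact h.unique (hq _ (hq' x hx)) (sym2_mem_swap.1 (hq x hx))
  obtain ⟨r, hr⟩ := h3
  omega

theorem sub_eq_single {f g : Cell d} (h : g ∈ f.facets) :
    ∃ (j : Fin d) (s : ℤ), (s = 1 ∨ s = -1) ∧ f - g = Pi.single j s := by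
  obtain ⟨j, s, -, hs, rfl⟩ := exists_of_mem_facets h
  refine ⟨j, -s, by omega, ?_⟩
  ext i
  simp only [Pi.sub_apply, Pi.add_apply, Pi.single_neg, Pi.neg_apply]
  ring

theorem sub_eq_neg_sub_iff {x y g : Cell d} : x - g = -(y - g) ↔ x + y = 2 • g := by
  constructor <;> intro h <;> ext i <;> have := congrFun h i <;> simp at this ⊢ <;> omega

/-- Both vectors are signed unit coordinate vectors, and two different ones are either opposite or
orthogonal. -/
theorem dotProduct_sub_eq_zero_iff {x y g : Cell d} (hx : g ∈ x.facets) (hy : g ∈ y.facets)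
    (hne : x ≠ y) : (x - g) ⬝ᵥ (y - g) = 0 ↔ x + y ≠ 2 • g := by
  rw [Ne, ← sub_eq_neg_sub_iff]
  obtain ⟨i, s, hs, h1⟩ := sub_eq_single hx
  obtain ⟨j, t, ht, h2⟩ := sub_eq_single hy
  have hne' : (Pi.single i s : Cell d) ≠ Pi.single j t := by
    rw [← h1, ← h2]; exact fun h => hne (sub_left_injective h)
  rw [h1, h2, single_dotProduct]
  by_cases hij : i = j
  · subst hij
    have hst : s ≠ t := fun h => hne' (by rw [h])
    have : s = -t := by omega
    subst this
    rcases ht with rfl | rfl <;> simp [Pi.single_neg]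
  · have h0 : s ≠ 0 := by omega
    simp only [Pi.single_eq_of_ne hij, mul_zero, true_iff]
    intro h
    have := congrFun h i
    simp [hij] at this
    omega

/-- In a pairing, different pairs are automatically disjoint. What remains of the osculating
condition is that at most one pair is antipodal. -/
theorem pairsOsculate_iff {g : Cell d} {P : Finset (Sym2 (Cell d))}
    (hg : ∀ x y, s(x, y) ∈ P → g ∈ x.facets) (hne : ∀ x y, s(x, y) ∈ P → x ≠ y)
    (hu : ∀ x y z, s(x, y) ∈ P → s(x, z) ∈ P → y = z) :
    LinkedFaces.PairsOsculate g P ↔ ∀ x y z w, s(x, y) ∈ P → s(z, w) ∈ P → x + y = 2 • g →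
      z + w = 2 • g → s(x, y) = s(z, w) := by
  have hg' : ∀ x y, s(x, y) ∈ P → g ∈ y.facets := fun x y h => hg y x (sym2_mem_swap.1 h)
  constructor
  · intro h x y z w hxy hzw h1 h2
    by_contra hcon
    have := (h x y z w hxy hzw hcon).2 (sub_eq_neg_sub_iff.2 h1)
    rw [dotProduct_sub_eq_zero_iff (hg _ _ hzw) (hg' _ _ hzw) (hne _ _ hzw)] at this
    exact this h2
  · intro h x y z w hxy hzw hn
    refine ⟨?_, fun h1 => ?_⟩
    · have a1 := hne _ _ hxy
      have a2 := hne _ _ hzw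
      have a3 : x ≠ z := by
        rintro rfl; exact hn (by rw [hu _ _ _ hxy hzw])
      have a4 : x ≠ w := by
        rintro rfl; exact hn (by rw [hu _ _ _ hxy (sym2_mem_swap.1 hzw), Sym2.eq_swap])
      have a5 : y ≠ z := by
        rintro rfl; exact hn (by rw [hu _ _ _ (sym2_mem_swap.1 hxy) hzw, Sym2.eq_swap])
      have a6 : y ≠ w := by
        rintro rfl
        exact hn (by rw [hu _ _ _ (sym2_mem_swap.1 hxy) (sym2_mem_swap.1 hzw)])
      simp [sub_left_inj, a1, a2, a3, a4, a5, a6]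
    · rw [dotProduct_sub_eq_zero_iff (hg _ _ hzw) (hg' _ _ hzw) (hne _ _ hzw)]
      exact fun h2 => hn (h x y z w hxy hzw (sub_eq_neg_sub_iff.1 h1) h2)

namespace LinkedFaces

theorem mem_linksAt {X : LinkedFaces d} {g x y : Cell d} :
    s(x, y) ∈ X.linksAt g ↔ s(x, y) ∈ X.links ∧ g ∈ x.facets ∧ g ∈ y.facets := by
  simp [linksAt, Sym2.mem_toFinset]

theorem mem_loneAt {X : LinkedFaces d} {g x : Cell d} :
    x ∈ X.loneAt g ↔ x ∈ cofaces X.faces g ∧ ∀ z, s(x, z) ∉ X.linksAt g := by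
  rw [loneAt, mem_filter]
  refine and_congr_right fun _ => ⟨fun h z hz => h _ hz (Sym2.mem_mk_left x z), fun h p hp hx => ?_⟩
  obtain ⟨y, rfl⟩ := hx
  exact h y hp

/-- At every edge the links pair off the faces, up to at most one. -/
structure IsPaired (X : LinkedFaces d) : Prop where
  share : ∀ {x y}, s(x, y) ∈ X.links → ShareFacet x y
  pairing : ∀ g, IsPairing (cofaces X.faces g) (X.linksAt g)

theorem IsPaired.mem {X : LinkedFaces d} (h : X.IsPaired) {x y : Cell d} (hxy : s(x, y) ∈ X.links) :
    x ∈ X.faces := by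
  obtain ⟨g, h1, h2⟩ := h.share hxy
  exact (mem_cofaces.1 ((h.pairing g).mem (mem_linksAt.2 ⟨hxy, h1, h2⟩))).1

theorem IsPaired.ne {X : LinkedFaces d} (h : X.IsPaired) {x y : Cell d} (hxy : s(x, y) ∈ X.links) :
    x ≠ y := by
  obtain ⟨g, h1, h2⟩ := h.share hxy
  exact (h.pairing g).ne (mem_linksAt.2 ⟨hxy, h1, h2⟩)

/-- Adding the pair of the lone face `l` and an unoccupied `f'` gives a pairing again, so the
condition is only that this pair is not a second antipodal one. -/
theorem osculatesAt_iff {X : LinkedFaces d} {g : Cell d}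
    (h : IsPairing (cofaces X.faces g) (X.linksAt g)) :
    X.OsculatesAt g ↔ Osc g (cofaces X.faces g) (X.linksAt g) := by
  have hg : ∀ x y, s(x, y) ∈ X.linksAt g → g ∈ x.facets := fun x y h => (mem_linksAt.1 h).2.1
  have hP := pairsOsculate_iff hg (fun _ _ => h.ne) (fun _ _ _ => h.unique)
  have hins : ∀ l f', l ∈ X.loneAt g → g ∈ f'.facets → f' ∉ X.faces →
      (PairsOsculate g (insert s(l, f') (X.linksAt g)) ↔
        (PairsOsculate g (X.linksAt g) ∧
          (l + f' = 2 • g → ∀ x y, s(x, y) ∈ X.linksAt g → x + y ≠ 2 • g))) := by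
    intro l f' hl hf hf'
    rw [mem_loneAt] at hl
    have hlf : l ≠ f' := fun e => hf' (e ▸ (mem_cofaces.1 hl.1).1)
    have hfn : ∀ z, s(f', z) ∉ X.linksAt g := fun z hz => hf' (mem_cofaces.1 (h.mem hz)).1
    rw [hP, pairsOsculate_iff]
    · simp only [mem_insert]
      constructor
      · intro H
        refine ⟨fun x y z w h1 h2 => H x y z w (Or.inr h1) (Or.inr h2), fun h1 x y h2 h3 => ?_⟩
        have := H x y l f' (Or.inr h2) (Or.inl rfl) h3 h1
        exact hl.2 f' (this ▸ h2)
      · rintro ⟨H1, H2⟩ x y z w h1 h2 h3 h4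
        have hsum : ∀ x y, s(x, y) = s(l, f') → x + y = l + f' := by
          intro x y he
          rcases Sym2.eq_iff.1 he with ⟨rfl, rfl⟩ | ⟨rfl, rfl⟩
          exacts [rfl, add_comm _ _]
        rcases h1 with h1 | h1 <;> rcases h2 with h2 | h2
        · rw [h1, h2]
        · exact absurd h4 (H2 ((hsum _ _ h1).symm.trans h3) z w h2)
        · exact absurd h3 (H2 ((hsum _ _ h2).symm.trans h4) x y h1)
        · exact H1 x y z w h1 h2 h3 h4
    · intro x y hxy
      rw [mem_insert] at hxy
      rcases hxy with hxy | hxy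
      · rcases Sym2.eq_iff.1 hxy with ⟨rfl, rfl⟩ | ⟨rfl, rfl⟩
        exacts [(mem_cofaces.1 hl.1).2, hf]
      · exact hg x y hxy
    · intro x y hxy
      rw [mem_insert] at hxy
      rcases hxy with hxy | hxy
      · rcases Sym2.eq_iff.1 hxy with ⟨rfl, rfl⟩ | ⟨rfl, rfl⟩
        exacts [hlf, hlf.symm]
      · exact h.ne hxy
    · intro x y z hxy hxz
      rw [mem_insert] at hxy hxz
      rcases hxy with hxy | hxy <;> rcases hxz with hxz | hxz
      · exact (Sym2.congr_right.1 (hxy.trans hxz.symm))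
      · rcases Sym2.eq_iff.1 hxy with ⟨rfl, rfl⟩ | ⟨rfl, rfl⟩
        exacts [absurd hxz (hl.2 _), absurd hxz (hfn _)]
      · rcases Sym2.eq_iff.1 hxz with ⟨rfl, rfl⟩ | ⟨rfl, rfl⟩
        exacts [absurd hxy (hl.2 _), absurd hxy (hfn _)]
      · exact h.unique hxy hxz
  rw [OsculatesAt, Osc, ← hP]
  have hfm : ∀ f', g ∈ f'.facets → (f' ∉ X.faces ↔ f' ∉ cofaces X.faces g) := by
    intro f' hf'; rw [mem_cofaces]; tauto
  constructor
  · rintro ⟨h1, h2⟩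
    refine ⟨?_, fun ho => ?_⟩
    · rcases Nat.even_or_odd (cofaces X.faces g).card with he | ho
      · exact h1 he
      · obtain ⟨l, hl, f', h3, h4, h5⟩ := h2 ho
        exact ((hins l f' hl h3 h4).1 h5).1
    · obtain ⟨l, hl, f', h3, h4, h5⟩ := h2 ho
      exact ⟨l, (mem_loneAt.1 hl).1, (mem_loneAt.1 hl).2, f', h3, (hfm f' h3).1 h4,
        ((hins l f' hl h3 h4).1 h5).2⟩
  · rintro ⟨h1, h2⟩
    refine ⟨fun _ => h1, fun ho => ?_⟩
    obtain ⟨l, hl, hl', f', h3, h4, h5⟩ := h2 ho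
    have hlm := mem_loneAt.2 ⟨hl, hl'⟩
    exact ⟨l, hlm, f', h3, (hfm f' h3).2 h4, (hins l f' hlm h3 ((hfm f' h3).2 h4)).2 ⟨h1, h5⟩⟩

/-- At every edge with more than two faces the osculating condition holds. -/
def IsOsculating (X : LinkedFaces d) : Prop :=
  ∀ g, 2 < (cofaces X.faces g).card → Osc g (cofaces X.faces g) (X.linksAt g)

/-- The faces are connected by the links. -/
def IsConn (X : LinkedFaces d) : Prop := Conn X.faces fun x y => s(x, y) ∈ X.links

/-- The four conditions can be checked separately: size and connection of the faces, then pairing,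
osculation and connection of the links. Parity of the lone faces follows from the pairing. -/
theorem isSOM_iff {k n : ℕ} {X : LinkedFaces d} :
    X.IsSOM k n ↔ IsXD k n X.faces ∧ X.IsPaired ∧ X.IsOsculating ∧ X.IsConn := by
  have hsymm : ∀ x y, s(x, y) ∈ X.links → s(y, x) ∈ X.links := fun _ _ => sym2_mem_swap.1
  constructor
  · intro h
    obtain ⟨h1, h2⟩ := (isConnectedVia_iff hsymm).1 h.connected
    have hshare : ∀ {x y}, s(x, y) ∈ X.links → ShareFacet x y := by
      intro x y hxy
      obtain ⟨f, -, f', -, -, hs, he⟩ := h.links_valid _ hxy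
      rcases Sym2.eq_iff.1 he with ⟨rfl, rfl⟩ | ⟨rfl, rfl⟩
      exacts [hs, hs.symm]
    have hmem : ∀ {x y}, s(x, y) ∈ X.links → x ∈ X.faces ∧ x ≠ y := by
      intro x y hxy
      obtain ⟨f, hf, f', hf', hn, -, he⟩ := h.links_valid _ hxy
      rcases Sym2.eq_iff.1 he with ⟨rfl, rfl⟩ | ⟨rfl, rfl⟩
      exacts [⟨hf, hn⟩, ⟨hf', hn.symm⟩]
    have hpair : X.IsPaired := by
      refine ⟨hshare, fun g => ⟨?_, ?_, ?_, ?_⟩⟩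
      · intro x y hxy
        rw [mem_linksAt] at hxy
        exact mem_cofaces.2 ⟨(hmem hxy.1).1, hxy.2.1⟩
      · intro x y hxy
        exact (hmem (mem_linksAt.1 hxy).1).2
      · intro x y z hxy hxz
        exact Sym2.congr_right.1 (h.links_disjoint g _ hxy _ hxz x (Sym2.mem_mk_left _ _)
          (Sym2.mem_mk_left _ _))
      · intro x y hx hy hx' hy'
        have hc : (X.loneAt g).card ≤ 1 := by rw [h.lone_card]; omega
        exact card_le_one.1 hc x (mem_loneAt.2 ⟨hx, hx'⟩) y (mem_loneAt.2 ⟨hy, hy'⟩)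
    refine ⟨⟨h.dim_eq, h.card_eq, (isConnectedVia_iff fun _ _ => ShareFacet.symm).2 ⟨h1, ?_⟩⟩,
      hpair, fun g hg => (osculatesAt_iff (hpair.pairing g)).1 (h.osculating g hg), h2⟩
    intro p hp
    exact h2 p fun x hx y hy hxy => hp x hx y hy (hshare hxy)
  · rintro ⟨h1, h2, h3, h4⟩
    refine ⟨h1.dim_eq, h1.card_eq, ?_, ?_, ?_, ?_, ?_⟩
    · intro p hp
      induction p with
      | _ x y => exact ⟨x, h2.mem hp, y, h2.mem (sym2_mem_swap.1 hp), h2.ne hp, h2.share hp, rfl⟩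
    · intro g p hp q hq f hfp hfq
      obtain ⟨y, rfl⟩ := hfp
      obtain ⟨z, rfl⟩ := hfq
      rw [(h2.pairing g).unique hp hq]
    · intro g
      classical
      rw [← (h2.pairing g).card_lone]
      congr 1
      ext x
      rw [mem_loneAt, mem_filter]
    · exact fun g hg => (osculatesAt_iff (h2.pairing g)).2 (h3 g hg)
    · exact (isConnectedVia_iff hsymm).2 ⟨h1.connected.1, h4⟩

theorem ext_of_linksAt {X Y : LinkedFaces d} (hX : X.IsPaired) (hY : Y.IsPaired)
    (hf : X.faces = Y.faces) (h : ∀ g, X.linksAt g = Y.linksAt g) : X = Y := by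
  refine LinkedFaces.ext hf (sym2_finset_ext fun x y => ⟨fun hxy => ?_, fun hxy => ?_⟩)
  · obtain ⟨g, h1, h2⟩ := hX.share hxy
    exact (mem_linksAt.1 (h g ▸ mem_linksAt.2 ⟨hxy, h1, h2⟩)).1
  · obtain ⟨g, h1, h2⟩ := hY.share hxy
    exact (mem_linksAt.1 (h g ▸ mem_linksAt.2 ⟨hxy, h1, h2⟩)).1

theorem IsPaired.linksAt_eq_empty {X : LinkedFaces d} (h : X.IsPaired) {g : Cell d}
    (hg : (cofaces X.faces g).card ≤ 1) : X.linksAt g = ∅ := by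
  refine sym2_finset_ext fun x y => ⟨fun hxy => ?_, fun h => by simp at h⟩
  exact absurd (card_le_one.1 hg x ((h.pairing g).mem hxy) y
    ((h.pairing g).mem (sym2_mem_swap.1 hxy))) ((h.pairing g).ne hxy)

end LinkedFaces

end

/-! ### Linked faces: symmetries, joining and attaching. -/

section

open Cell

variable {d : ℕ}

theorem affine_add_affine {u : ℤˣ} {w : Fin d → ℤ} {x y g : Cell d} :
    affine u w x + affine u w y = 2 • affine u w g ↔ x + y = 2 • g := by
  have key : affine u w x + affine u w y - 2 • affine u w g = (u : ℤ) • (x + y - 2 • g) := by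
    ext i; simp [affine_apply]; ring
  rw [← sub_eq_zero, key, ← sub_eq_zero (a := x + y), smul_eq_zero, or_iff_right u.ne_zero]

theorem Osc.image_affine {g : Cell d} {D : Finset (Cell d)} {P : Finset (Sym2 (Cell d))} (h : Osc g D P)
    (u : ℤˣ) (w : Fin d → ℤ) :
    Osc (affine u w g) (D.image (affine u w)) (P.image (Sym2.map (affine u w))) := by
  obtain ⟨h1, h2⟩ := h
  refine ⟨fun x y z v => ?_, fun ho => ?_⟩
  · obtain ⟨x, rfl⟩ := (Cell.affine u w).surjective x
    obtain ⟨y, rfl⟩ := (Cell.affine u w).surjective y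
    obtain ⟨z, rfl⟩ := (Cell.affine u w).surjective z
    obtain ⟨v, rfl⟩ := (Cell.affine u w).surjective v
    rw [mem_image_sym2_map, mem_image_sym2_map, affine_add_affine, affine_add_affine]
    intro a1 a2 a3 a4
    rw [← Sym2.map_mk, ← Sym2.map_mk, h1 x y z v a1 a2 a3 a4]
  · rw [card_image_of_injective _ (Cell.affine u w).injective] at ho
    obtain ⟨l, hl, hl', f, hf, hf', hlf⟩ := h2 ho
    refine ⟨Cell.affine u w l, mem_image_of_mem _ hl, fun z => ?_, Cell.affine u w f,
      (affine_mem_facets u w).2 hf, fun hm => hf' ((mem_image_affine u w).1 hm), fun he x y => ?_⟩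
    · obtain ⟨z, rfl⟩ := (Cell.affine u w).surjective z
      rw [mem_image_sym2_map]; exact hl' z
    · obtain ⟨x, rfl⟩ := (Cell.affine u w).surjective x
      obtain ⟨y, rfl⟩ := (Cell.affine u w).surjective y
      rw [mem_image_sym2_map, Ne, affine_add_affine]
      exact hlf (affine_add_affine.1 he) x y

namespace LinkedFaces

/-- The image of a linked set of faces under an affine lattice automorphism. -/
def map (u : ℤˣ) (w : Fin d → ℤ) (X : LinkedFaces d) : LinkedFaces d where
  faces := X.faces.image (affine u w)
  links := X.links.image (Sym2.map (affine u w))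

theorem map_one (w : Fin d → ℤ) (X : LinkedFaces d) : X.map 1 w = X.translate w := by
  rw [map, translate, affine_one]

theorem map_one_zero (X : LinkedFaces d) : X.map 1 0 = X := by
  rw [map_one, LinkedFaces.translate_zero]

section Map

variable (u : ℤˣ) (w : Fin d → ℤ) {X : LinkedFaces d}

theorem mem_links_map {x y : Cell d} :
    s(affine u w x, affine u w y) ∈ (X.map u w).links ↔ s(x, y) ∈ X.links :=
  mem_image_sym2_map _

theorem linksAt_map (g : Cell d) :
    (X.map u w).linksAt (affine u w g) = (X.linksAt g).image (Sym2.map (affine u w)) := by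
  refine sym2_finset_ext fun x y => ?_
  obtain ⟨x, rfl⟩ := (affine u w).surjective x
  obtain ⟨y, rfl⟩ := (affine u w).surjective y
  rw [mem_image_sym2_map, mem_linksAt, mem_linksAt, mem_links_map, affine_mem_facets,
    affine_mem_facets]

theorem cofaces_map (g : Cell d) :
    cofaces (X.map u w).faces (affine u w g) = (cofaces X.faces g).image (affine u w) :=
  cofaces_image u w X.faces g

theorem IsPaired.map (h : X.IsPaired) : (X.map u w).IsPaired := by
  constructor
  · intro x y
    obtain ⟨x, rfl⟩ := (affine u w).surjective x
    obtain ⟨y, rfl⟩ := (affine u w).surjective y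
    rw [mem_links_map, shareFacet_affine]
    exact h.share
  · intro g
    obtain ⟨g, rfl⟩ := (affine u w).surjective g
    rw [linksAt_map, cofaces_map]
    exact (h.pairing g).image _

theorem IsOsculating.map (h : X.IsOsculating) : (X.map u w).IsOsculating := by
  intro g
  obtain ⟨g, rfl⟩ := (affine u w).surjective g
  rw [linksAt_map, cofaces_map, card_image_of_injective _ (affine u w).injective]
  exact fun hg => (h g hg).image_affine u w

theorem IsConn.map (h : X.IsConn) : (X.map u w).IsConn :=
  Conn.image u w h fun _ _ _ _ hxy => (mem_links_map u w).2 hxy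

theorem IsSOM.map {k n : ℕ} (h : X.IsSOM k n) : (X.map u w).IsSOM k n := by
  rw [isSOM_iff] at h ⊢
  exact ⟨h.1.image u w, h.2.1.map u w, h.2.2.1.map u w, h.2.2.2.map u w⟩

end Map

open Classical in
/-- All faces of `S` that share an edge are linked. -/
noncomputable def full (S : Finset (Cell d)) : LinkedFaces d where
  faces := S
  links := ((S ×ˢ S).filter fun p => p.1 ≠ p.2 ∧ ShareFacet p.1 p.2).image fun p => s(p.1, p.2)

theorem mem_links_full {S : Finset (Cell d)} {x y : Cell d} :
    s(x, y) ∈ (full S).links ↔ x ∈ S ∧ y ∈ S ∧ x ≠ y ∧ ShareFacet x y := by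
  simp only [full, mem_image, mem_filter, mem_product, Prod.exists]
  constructor
  · rintro ⟨p, q, ⟨⟨h1, h2⟩, h3, h4⟩, he⟩
    rcases Sym2.eq_iff.1 he with ⟨rfl, rfl⟩ | ⟨rfl, rfl⟩
    exacts [⟨h1, h2, h3, h4⟩, ⟨h2, h1, h3.symm, h4.symm⟩]
  · rintro ⟨h1, h2, h3, h4⟩
    exact ⟨x, y, ⟨⟨h1, h2⟩, h3, h4⟩, rfl⟩

theorem isPaired_full {S : Finset (Cell d)} (hS : ∀ g, (cofaces S g).card ≤ 2) :
    (full S).IsPaired := by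
  refine ⟨fun h => (mem_links_full.1 h).2.2.2, fun g => ⟨?_, ?_, ?_, ?_⟩⟩
  · intro x y h
    rw [mem_linksAt, mem_links_full] at h
    exact mem_cofaces.2 ⟨h.1.1, h.2.1⟩
  · intro x y h
    exact (mem_links_full.1 (mem_linksAt.1 h).1).2.2.1
  · intro x y z hy hz
    rw [mem_linksAt, mem_links_full] at hy hz
    by_contra hne
    have hsub : ({x, y, z} : Finset (Cell d)) ⊆ cofaces S g := by
      intro v hv
      rw [mem_insert, mem_insert, mem_singleton] at hv
      rw [mem_cofaces]
      rcases hv with rfl | rfl | rfl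
      exacts [⟨hy.1.1, hy.2.1⟩, ⟨hy.1.2.1, hy.2.2⟩, ⟨hz.1.2.1, hz.2.2⟩]
    have := card_le_card hsub
    rw [card_eq_three.2 ⟨x, y, z, hy.1.2.2.1, hz.1.2.2.1, hne, rfl⟩] at this
    have := hS g
    omega
  · intro x y hx hy hx' _
    by_contra hne
    have hx := mem_cofaces.1 hx
    have hy := mem_cofaces.1 hy
    exact hx' y (mem_linksAt.2 ⟨mem_links_full.2 ⟨hx.1, hy.1, hne, g, hx.2, hy.2⟩, hx.2, hy.2⟩)

open Classical in
/-- The union of `S` and `U` without the face `f`, where the faces of `S` that were linked to `f`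
get linked to the face of `U` at the same edge. -/
noncomputable def join (S U : LinkedFaces d) (f : Cell d) : LinkedFaces d where
  faces := joinFaces S.faces U.faces f
  links := S.links.filter (f ∉ ·) ∪ U.links.filter (f ∉ ·) ∪
    ((S.faces ×ˢ U.faces).filter fun p => p.1 ≠ f ∧ p.2 ≠ f ∧ s(p.1, f) ∈ S.links ∧
      ∃ g ∈ f.facets, g ∈ p.1.facets ∧ g ∈ p.2.facets).image fun p => s(p.1, p.2)

/-- The new links of `join S U f`. -/
def JoinLink (S U : LinkedFaces d) (f x y : Cell d) : Prop :=
  x ∈ S.faces ∧ y ∈ U.faces ∧ x ≠ f ∧ y ≠ f ∧ s(x, f) ∈ S.links ∧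
    ∃ g ∈ f.facets, g ∈ x.facets ∧ g ∈ y.facets

theorem mem_links_join {S U : LinkedFaces d} {f x y : Cell d} :
    s(x, y) ∈ (join S U f).links ↔ (f ≠ x ∧ f ≠ y) ∧ (s(x, y) ∈ S.links ∨ s(x, y) ∈ U.links) ∨
      JoinLink S U f x y ∨ JoinLink S U f y x := by
  simp only [join, mem_union, mem_filter, Sym2.mem_iff, not_or, mem_image, mem_product,
    Prod.exists, JoinLink]
  constructor
  · rintro ((h | h) | ⟨p, q, ⟨⟨h1, h2⟩, h3⟩, he⟩)
    · exact Or.inl ⟨h.2, Or.inl h.1⟩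
    · exact Or.inl ⟨h.2, Or.inr h.1⟩
    · rcases Sym2.eq_iff.1 he with ⟨rfl, rfl⟩ | ⟨rfl, rfl⟩
      · exact Or.inr (Or.inl ⟨h1, h2, h3⟩)
      · exact Or.inr (Or.inr ⟨h1, h2, h3⟩)
  · rintro (⟨h1, h | h⟩ | h | h)
    · exact Or.inl (Or.inl ⟨h, h1⟩)
    · exact Or.inl (Or.inr ⟨h, h1⟩)
    · exact Or.inr ⟨x, y, ⟨⟨h.1, h.2.1⟩, h.2.2⟩, rfl⟩
    · exact Or.inr ⟨y, x, ⟨⟨h.1, h.2.1⟩, h.2.2⟩, Sym2.eq_swap⟩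

section Join

variable {S U : LinkedFaces d} {f : Cell d}

theorem linksAt_join_left (hJ : Joinable S.faces U.faces f) (hU : U.IsPaired)
    {x g : Cell d} (hx : x ∈ S.faces) (hg : g ∈ x.facets) (hgf : g ∉ f.facets) :
    (join S U f).linksAt g = S.linksAt g := by
  have hno : ∀ y ∈ U.faces, g ∉ y.facets := fun y hy hgy => hgf (hJ.edge x hx y hy g hg hgy)
  refine sym2_finset_ext fun y z => ?_
  rw [mem_linksAt, mem_linksAt, mem_links_join]
  constructor
  · rintro ⟨h | h | h, h1, h2⟩
    · rcases h.2 with h | h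
      · exact ⟨h, h1, h2⟩
      · exact absurd h1 (hno y (hU.mem h))
    · exact absurd h2 (hno z h.2.1)
    · exact absurd h1 (hno y h.2.1)
  · rintro ⟨h, h1, h2⟩
    refine ⟨Or.inl ⟨⟨?_, ?_⟩, Or.inl h⟩, h1, h2⟩
    · rintro rfl; exact hgf h1
    · rintro rfl; exact hgf h2

theorem linksAt_join_right (hJ : Joinable S.faces U.faces f) (hS : S.IsPaired)
    {x g : Cell d} (hx : x ∈ U.faces) (hg : g ∈ x.facets) (hgf : g ∉ f.facets) :
    (join S U f).linksAt g = U.linksAt g := by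
  have hno : ∀ y ∈ S.faces, g ∉ y.facets := fun y hy hgy => hgf (hJ.edge y hy x hx g hgy hg)
  refine sym2_finset_ext fun y z => ?_
  rw [mem_linksAt, mem_linksAt, mem_links_join]
  constructor
  · rintro ⟨h | h | h, h1, h2⟩
    · rcases h.2 with h | h
      · exact absurd h1 (hno y (hS.mem h))
      · exact ⟨h, h1, h2⟩
    · exact absurd h1 (hno y h.1)
    · exact absurd h2 (hno z h.1)
  · rintro ⟨h, h1, h2⟩
    refine ⟨Or.inl ⟨⟨?_, ?_⟩, Or.inr h⟩, h1, h2⟩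
    · rintro rfl; exact hgf h1
    · rintro rfl; exact hgf h2

/-- At an edge of `f` the links are those of `S` with `f` renamed to `u`. The link of `f` and `u` in
`U` disappears together with `f`. -/
theorem linksAt_join_of_mem (hJ : Joinable S.faces U.faces f) (hS : S.IsPaired) (hU : U.IsPaired)
    {u g : Cell d} (hg : g ∈ f.facets) (hu : u ≠ f) (hug : cofaces U.faces g = {f, u}) :
    (join S U f).linksAt g = (S.linksAt g).image (Sym2.map (Equiv.swap f u)) := by
  have huU : u ∈ U.faces ∧ g ∈ u.facets := mem_cofaces.1 (by rw [hug]; simp)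
  have huS : u ∉ S.faces := fun h => hu (hJ.inter u h huU.1)
  have key : ∀ y, y ∈ U.faces → g ∈ y.facets → y ≠ f → y = u := by
    intro y h1 h2 h3
    have : y ∈ cofaces U.faces g := mem_cofaces.2 ⟨h1, h2⟩
    rw [hug, mem_insert, mem_singleton] at this
    tauto
  have hfix : ∀ y ∈ S.faces, y ≠ f → Equiv.swap f u y = y := fun y hy hyf =>
    Equiv.swap_apply_of_ne_of_ne hyf fun e => huS (e ▸ hy)
  have hJL : ∀ y z, JoinLink S U f y z → g ∈ y.facets → g ∈ z.facets →
      s(Equiv.swap f u y, Equiv.swap f u z) ∈ S.links ∧ z = u := by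
    intro y z h h1 h2
    have : z = u := key z h.2.1 h2 h.2.2.2.1
    subst this
    rw [Equiv.swap_apply_right, hfix y h.1 h.2.2.1]
    exact ⟨h.2.2.2.2.1, rfl⟩
  have hgs : ∀ y, g ∈ y.facets ↔ g ∈ (Equiv.swap f u y).facets := by
    intro y
    by_cases hyf : y = f
    · subst hyf; rw [Equiv.swap_apply_left]; exact iff_of_true hg huU.2
    by_cases hyu : y = u
    · subst hyu; rw [Equiv.swap_apply_right]; exact iff_of_true huU.2 hg
    rw [Equiv.swap_apply_of_ne_of_ne hyf hyu]
  refine sym2_finset_ext fun y z => ?_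
  rw [show s(y, z) = s(Equiv.swap f u (Equiv.swap f u y), Equiv.swap f u (Equiv.swap f u z)) by
    rw [Equiv.swap_apply_self, Equiv.swap_apply_self], mem_image_sym2_map, Equiv.swap_apply_self,
    Equiv.swap_apply_self, mem_linksAt, mem_linksAt, mem_links_join, ← hgs, ← hgs]
  refine and_congr_left fun ⟨h1, h2⟩ => ⟨?_, fun h => ?_⟩
  · rintro (⟨⟨h3, h4⟩, h | h⟩ | h | h)
    · rw [hfix y (hS.mem h) h3.symm, hfix z (hS.mem (sym2_mem_swap.1 h)) h4.symm]
      exact h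
    · have e1 := key y (hU.mem h) h1 h3.symm
      have e2 := key z (hU.mem (sym2_mem_swap.1 h)) h2 h4.symm
      exact absurd (e1.trans e2.symm) (hU.ne h)
    · exact (hJL y z h h1 h2).1
    · rw [sym2_mem_swap]; exact (hJL z y h h2 h1).1
  · have hne := hS.ne h
    have hm1 := hS.mem h
    have hm2 := hS.mem (sym2_mem_swap.1 h)
    have hyf : y ≠ f := by
      rintro rfl; rw [Equiv.swap_apply_left] at hm1; exact huS hm1
    have hzf : z ≠ f := by
      rintro rfl; rw [Equiv.swap_apply_left] at hm2; exact huS hm2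
    have hyz : y ≠ z := fun e => hne (by rw [e])
    by_cases hyu : y = u
    · subst hyu
      rw [Equiv.swap_apply_right, Equiv.swap_apply_of_ne_of_ne hzf hyz.symm] at h
      exact Or.inr (Or.inr ⟨hS.mem (sym2_mem_swap.1 h), huU.1, hzf, hyf, sym2_mem_swap.1 h,
        g, hg, h2, h1⟩)
    by_cases hzu : z = u
    · subst hzu
      rw [Equiv.swap_apply_right, Equiv.swap_apply_of_ne_of_ne hyf hyz] at h
      exact Or.inr (Or.inl ⟨hS.mem h, huU.1, hyf, hzf, h, g, hg, h1, h2⟩)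
    rw [Equiv.swap_apply_of_ne_of_ne hyf hyu, Equiv.swap_apply_of_ne_of_ne hzf hzu] at h
    exact Or.inl ⟨⟨hyf.symm, hzf.symm⟩, Or.inl h⟩

theorem isPaired_join (hJ : Joinable S.faces U.faces f) (hS : S.IsPaired) (hU : U.IsPaired) :
    (join S U f).IsPaired := by
  constructor
  · intro x y h
    rcases mem_links_join.1 h with ⟨-, h | h⟩ | h | h
    · exact hS.share h
    · exact hU.share h
    · obtain ⟨g, -, h1, h2⟩ := h.2.2.2.2.2; exact ⟨g, h1, h2⟩
    · obtain ⟨g, -, h1, h2⟩ := h.2.2.2.2.2; exact ⟨g, h2, h1⟩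
  · intro g
    by_cases hg : g ∈ f.facets
    · obtain ⟨u, hu, hug⟩ := hJ.thin g hg
      rw [linksAt_join_of_mem hJ hS hU hg hu hug,
        show cofaces (join S U f).faces g = _ from hJ.cofaces_of_mem hg hu hug]
      exact (hS.pairing g).image _
    by_cases hx : ∃ x ∈ S.faces, g ∈ x.facets
    · obtain ⟨x, hx, hgx⟩ := hx
      rw [linksAt_join_left hJ hU hx hgx hg,
        show cofaces (join S U f).faces g = _ from hJ.cofaces_of_left hx hgx hg]
      exact hS.pairing g
    by_cases hy : ∃ x ∈ U.faces, g ∈ x.facets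
    · obtain ⟨x, hx, hgx⟩ := hy
      rw [linksAt_join_right hJ hS hx hgx hg,
        show cofaces (join S U f).faces g = _ from hJ.cofaces_of_right hx hgx hg]
      exact hU.pairing g
    have hno : ∀ {x y}, s(x, y) ∈ (join S U f).linksAt g → False := by
      intro x y h
      rw [mem_linksAt, mem_links_join] at h
      obtain ⟨h | h | h, h1, h2⟩ := h
      · rcases h.2 with h | h
        · exact hx ⟨x, hS.mem h, h1⟩
        · exact hy ⟨x, hU.mem h, h1⟩
      · exact hx ⟨x, h.1, h1⟩
      · exact hx ⟨y, h.1, h2⟩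
    refine ⟨fun h => (hno h).elim, fun h => (hno h).elim, fun h => (hno h).elim, ?_⟩
    intro x y h1
    have h2 := mem_cofaces.1 h1
    rcases (mem_joinFaces.1 h2.1).2 with h | h
    · exact absurd ⟨x, h, h2.2⟩ hx
    · exact absurd ⟨x, h, h2.2⟩ hy

/-- Away from `f` faces and links at an edge are copied from one part. At an edge of `f`, however,
`u` may point in another direction than `f`, so there the condition has to be supplied. -/
theorem isOsculating_join (hJ : Joinable S.faces U.faces f) (hS : S.IsPaired) (hU : U.IsPaired)
    (hSo : ∀ g, g ∉ f.facets → 2 < (cofaces S.faces g).card →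
      Osc g (cofaces S.faces g) (S.linksAt g)) (hUo : U.IsOsculating)
    (h : ∀ g ∈ f.facets, 2 < (cofaces S.faces g).card → ∀ u, u ≠ f → cofaces U.faces g = {f, u} →
      Osc g ((cofaces S.faces g).image (Equiv.swap f u))
        ((S.linksAt g).image (Sym2.map (Equiv.swap f u)))) : (join S U f).IsOsculating := by
  intro g hc
  change 2 < (cofaces (joinFaces S.faces U.faces f) g).card at hc
  change Osc g (cofaces (joinFaces S.faces U.faces f) g) _
  by_cases hg : g ∈ f.facets
  · obtain ⟨u, hu, hug⟩ := hJ.thin g hg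
    rw [linksAt_join_of_mem hJ hS hU hg hu hug, hJ.cofaces_of_mem hg hu hug]
    rw [hJ.card_cofaces_of_mem hg] at hc
    exact h g hg hc u hu hug
  obtain ⟨x, hx⟩ := card_pos.1 (by omega : 0 < (cofaces (joinFaces S.faces U.faces f) g).card)
  obtain ⟨hx, hgx⟩ := mem_cofaces.1 hx
  rcases (mem_joinFaces.1 hx).2 with hx | hx
  · rw [hJ.cofaces_of_left hx hgx hg] at hc ⊢
    rw [linksAt_join_left hJ hU hx hgx hg]
    exact hSo g hg hc
  · rw [hJ.cofaces_of_right hx hgx hg] at hc ⊢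
    rw [linksAt_join_right hJ hS hx hgx hg]
    exact hUo g hc

theorem mem_links_join_of_left {x y : Cell d} (hx : x ≠ f) (hy : y ≠ f) (h : s(x, y) ∈ S.links) :
    s(x, y) ∈ (join S U f).links :=
  mem_links_join.2 (Or.inl ⟨⟨hx.symm, hy.symm⟩, Or.inl h⟩)

theorem mem_links_join_of_right {x y : Cell d} (hx : x ≠ f) (hy : y ≠ f) (h : s(x, y) ∈ U.links) :
    s(x, y) ∈ (join S U f).links :=
  mem_links_join.2 (Or.inl ⟨⟨hx.symm, hy.symm⟩, Or.inr h⟩)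

theorem exists_mem_links_join (hJ : Joinable S.faces U.faces f) (hS : S.IsPaired) {x : Cell d}
    (h : s(x, f) ∈ S.links) : ∃ g u, g ∈ f.facets ∧ u ≠ f ∧ u ∈ U.faces ∧ g ∈ u.facets ∧
      s(x, u) ∈ (join S U f).links := by
  obtain ⟨g, h1, h2⟩ := hS.share h
  obtain ⟨u, hu, hug⟩ := hJ.thin g h2
  have huU : u ∈ U.faces ∧ g ∈ u.facets := mem_cofaces.1 (by rw [hug]; simp)
  exact ⟨g, u, h2, hu, huU.1, huU.2, mem_links_join.2 (Or.inr (Or.inl ⟨hS.mem h, huU.1, hS.ne h,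
    hu, h, g, h2, h1, huU.2⟩))⟩

end Join

/-- The linked set of faces with a further face `f` that is linked to `c`. -/
def attach (X : LinkedFaces d) (f c : Cell d) : LinkedFaces d where
  faces := insert f X.faces
  links := insert s(c, f) X.links

section Attach

variable {X : LinkedFaces d} {f g c : Cell d}

theorem linksAt_attach_self (hX : X.IsPaired) (h : Attachable X.faces f g c) :
    (X.attach f c).linksAt g = {s(c, f)} := by
  refine sym2_finset_ext fun x y => ?_
  rw [mem_linksAt, attach, mem_insert, mem_singleton]
  constructor
  · rintro ⟨h1 | h1, h2, h3⟩
    · exact h1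
    · have e1 := (h.edge x (hX.mem h1) g h2 h.right).1
      have e2 := (h.edge y (hX.mem (sym2_mem_swap.1 h1)) g h3 h.right).1
      exact absurd (e1.trans e2.symm) (hX.ne h1)
  · intro he
    refine ⟨Or.inl he, ?_⟩
    rcases Sym2.eq_iff.1 he with ⟨rfl, rfl⟩ | ⟨rfl, rfl⟩
    exacts [⟨h.left, h.right⟩, ⟨h.right, h.left⟩]

theorem linksAt_attach_of_ne (h : Attachable X.faces f g c) {e : Cell d} (he : e ≠ g) :
    (X.attach f c).linksAt e = X.linksAt e := by
  refine sym2_finset_ext fun x y => ?_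
  rw [mem_linksAt, mem_linksAt, attach, mem_insert]
  refine and_congr_left fun ⟨h1, h2⟩ => or_iff_right fun hs => he ?_
  rcases Sym2.eq_iff.1 hs with ⟨rfl, rfl⟩ | ⟨rfl, rfl⟩
  exacts [(h.edge _ h.mem e h1 h2).2, (h.edge _ h.mem e h2 h1).2]

theorem isPaired_attach (hX : X.IsPaired) (h : Attachable X.faces f g c) :
    (X.attach f c).IsPaired := by
  constructor
  · intro x y hxy
    rw [attach, mem_insert] at hxy
    rcases hxy with hxy | hxy
    · rcases Sym2.eq_iff.1 hxy with ⟨rfl, rfl⟩ | ⟨rfl, rfl⟩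
      exacts [⟨g, h.left, h.right⟩, ⟨g, h.right, h.left⟩]
    · exact hX.share hxy
  · intro e
    by_cases he : e = g
    · subst he
      rw [linksAt_attach_self hX h, show cofaces (X.attach f c).faces e = _ from h.cofaces_self]
      have hne : c ≠ f := fun e => h.notMem (e ▸ h.mem)
      refine ⟨?_, ?_, ?_, ?_⟩
      · intro x y hxy
        rw [mem_singleton] at hxy
        rcases Sym2.eq_iff.1 hxy with ⟨rfl, rfl⟩ | ⟨rfl, rfl⟩ <;> simp
      · intro x y hxy
        rw [mem_singleton] at hxy
        rcases Sym2.eq_iff.1 hxy with ⟨rfl, rfl⟩ | ⟨rfl, rfl⟩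
        exacts [hne, hne.symm]
      · intro x y z hxy hxz
        rw [mem_singleton] at hxy hxz
        exact Sym2.congr_right.1 (hxy.trans hxz.symm)
      · intro x y hx _ hx' _
        rw [mem_insert, mem_singleton] at hx
        rcases hx with rfl | rfl
        · exact absurd (mem_singleton_self _) (hx' f)
        · exact absurd (mem_singleton.2 Sym2.eq_swap) (hx' c)
    · rw [linksAt_attach_of_ne h he]
      by_cases hf : e ∈ f.facets
      · obtain ⟨h1, h2⟩ := h.cofaces_of_mem hf he
        rw [show cofaces (X.attach f c).faces e = _ from h2]
        have hno : X.linksAt e = ∅ := hX.linksAt_eq_empty (by rw [h1]; simp)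
        rw [hno]
        refine ⟨by simp, by simp, by simp, ?_⟩
        intro x y hx hy _ _
        rw [mem_singleton.1 hx, mem_singleton.1 hy]
      · rw [show cofaces (X.attach f c).faces e = _ from Attachable.cofaces_of_notMem hf]
        exact hX.pairing e

theorem isOsculating_attach (hXo : X.IsOsculating) (h : Attachable X.faces f g c) :
    (X.attach f c).IsOsculating := by
  intro e hc
  have hce : ∀ T, cofaces (X.attach f c).faces e = T → 2 < T.card := fun T hT => hT ▸ hc
  by_cases he : e = g
  · subst he
    have := hce _ h.cofaces_self
    have := card_le_two (a := c) (b := f)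
    omega
  · by_cases hf : e ∈ f.facets
    · have := hce _ (h.cofaces_of_mem hf he).2
      simp at this
    · have h1 := hce _ (Attachable.cofaces_of_notMem hf)
      rw [linksAt_attach_of_ne h he,
        show cofaces (X.attach f c).faces e = _ from Attachable.cofaces_of_notMem hf]
      exact hXo e h1

theorem isConn_attach (hXc : X.IsConn) (h : Attachable X.faces f g c) :
    (X.attach f c).IsConn := by
  intro p hp
  have h1 := hXc p fun x hx y hy hxy => hp x (mem_insert_of_mem hx) y (mem_insert_of_mem hy)
    (mem_insert_of_mem hxy)
  have h2 := hp c (mem_insert_of_mem h.mem) f (mem_insert_self _ _) (mem_insert_self _ _)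
  have key : ∀ x ∈ (X.attach f c).faces, (p x ↔ p c) := by
    intro x hx
    rcases mem_insert.1 hx with rfl | hx
    · exact h2.symm
    · exact h1 x hx c h.mem
  intro x hx y hy
  rw [key x hx, key y hy]

end Attach

end LinkedFaces

end

/-! ### Exchanging partners at an edge. -/

section

open Cell

variable {d : ℕ}

theorem exists_mem_of_mem_image_sym2 {P : Finset (Sym2 (Cell d))} {σ : Equiv.Perm (Cell d)}
    {x y : Cell d} (h : s(x, y) ∈ P.image (Sym2.map σ)) :
    ∃ u v, s(u, v) ∈ P ∧ x = σ u ∧ y = σ v := by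
  obtain ⟨u, rfl⟩ := σ.surjective x
  obtain ⟨v, rfl⟩ := σ.surjective y
  exact ⟨u, v, (mem_image_sym2_map σ).1 h, rfl, rfl⟩

theorem image_swap_eq {D : Finset (Cell d)} {x y : Cell d} (hx : x ∈ D) (hy : y ∈ D) :
    D.image (Equiv.swap x y) = D := by
  have hsub : D.image (Equiv.swap x y) ⊆ D := by
    intro z hz
    obtain ⟨w, hw, rfl⟩ := mem_image.1 hz
    rw [Equiv.swap_apply_def]
    split_ifs <;> assumption
  exact eq_of_subset_of_card_le hsub (card_image_of_injective _ (Equiv.swap x y).injective).ge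

theorem image_swap_image_swap {P : Finset (Sym2 (Cell d))} (x y : Cell d) :
    (P.image (Sym2.map (Equiv.swap x y))).image (Sym2.map (Equiv.swap x y)) = P := by
  have h : (Sym2.map (Equiv.swap x y) ∘ Sym2.map (Equiv.swap x y)) = id := by
    rw [← Sym2.map_comp]
    convert Sym2.map_id
    ext1 z
    exact Equiv.swap_apply_self x y z
  rw [image_image, h, image_id]

/-- Without any antipodal pair, a lone face may be paired with any free position. -/
theorem Osc.of_forall_ne {g f : Cell d} {D : Finset (Cell d)} {P : Finset (Sym2 (Cell d))}
    (hP : IsPairing D P) (h : ∀ x y, s(x, y) ∈ P → x + y ≠ 2 • g) (hf : g ∈ f.facets)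
    (hfD : f ∉ D) : Osc g D P := by
  classical
  refine ⟨fun x y z w h1 _ h3 _ => absurd h3 (h x y h1), fun ho => ?_⟩
  have h1 := hP.card_lone
  rw [Nat.odd_iff.1 ho] at h1
  obtain ⟨l, hl⟩ := card_pos.1 (by omega : 0 < (D.filter fun x => ∀ z, s(x, z) ∉ P).card)
  rw [mem_filter] at hl
  exact ⟨l, hl.1, hl.2, f, hf, hfD, fun _ => h⟩

theorem iff_not_of_not_iff {p q : Prop} (h : ¬ (p ↔ q)) : p ↔ ¬ q := by tauto

/-- Of two ways to reconnect the pairs `{a, x}` and `{y, z}`, one keeps `S` connected; `y = z` is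
allowed. -/
theorem Conn.or_of_exchange {S : Finset (Cell d)} {R R₁ R₂ : Cell d → Cell d → Prop}
    {a x y z : Cell d} (h : Conn S R) (ha : a ∈ S) (hx : x ∈ S) (hy : y ∈ S) (hz : z ∈ S)
    (hR : ∀ u v, R u v → s(u, v) = s(a, x) ∨ s(u, v) = s(y, z) ∨ (R₁ u v ∧ R₂ u v))
    (h1 : R₁ a y) (h2 : R₂ x y) (h3 : y = z ∨ (R₁ x z ∧ R₂ a z)) : Conn S R₁ ∨ Conn S R₂ := by
  by_contra hcon
  rw [not_or] at hcon
  obtain ⟨hc1, hc2⟩ := hcon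
  simp only [Conn, not_forall] at hc1 hc2
  obtain ⟨p, hp, u1, hu1, v1, hv1, hn1⟩ := hc1
  obtain ⟨q, hq, u2, hu2, v2, hv2, hn2⟩ := hc2
  have inv : ∀ r : Cell d → Prop, (r a ↔ r x) → (r y ↔ r z) →
      (∀ u ∈ S, ∀ v ∈ S, R₁ u v → R₂ u v → (r u ↔ r v)) → ∀ u ∈ S, ∀ v ∈ S, (r u ↔ r v) := by
    intro r hr1 hr2 hr3
    refine h r fun u hu v hv huv => ?_
    rcases hR u v huv with he | he | ⟨h4, h5⟩
    · rcases Sym2.eq_iff.1 he with ⟨rfl, rfl⟩ | ⟨rfl, rfl⟩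
      exacts [hr1, hr1.symm]
    · rcases Sym2.eq_iff.1 he with ⟨rfl, rfl⟩ | ⟨rfl, rfl⟩
      exacts [hr2, hr2.symm]
    · exact hr3 u hu v hv h4 h5
  have p1 := hp a ha y hy h1
  have q1 := hq x hx y hy h2
  have p2 : p y = p z ∨ (p x ↔ p z) := h3.imp (fun e => by rw [e]) fun h => hp x hx z hz h.1
  have q2 : q y = q z ∨ (q a ↔ q z) := h3.imp (fun e => by rw [e]) fun h => hq a ha z hz h.2
  have p3 : ¬ (p a ↔ p x) := fun he => hn1 (inv p he
    (p2.elim (fun e => by rw [e]) fun e => p1.symm.trans (he.trans e))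
    (fun u hu v hv h _ => hp u hu v hv h) u1 hu1 v1 hv1)
  have q3 : ¬ (q a ↔ q x) := fun he => hn2 (inv q he
    (q2.elim (fun e => by rw [e]) fun e => q1.symm.trans (he.symm.trans e))
    (fun u hu v hv _ h => hq u hu v hv h) u2 hu2 v2 hv2)
  have r2 : (p y ↔ q y) ↔ (p z ↔ q z) := by
    rcases h3 with rfl | h3
    · rfl
    · have e1 : p y ↔ ¬ p z := by
        rw [← p1, ← hp x hx z hz h3.1]; exact (iff_not_of_not_iff p3)
      have e2 : q y ↔ ¬ q z := by
        rw [← q1, ← hq a ha z hz h3.2]; exact iff_not_of_not_iff fun h => q3 h.symm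
      rw [e1, e2, not_iff_not]
  have r1 : (p a ↔ q a) ↔ (p x ↔ q x) := by
    rw [show p x ↔ ¬ p a from iff_not_of_not_iff fun h => p3 h.symm,
      show q x ↔ ¬ q a from iff_not_of_not_iff fun h => q3 h.symm, not_iff_not]
  -- If both reconnections fail, `p` and `q` both separate `a` from `x`, and they separate `y` from
  -- `z` together or not at all. Their equivalence then respects every original link and is
  -- constant, which contradicts its values at `a` and `y`.
  have := inv (fun w => (p w ↔ q w)) r1 r2
    (fun u hu v hv h4 h5 => by rw [hp u hu v hv h4, hq u hu v hv h5]) a ha y hy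
  rw [← p1, ← q1] at this
  by_cases hpa : p a
  · simp only [hpa, true_iff] at this
    exact q3 this
  · simp only [hpa, false_iff, not_iff_not] at this
    exact q3 this

variable [NeZero d]

/-- `Q` arises from `P` by reconnecting the face `a`. -/
def Switched (g a : Cell d) (P Q : Finset (Sym2 (Cell d))) : Prop :=
  ∃ x y, Q = P.image (Sym2.map (Equiv.swap x y)) ∧
    ((∃ z, s(a, x) ∈ P ∧ s(y, z) ∈ P ∧ y + z = 2 • g ∧ a ≠ y ∧ a ≠ z) ∨
      (s(a, x) ∈ P ∧ x + (g + Pi.single 0 1) = 2 • g ∧ y + a = 2 • g ∧ ∀ z, s(y, z) ∉ P) ∨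
      (x = a ∧ y + a = 2 • g ∧ ∀ z, s(y, z) ∉ P))

/-- The three kinds of exchange leave different traces at `a`: linked to a face that is not
opposite, linked to the opposite face, or unlinked. In each case the transposition can be read off
from `Q`, and it is its own inverse. -/
theorem Switched.left_unique {g a : Cell d} {D D' : Finset (Cell d)}
    {P P' Q : Finset (Sym2 (Cell d))}
    (hP : IsPairing D P) (hP' : IsPairing D' P') (hQ : IsPairing D Q) (h : Switched g a P Q)
    (h' : Switched g a P' Q) : P = P' := by
  have key : ∀ {D P}, IsPairing D P → Switched g a P Q →
      ∃ x y, P = Q.image (Sym2.map (Equiv.swap x y)) ∧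
        ((∃ z, s(a, y) ∈ Q ∧ s(x, z) ∈ Q ∧ y + z = 2 • g ∧ y + a ≠ 2 • g) ∨
        (s(a, y) ∈ Q ∧ x + (g + Pi.single 0 1) = 2 • g ∧ y + a = 2 • g) ∨
        (x = a ∧ y + a = 2 • g ∧ ∀ z, s(a, z) ∉ Q)) := by
    clear h h' hP hP' hQ
    rintro D P hP ⟨x, y, rfl, h⟩
    refine ⟨x, y, (image_swap_image_swap x y).symm, ?_⟩
    rcases h with ⟨z, h1, h2, h3, h4, h5⟩ | ⟨h1, h2, h3, h4⟩ | ⟨rfl, h2, h3⟩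
    · left
      have hax := hP.ne h1
      have hzy := (hP.ne h2).symm
      have hzx : z ≠ x := by
        rintro rfl
        exact h4 (hP.unique (sym2_mem_swap.1 h1) (sym2_mem_swap.1 h2))
      refine ⟨z, ?_, ?_, h3, ?_⟩
      · have := (mem_image_sym2_map (Equiv.swap x y)).2 h1
        rwa [Equiv.swap_apply_left, Equiv.swap_apply_of_ne_of_ne hax h4] at this
      · have := (mem_image_sym2_map (Equiv.swap x y)).2 h2
        rwa [Equiv.swap_apply_right, Equiv.swap_apply_of_ne_of_ne hzx hzy] at this
      · intro e
        exact h5 (add_left_cancel (e.trans h3.symm))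
    · right; left
      refine ⟨?_, h2, h3⟩
      have hay : a ≠ y := by rintro rfl; exact h4 _ h1
      have := (mem_image_sym2_map (Equiv.swap x y)).2 h1
      rwa [Equiv.swap_apply_left, Equiv.swap_apply_of_ne_of_ne (hP.ne h1) hay] at this
    · right; right
      refine ⟨rfl, h2, fun z hz => ?_⟩
      obtain ⟨u, v, h, e1, -⟩ := exists_mem_of_mem_image_sym2 hz
      have : u = y := by
        have := congrArg (Equiv.swap x y) e1
        rwa [Equiv.swap_apply_left, Equiv.swap_apply_self, eq_comm] at this
      exact h3 _ (this ▸ h)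
  obtain ⟨x, y, e, h⟩ := key hP h
  obtain ⟨x', y', e', h'⟩ := key hP' h'
  suffices x = x' ∧ y = y' by rw [e, e', this.1, this.2]
  rcases h with ⟨z, h1, h2, h3, h4⟩ | ⟨h1, h2, h3⟩ | ⟨h1, h2, h3⟩ <;>
  rcases h' with ⟨z', h1', h2', h3', h4'⟩ | ⟨h1', h2', h3'⟩ | ⟨h1', h2', h3'⟩
  · obtain rfl := hQ.unique h1 h1'
    obtain rfl : z = z' := add_left_cancel (h3.trans h3'.symm)
    exact ⟨hQ.unique (sym2_mem_swap.1 h2) (sym2_mem_swap.1 h2'), rfl⟩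
  · obtain rfl := hQ.unique h1 h1'
    exact absurd h3' h4
  · exact absurd h1 (h3' _)
  · obtain rfl := hQ.unique h1 h1'
    exact absurd h3 h4'
  · exact ⟨add_right_cancel (h2.trans h2'.symm), hQ.unique h1 h1'⟩
  · exact absurd h1 (h3' _)
  · exact absurd h1' (h3 _)
  · exact absurd h1' (h3 _)
  · exact ⟨h1.trans h1'.symm, add_right_cancel (h2.trans h2'.symm)⟩

section Local

variable {g a : Cell d} {D : Finset (Cell d)} {P : Finset (Sym2 (Cell d))}

/-- After moving `a` to a free position `b`, the osculating condition can fail in two ways only. -/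
theorem osc_or_of_swap {b : Cell d} (hP : IsPairing D P) (h : Osc g D P) (hb : b ∉ D)
    (ha : g ∈ a.facets) (haD : a ∈ D) (hab : a + b ≠ 2 • g) :
    Osc g (D.image (Equiv.swap a b)) (P.image (Sym2.map (Equiv.swap a b))) ∨
    (∃ x y z, s(a, x) ∈ P ∧ s(y, z) ∈ P ∧ y + z = 2 • g ∧ a ≠ y ∧ a ≠ z) ∨
    (∃ x l, s(a, x) ∈ P ∧ x + b = 2 • g ∧ l ∈ D ∧ l + a = 2 • g ∧ (∀ z, s(l, z) ∉ P) ∧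
      ∀ y z, s(y, z) ∈ P → y + z ≠ 2 • g) := by
  have hba : a ≠ b := fun e => hb (e ▸ haD)
  set σ := Equiv.swap a b with hσ
  have hσD : ∀ y ∈ D, y ≠ a → σ y = y := fun y hy hya =>
    Equiv.swap_apply_of_ne_of_ne hya fun e => hb (e ▸ hy)
  have haD' : a ∉ D.image σ := by
    intro hm
    obtain ⟨y, hy, he⟩ := mem_image.1 hm
    have : y = b := by
      rw [← Equiv.swap_apply_left a b, ← hσ, ← he, hσ, Equiv.swap_apply_self]
    exact hb (this ▸ hy)
  -- antipodal pairs after the move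
  have hanti : ∀ u v, s(u, v) ∈ P → σ u + σ v = 2 • g →
      (u + v = 2 • g ∧ a ≠ u ∧ a ≠ v) ∨ (∃ x, s(a, x) ∈ P ∧ x + b = 2 • g ∧ s(u, v) = s(a, x)) := by
    intro u v huv he
    have hne := hP.ne huv
    by_cases hu : u = a
    · subst hu
      rw [hσ, Equiv.swap_apply_left, ← hσ, hσD v (hP.mem (sym2_mem_swap.1 huv)) hne.symm] at he
      exact Or.inr ⟨v, huv, by rw [add_comm, he], rfl⟩
    by_cases hv : v = a
    · subst hv
      rw [hσ, Equiv.swap_apply_left, ← hσ, hσD u (hP.mem huv) hne] at he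
      exact Or.inr ⟨u, sym2_mem_swap.1 huv, he, Sym2.eq_swap⟩
    rw [hσD u (hP.mem huv) hu, hσD v (hP.mem (sym2_mem_swap.1 huv)) hv] at he
    exact Or.inl ⟨he, Ne.symm hu, Ne.symm hv⟩
  have hP' := hP.image σ
  have hcard : (D.image σ).card = D.card := card_image_of_injective _ σ.injective
  by_cases hx : ∃ x, s(a, x) ∈ P ∧ x + b = 2 • g
  · obtain ⟨x, hax, hxb⟩ := hx
    by_cases hyz : ∃ y z, s(y, z) ∈ P ∧ y + z = 2 • g
    · obtain ⟨y, z, h1, h2⟩ := hyz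
      right; left
      refine ⟨x, y, z, hax, h1, h2, ?_, ?_⟩
      · rintro rfl
        obtain rfl := hP.unique hax h1
        rw [add_comm] at h2
        exact hba (add_left_cancel (h2.trans hxb.symm))
      · rintro rfl
        obtain rfl := hP.unique hax (sym2_mem_swap.1 h1)
        exact hba (add_left_cancel (h2.trans hxb.symm))
    · push Not at hyz
      by_cases hl : ∃ l ∈ D, l + a = 2 • g ∧ ∀ z, s(l, z) ∉ P
      · obtain ⟨l, h1, h2, h3⟩ := hl
        exact Or.inr (Or.inr ⟨x, l, hax, hxb, h1, h2, h3, hyz⟩)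
      left
      -- The moved pair is the only antipodal one. The lone face, if any, is not opposite to `a`, so
      -- it may be paired with the vacated position of `a`.
      have huniq : ∀ u v, s(u, v) ∈ P → σ u + σ v = 2 • g → s(u, v) = s(a, x) := by
        intro u v h1 h2
        rcases hanti u v h1 h2 with ⟨h3, -⟩ | ⟨x', h3, -, h4⟩
        · exact absurd h3 (hyz u v h1)
        · rw [h4, hP.unique h3 hax]
      refine ⟨fun u v u' v' h1 h2 h3 h4 => ?_, fun ho => ?_⟩
      · obtain ⟨u, v, k1, rfl, rfl⟩ := exists_mem_of_mem_image_sym2 h1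
        obtain ⟨u', v', k2, rfl, rfl⟩ := exists_mem_of_mem_image_sym2 h2
        rw [← Sym2.map_mk, ← Sym2.map_mk, huniq u v k1 h3, huniq u' v' k2 h4]
      · rw [hcard] at ho
        obtain ⟨l, hl1, hl2, -⟩ := h.2 ho
        have hla : l ≠ a := by rintro rfl; exact hl2 _ hax
        have hσl := hσD l hl1 hla
        refine ⟨l, hσl ▸ mem_image_of_mem σ hl1, fun z hz => ?_, a, ha, haD', fun he => ?_⟩
        · obtain ⟨u, v, h1, h2, -⟩ := exists_mem_of_mem_image_sym2 hz
          rw [← hσl] at h2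
          exact hl2 v (σ.injective h2 ▸ h1)
        · exact absurd ⟨l, hl1, he, hl2⟩ hl
  · have hanti' : ∀ u v, s(u, v) ∈ P → σ u + σ v = 2 • g → u + v = 2 • g ∧ a ≠ u ∧ a ≠ v := by
      intro u v h1 h2
      rcases hanti u v h1 h2 with h3 | ⟨x, h3, h4, -⟩
      exacts [h3, absurd ⟨x, h3, h4⟩ hx]
    by_cases hyz : ∃ y z, s(y, z) ∈ P ∧ y + z = 2 • g ∧ a ≠ y ∧ a ≠ z
    · obtain ⟨y, z, hyz, hyz', hay, haz⟩ := hyz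
      by_cases hax : ∃ x, s(a, x) ∈ P
      · obtain ⟨x, hax⟩ := hax
        -- An exchange is offered here even if `x` is not opposite to `b`. For an odd number of
        -- faces the vacated position may be the only one left for the lone face, and opposite to
        -- it.
        exact Or.inr (Or.inl ⟨x, y, z, hax, hyz, hyz', hay, haz⟩)
      push Not at hax
      left
      refine ⟨fun u v u' v' h1 h2 h3 h4 => ?_, fun _ => ?_⟩
      · obtain ⟨u, v, k1, rfl, rfl⟩ := exists_mem_of_mem_image_sym2 h1
        obtain ⟨u', v', k2, rfl, rfl⟩ := exists_mem_of_mem_image_sym2 h2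
        rw [← Sym2.map_mk, ← Sym2.map_mk,
          h.1 u v u' v' k1 k2 (hanti' u v k1 h3).1 (hanti' u' v' k2 h4).1]
      -- Here `a` was the lone face. It stays alone at `b`, and the vacated position `a` is not
      -- opposite to it.
      · refine ⟨b, mem_image.2 ⟨a, haD, Equiv.swap_apply_left a b⟩, fun w hw => ?_, a, ha, haD',
          fun he => absurd ((add_comm _ _).trans he) hab⟩
        obtain ⟨u, v, h1, h2, -⟩ := exists_mem_of_mem_image_sym2 hw
        have : a = u := by
          apply σ.injective
          rw [← h2, hσ, Equiv.swap_apply_left]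
        exact hax v (this ▸ h1)
    · push Not at hyz
      left
      refine Osc.of_forall_ne hP' (fun u v h1 h2 => ?_) ha haD'
      obtain ⟨u, v, k1, rfl, rfl⟩ := exists_mem_of_mem_image_sym2 h1
      obtain ⟨h3, h4, h5⟩ := hanti' u v k1 h2
      exact h5 (hyz u v k1 h3 h4)

end Local

end

/-! ### Repairing the links around the top face. -/

section

open Cell

variable {d : ℕ}

section Swap

variable {g a b x y z l u v : Cell d} {D : Finset (Cell d)} {P : Finset (Sym2 (Cell d))}

theorem mem_image_swap_of_ne (h : s(u, v) ∈ P) (h1 : u ≠ x) (h2 : u ≠ y) (h3 : v ≠ x)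
    (h4 : v ≠ y) : s(u, v) ∈ P.image (Sym2.map (Equiv.swap x y)) := by
  have := (mem_image_sym2_map (Equiv.swap x y)).2 h
  rwa [Equiv.swap_apply_of_ne_of_ne h1 h2, Equiv.swap_apply_of_ne_of_ne h3 h4] at this

theorem mem_image_swap (h : s(u, x) ∈ P) (h1 : u ≠ x) (h2 : u ≠ y) :
    s(u, y) ∈ P.image (Sym2.map (Equiv.swap x y)) := by
  have := (mem_image_sym2_map (Equiv.swap x y)).2 h
  rwa [Equiv.swap_apply_of_ne_of_ne h1 h2, Equiv.swap_apply_left] at this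

/-- The new pairs are `{b, y}` and `{x, z}`. Since `y` and `z` are opposite to each other, neither
is opposite to anything else, and `{y, z}` was the only antipodal pair. -/
theorem add_ne_of_exchange (hP : IsPairing D P) (h : Osc g D P) (hb : b ∉ D)
    (hax : s(a, x) ∈ P) (hyz : s(y, z) ∈ P) (hs : y + z = 2 • g) (hay : a ≠ y) (haz : a ≠ z)
    (hm : s(u, v) ∈ (P.image (Sym2.map (Equiv.swap x y))).image (Sym2.map (Equiv.swap a b))) :
    u + v ≠ 2 • g := by
  obtain ⟨u₁, v₁, h₁, rfl, rfl⟩ := exists_mem_of_mem_image_sym2 hm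
  obtain ⟨u, v, huv, rfl, rfl⟩ := exists_mem_of_mem_image_sym2 h₁
  have nax := hP.ne hax
  have nyz := hP.ne hyz
  have nxy : x ≠ y := by
    rintro rfl; exact haz (hP.unique (sym2_mem_swap.1 hax) hyz)
  have nxz : x ≠ z := by
    rintro rfl; exact hay (hP.unique (sym2_mem_swap.1 hax) (sym2_mem_swap.1 hyz))
  have hD : ∀ w ∈ D, w ≠ b := fun w hw e => hb (e ▸ hw)
  have mx := hP.mem (sym2_mem_swap.1 hax)
  have my := hP.mem hyz
  have mz := hP.mem (sym2_mem_swap.1 hyz)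
  have Fa : Equiv.swap a b (Equiv.swap x y a) = b := by
    rw [Equiv.swap_apply_of_ne_of_ne nax hay, Equiv.swap_apply_left]
  have Fx : Equiv.swap a b (Equiv.swap x y x) = y := by
    rw [Equiv.swap_apply_left, Equiv.swap_apply_of_ne_of_ne hay.symm (hD y my)]
  have Fy : Equiv.swap a b (Equiv.swap x y y) = x := by
    rw [Equiv.swap_apply_right, Equiv.swap_apply_of_ne_of_ne nax.symm (hD x mx)]
  have Fw : ∀ w ∈ D, w ≠ a → w ≠ x → w ≠ y → Equiv.swap a b (Equiv.swap x y w) = w := by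
    intro w h1 h2 h3 h4
    rw [Equiv.swap_apply_of_ne_of_ne h3 h4, Equiv.swap_apply_of_ne_of_ne h2 (hD w h1)]
  have Fz := Fw z mz haz.symm nxz.symm nyz.symm
  have e1 : b + y ≠ 2 • g := fun e => hD z mz (add_right_cancel
    (((add_comm _ _).trans hs).trans e.symm))
  have e2 : x + z ≠ 2 • g := fun e => nxy (add_right_cancel (e.trans hs.symm))
  have huv' := sym2_mem_swap.1 huv
  by_cases hua : u = a
  · subst hua; rw [← hP.unique hax huv, Fa, Fx]; exact e1
  by_cases hux : u = x
  · subst hux; rw [← hP.unique (sym2_mem_swap.1 hax) huv, Fa, Fx, add_comm]; exact e1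
  by_cases huy : u = y
  · subst huy; rw [← hP.unique hyz huv, Fy, Fz]; exact e2
  by_cases huz : u = z
  · subst huz; rw [← hP.unique (sym2_mem_swap.1 hyz) huv, Fy, Fz, add_comm]; exact e2
  have hva : v ≠ a := by
    rintro rfl; exact hux (hP.unique huv' hax)
  have hvx : v ≠ x := by
    rintro rfl; exact hua (hP.unique huv' (sym2_mem_swap.1 hax))
  have hvy : v ≠ y := by
    rintro rfl; exact huz (hP.unique huv' hyz)
  rw [Fw u (hP.mem huv) hua hux huy, Fw v (hP.mem huv') hva hvx hvy]
  intro he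
  rcases Sym2.eq_iff.1 (h.1 u v y z huv hyz he hs) with ⟨e, -⟩ | ⟨e, -⟩
  exacts [huy e, huz e]

/-- The moved face `b` gets linked to `l`, which is opposite to the vacated position `a` and so not
to `b`; `x` becomes the lone face. -/
theorem add_ne_of_move_left (hP : IsPairing D P) (hab : a ≠ b) (hb : b ∉ D) (hax : s(a, x) ∈ P)
    (hl : l ∈ D) (hla : l + a = 2 • g) (hl' : ∀ z, s(l, z) ∉ P)
    (hno : ∀ y z, s(y, z) ∈ P → y + z ≠ 2 • g)
    (hm : s(u, v) ∈ (P.image (Sym2.map (Equiv.swap x l))).image (Sym2.map (Equiv.swap a b))) :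
    u + v ≠ 2 • g := by
  obtain ⟨u₁, v₁, h₁, rfl, rfl⟩ := exists_mem_of_mem_image_sym2 hm
  obtain ⟨u, v, huv, rfl, rfl⟩ := exists_mem_of_mem_image_sym2 h₁
  have huv' := sym2_mem_swap.1 huv
  have nax := hP.ne hax
  have nal : a ≠ l := by rintro rfl; exact hl' _ hax
  have hD : ∀ w ∈ D, w ≠ b := fun w hw e => hb (e ▸ hw)
  have Fa : Equiv.swap a b (Equiv.swap x l a) = b := by
    rw [Equiv.swap_apply_of_ne_of_ne nax nal, Equiv.swap_apply_left]
  have Fx : Equiv.swap a b (Equiv.swap x l x) = l := by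
    rw [Equiv.swap_apply_left, Equiv.swap_apply_of_ne_of_ne nal.symm (hD l hl)]
  have e1 : l + b ≠ 2 • g := fun e => hab (add_left_cancel (hla.trans e.symm))
  have Fw : ∀ w ∈ D, w ≠ a → w ≠ x → w ≠ l → Equiv.swap a b (Equiv.swap x l w) = w := by
    intro w h1 h2 h3 h4
    rw [Equiv.swap_apply_of_ne_of_ne h3 h4, Equiv.swap_apply_of_ne_of_ne h2 (hD w h1)]
  have nl : ∀ u v, s(u, v) ∈ P → u ≠ l := by rintro u v h rfl; exact hl' _ h
  by_cases hua : u = a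
  · subst hua; rw [← hP.unique hax huv, Fa, Fx, add_comm]; exact e1
  by_cases hux : u = x
  · subst hux; rw [← hP.unique (sym2_mem_swap.1 hax) huv, Fa, Fx]; exact e1
  have hva : v ≠ a := by
    rintro rfl; exact hux (hP.unique huv' hax)
  have hvx : v ≠ x := by
    rintro rfl; exact hua (hP.unique huv' (sym2_mem_swap.1 hax))
  rw [Fw u (hP.mem huv) hua hux (nl u v huv), Fw v (hP.mem huv') hva hvx (nl v u huv')]
  exact hno u v huv

/-- The former partner `x` gets linked to `l`, which is opposite to `a` and so not to `x`; the moved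
face becomes the lone one. -/
theorem add_ne_of_move_right (hP : IsPairing D P) (hb : b ∉ D) (hax : s(a, x) ∈ P)
    (hl : l ∈ D) (hla : l + a = 2 • g) (hl' : ∀ z, s(l, z) ∉ P)
    (hno : ∀ y z, s(y, z) ∈ P → y + z ≠ 2 • g)
    (hm : s(u, v) ∈ (P.image (Sym2.map (Equiv.swap a l))).image (Sym2.map (Equiv.swap a b))) :
    u + v ≠ 2 • g := by
  obtain ⟨u₁, v₁, h₁, rfl, rfl⟩ := exists_mem_of_mem_image_sym2 hm
  obtain ⟨u, v, huv, rfl, rfl⟩ := exists_mem_of_mem_image_sym2 h₁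
  have huv' := sym2_mem_swap.1 huv
  have nax := hP.ne hax
  have nal : a ≠ l := by rintro rfl; exact hl' _ hax
  have hD : ∀ w ∈ D, w ≠ b := fun w hw e => hb (e ▸ hw)
  have nl : ∀ u v, s(u, v) ∈ P → u ≠ l := by rintro u v h rfl; exact hl' _ h
  have Fa : Equiv.swap a b (Equiv.swap a l a) = l := by
    rw [Equiv.swap_apply_left, Equiv.swap_apply_of_ne_of_ne nal.symm (hD l hl)]
  have Fw : ∀ w ∈ D, w ≠ a → w ≠ l → Equiv.swap a b (Equiv.swap a l w) = w := by
    intro w h1 h2 h4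
    rw [Equiv.swap_apply_of_ne_of_ne h2 h4, Equiv.swap_apply_of_ne_of_ne h2 (hD w h1)]
  have e1 : ∀ w, s(a, w) ∈ P → l + w ≠ 2 • g := fun w hw e =>
    hP.ne hw (add_left_cancel (hla.trans e.symm))
  by_cases hua : u = a
  · subst hua
    rw [Fa, Fw v (hP.mem huv') (hP.ne huv').symm.symm (nl v u huv')]
    exact e1 v huv
  by_cases hva : v = a
  · subst hva
    rw [Fa, Fw u (hP.mem huv) hua (nl u v huv), add_comm]
    exact e1 u huv'
  rw [Fw u (hP.mem huv) hua (nl u v huv), Fw v (hP.mem huv') hva (nl v u huv')]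
  exact hno u v huv

end Swap

namespace LinkedFaces

/-- Replace the links at `g` by `Q`. -/
def relink (X : LinkedFaces d) (g : Cell d) (Q : Finset (Sym2 (Cell d))) : LinkedFaces d where
  faces := X.faces
  links := (X.links \ X.linksAt g) ∪ Q

section Relink

variable {X : LinkedFaces d} {g : Cell d} {Q : Finset (Sym2 (Cell d))}

theorem linksAt_relink_self (hQ : IsPairing (cofaces X.faces g) Q) :
    (X.relink g Q).linksAt g = Q := by
  refine sym2_finset_ext fun x y => ?_
  rw [mem_linksAt, relink, mem_union, mem_sdiff, mem_linksAt]
  constructor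
  · rintro ⟨⟨h1, h2⟩ | h, h3⟩
    · exact absurd ⟨h1, h3⟩ h2
    · exact h
  · exact fun h => ⟨Or.inr h, (mem_cofaces.1 (hQ.mem h)).2,
      (mem_cofaces.1 (hQ.mem (sym2_mem_swap.1 h))).2⟩

/-- Two different faces share at most one edge, so each link belongs to a single edge and edges can
be relinked independently. -/
theorem linksAt_relink_of_ne (hX : X.IsPaired) (hQ : IsPairing (cofaces X.faces g) Q) {e : Cell d}
    (he : e ≠ g) : (X.relink g Q).linksAt e = X.linksAt e := by
  refine sym2_finset_ext fun x y => ?_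
  rw [mem_linksAt, mem_linksAt, relink, mem_union, mem_sdiff, mem_linksAt]
  refine and_congr_left fun ⟨h1, h2⟩ => ⟨?_, fun h => Or.inl ⟨h, fun h' => ?_⟩⟩
  · rintro (⟨h, -⟩ | h)
    · exact h
    · exact absurd (facet_unique (hQ.ne h) h1 h2 (mem_cofaces.1 (hQ.mem h)).2
        (mem_cofaces.1 (hQ.mem (sym2_mem_swap.1 h))).2) he
  · exact he (facet_unique (hX.ne h) h1 h2 h'.2.1 h'.2.2)

theorem IsPaired.relink (hX : X.IsPaired) (hQ : IsPairing (cofaces X.faces g) Q) :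
    (X.relink g Q).IsPaired := by
  constructor
  · intro x y h
    rcases mem_union.1 h with h | h
    · exact hX.share (mem_sdiff.1 h).1
    · exact ⟨g, (mem_cofaces.1 (hQ.mem h)).2, (mem_cofaces.1 (hQ.mem (sym2_mem_swap.1 h))).2⟩
  · intro e
    change IsPairing (cofaces X.faces e) _
    by_cases he : e = g
    · subst he
      rw [linksAt_relink_self hQ]; exact hQ
    · rw [linksAt_relink_of_ne hX hQ he]; exact hX.pairing e

theorem isConn_relink_or {Q₁ Q₂ : Finset (Sym2 (Cell d))} {a x y z : Cell d} (hX : X.IsConn)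
    (ha : a ∈ X.faces) (hx : x ∈ X.faces) (hy : y ∈ X.faces) (hz : z ∈ X.faces)
    (hR : ∀ u v, s(u, v) ∈ X.linksAt g → s(u, v) = s(a, x) ∨ s(u, v) = s(y, z) ∨
      (s(u, v) ∈ Q₁ ∧ s(u, v) ∈ Q₂))
    (h1 : s(a, y) ∈ Q₁) (h2 : s(x, y) ∈ Q₂) (h3 : y = z ∨ (s(x, z) ∈ Q₁ ∧ s(a, z) ∈ Q₂)) :
    (X.relink g Q₁).IsConn ∨ (X.relink g Q₂).IsConn := by
  have hm : ∀ {Q p}, p ∈ Q → p ∈ (X.relink g Q).links := fun h => mem_union_right _ h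
  refine Conn.or_of_exchange (a := a) (x := x) (y := y) (z := z) hX ha hx hy hz
    (fun u v huv => ?_) (hm h1) (hm h2) (h3.imp_right fun h => ⟨hm h.1, hm h.2⟩)
  by_cases hg : s(u, v) ∈ X.linksAt g
  · rcases hR u v hg with h | h | h
    exacts [Or.inl h, Or.inr (Or.inl h), Or.inr (Or.inr ⟨hm h.1, hm h.2⟩)]
  · exact Or.inr (Or.inr ⟨mem_union_left _ (mem_sdiff.2 ⟨huv, hg⟩),
      mem_union_left _ (mem_sdiff.2 ⟨huv, hg⟩)⟩)

end Relink

variable [NeZero d]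

/-- If `g = a + e_i`, one face of an antipodal pair at `g` is at least `g` in every coordinate and
hence lexicographically larger than `a`. So exchanges occur only at the edges `a - e_i`, and one bit
for each dimension of `a` records them. -/
theorem eq_sub_of_antipodal {A : Finset (Cell d)} {a g y z : Cell d} (hA : IsTopFace A a)
    (hg : g ∈ a.facets) (hy : y ∈ A) (hz : z ∈ A) (hgy : g ∈ y.facets) (hyz : y + z = 2 • g) :
    ∃ i, g = a + Pi.single i (-1) := by
  obtain ⟨i, s, -, hs, he⟩ := exists_of_mem_facets hg
  rcases hs with rfl | rfl
  swap
  · exact ⟨i, he⟩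
  exfalso
  have hlt : ∀ w ∈ A, (∀ m, g m ≤ w m) → False := by
    intro w hw hle
    have h1 : a ≤ w := fun m => by
      refine le_trans ?_ (hle m)
      rw [he, Pi.add_apply]
      by_cases hm : m = i
      · subst hm; simp
      · simp [hm]
    have h2 : w = a := toLex.injective (le_antisymm (hA.2 w hw) (Pi.toLex_monotone h1))
    have := hle i
    rw [h2, he] at this
    simp at this
  obtain ⟨j, t, -, ht, he'⟩ := exists_of_mem_facets hgy
  have hy' : ∀ m, y m = g m - (Pi.single j t : Cell d) m := fun m => by
    rw [he', Pi.add_apply]; ring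
  have hz' : ∀ m, z m = g m + (Pi.single j t : Cell d) m := fun m => by
    have := congrFun hyz m
    simp only [Pi.add_apply, Pi.smul_apply, nsmul_eq_mul] at this
    have := hy' m
    push_cast at *
    omega
  rcases ht with rfl | rfl
  · refine hlt z hz fun m => ?_
    rw [hz' m]
    by_cases hm : m = j
    · subst hm; simp
    · simp [hm]
  · refine hlt y hy fun m => ?_
    rw [hy' m]
    by_cases hm : m = j
    · subst hm; simp
    · simp [hm]

/-- Each obstruction to moving `a` to the position `b` above `g` admits two exchanges that leave no
antipodal pair at all. At least one of them keeps the links connected. -/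
theorem exists_relink {X : LinkedFaces d} {a g : Cell d} (hX : X.IsPaired) (hc : X.IsConn)
    (ha : IsTopFace X.faces a) (hv : ¬ a.Vertical) (hg : g ∈ a.facets)
    (ho : 2 < (cofaces X.faces g).card → Osc g (cofaces X.faces g) (X.linksAt g)) :
    ∃ Q, IsPairing (cofaces X.faces g) Q ∧ (X.relink g Q).IsConn ∧
      (2 < (cofaces X.faces g).card → Osc g
        ((cofaces X.faces g).image (Equiv.swap a (g + Pi.single 0 1)))
        (Q.image (Sym2.map (Equiv.swap a (g + Pi.single 0 1))))) ∧
      (Q = X.linksAt g ∨ (2 < (cofaces X.faces g).card ∧ (∃ i, g = a + Pi.single i (-1)) ∧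
        Switched g a (X.linksAt g) Q)) := by
  have hself : X.relink g (X.linksAt g) = X := by
    refine LinkedFaces.ext rfl ?_
    exact sdiff_union_of_subset (filter_subset _ _)
  have hP := hX.pairing g
  by_cases h2 : 2 < (cofaces X.faces g).card
  swap
  · exact ⟨X.linksAt g, hP, by rwa [hself], fun h => absurd h h2, Or.inl rfl⟩
  have hev : Even (a 0) := Int.not_odd_iff_even.1 hv
  have hg0 : g 0 = a 0 := height_eq_of_even hg hev
  set b : Cell d := g + Pi.single 0 1 with hb
  have hb0 : b 0 = a 0 + 1 := by simp [hb, hg0]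
  have hbD : b ∉ cofaces X.faces g := fun h => by
    have := ha.height_le (mem_cofaces.1 h).1
    omega
  have haD : a ∈ cofaces X.faces g := mem_cofaces.2 ⟨ha.1, hg⟩
  have hab' : a ≠ b := fun e => hbD (e ▸ haD)
  have haD' : a ∉ (cofaces X.faces g).image (Equiv.swap a b) := by
    intro hm
    obtain ⟨y, hy, he⟩ := mem_image.1 hm
    have : y = b := by
      have := congrArg (Equiv.swap a b) he
      rwa [Equiv.swap_apply_self, Equiv.swap_apply_left] at this
    exact hbD (this ▸ hy)
  have hab : a + b ≠ 2 • g := fun e => by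
    have := congrFun e 0
    simp only [Pi.add_apply, Pi.smul_apply, nsmul_eq_mul] at this
    push_cast at this
    omega
  have hO := ho h2
  have hpair : ∀ {x y}, x ∈ cofaces X.faces g → y ∈ cofaces X.faces g →
      IsPairing (cofaces X.faces g) ((X.linksAt g).image (Sym2.map (Equiv.swap x y))) := by
    intro x y hx hy
    have := hP.image (Equiv.swap x y)
    rwa [image_swap_eq hx hy] at this
  have hin : ∀ {x}, x ∈ cofaces X.faces g → x ∈ X.faces := fun h => (mem_cofaces.1 h).1
  rcases osc_or_of_swap hP hO hbD hg haD hab with h | ⟨x, y, z, hax, hyz, hs, hay, haz⟩ |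
    ⟨x, l, hax, hxb, hl, hla, hl', hno⟩
  · exact ⟨X.linksAt g, hP, by rwa [hself], fun _ => h, Or.inl rfl⟩
  · have hzy := sym2_mem_swap.1 hyz
    have hxa := sym2_mem_swap.1 hax
    have mx := hP.mem hxa
    have my := hP.mem hyz
    have mz := hP.mem hzy
    have hs' : z + y = 2 • g := by rw [add_comm, hs]
    have nax := hP.ne hax
    have nyz := hP.ne hyz
    have nxy : x ≠ y := by
      rintro rfl; exact haz (hP.unique hxa hyz)
    have nxz : x ≠ z := by
      rintro rfl; exact hay (hP.unique hxa hzy)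
    have hi := eq_sub_of_antipodal ha hg (hin my) (hin mz) (mem_cofaces.1 my).2 hs
    -- The pairs `{a, x}`, `{y, z}` become `{a, y}`, `{x, z}` or `{a, z}`, `{x, y}`.
    have hconn : (X.relink g ((X.linksAt g).image (Sym2.map (Equiv.swap x y)))).IsConn ∨
        (X.relink g ((X.linksAt g).image (Sym2.map (Equiv.swap x z)))).IsConn := by
      refine isConn_relink_or (a := a) (x := x) (y := y) (z := z) hc ha.1 (hin mx) (hin my)
        (hin mz) (fun u v huv => ?_) (mem_image_swap hax nax hay) ?_
        (Or.inr ⟨?_, mem_image_swap hax nax haz⟩)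
      · have hvu := sym2_mem_swap.1 huv
        by_cases hux : u = x
        · subst hux; left; rw [hP.unique huv hxa, Sym2.eq_swap]
        by_cases huy : u = y
        · subst huy; right; left; rw [hP.unique huv hyz]
        by_cases huz : u = z
        · subst huz; right; left; rw [hP.unique huv hzy, Sym2.eq_swap]
        by_cases hvx : v = x
        · subst hvx; left; rw [hP.unique hvu hxa]
        by_cases hvy : v = y
        · subst hvy; exact absurd (hP.unique hvu hyz) huz
        by_cases hvz : v = z
        · subst hvz; exact absurd (hP.unique hvu hzy) huy
        exact Or.inr (Or.inr ⟨mem_image_swap_of_ne huv hux huy hvx hvy,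
          mem_image_swap_of_ne huv hux huz hvx hvz⟩)
      · rw [Equiv.swap_comm, sym2_mem_swap]
        exact mem_image_swap hyz nyz nxy.symm
      · rw [Equiv.swap_comm, sym2_mem_swap]
        exact mem_image_swap hzy nyz.symm nxz.symm
    rcases hconn with h | h
    · exact ⟨_, hpair mx my, h, fun _ => Osc.of_forall_ne ((hpair mx my).image _)
        (fun u v => add_ne_of_exchange hP hO hbD hax hyz hs hay haz) hg haD',
        Or.inr ⟨h2, hi, x, y, rfl, Or.inl ⟨z, hax, hyz, hs, hay, haz⟩⟩⟩
    · exact ⟨_, hpair mx mz, h, fun _ => Osc.of_forall_ne ((hpair mx mz).image _)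
        (fun u v => add_ne_of_exchange hP hO hbD hax hzy hs' haz hay) hg haD',
        Or.inr ⟨h2, hi, x, z, rfl, Or.inl ⟨y, hax, hzy, hs', haz, hay⟩⟩⟩
  · have hxa := sym2_mem_swap.1 hax
    have mx := hP.mem hxa
    have nax := hP.ne hax
    have nal : a ≠ l := by rintro rfl; exact hl' _ hax
    have nxl : x ≠ l := by rintro rfl; exact hl' _ hxa
    have hi := eq_sub_of_antipodal ha hg (hin hl) ha.1 (mem_cofaces.1 hl).2 hla
    -- The lone face `l` is linked to `a` or to `x`, the other one becoming alone; this is the case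
    -- `y = z` of the exchange argument.
    have hconn : (X.relink g ((X.linksAt g).image (Sym2.map (Equiv.swap x l)))).IsConn ∨
        (X.relink g ((X.linksAt g).image (Sym2.map (Equiv.swap a l)))).IsConn := by
      refine isConn_relink_or (a := a) (x := x) (y := l) (z := l) hc ha.1 (hin mx) (hin hl)
        (hin hl) (fun u v huv => ?_) (mem_image_swap hax nax nal)
        (mem_image_swap hxa nax.symm nxl) (Or.inl rfl)
      have hvu := sym2_mem_swap.1 huv
      by_cases hux : u = x
      · subst hux; left; rw [hP.unique huv hxa, Sym2.eq_swap]
      by_cases hua : u = a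
      · subst hua; left; rw [hP.unique huv hax]
      have hul : u ≠ l := by rintro rfl; exact hl' _ huv
      have hvl : v ≠ l := by rintro rfl; exact hl' _ hvu
      have hvx : v ≠ x := by rintro rfl; exact hua (hP.unique hvu hxa)
      have hva : v ≠ a := by rintro rfl; exact hux (hP.unique hvu hax)
      exact Or.inr (Or.inr ⟨mem_image_swap_of_ne huv hux hul hvx hvl,
        mem_image_swap_of_ne huv hua hul hva hvl⟩)
    rcases hconn with h | h
    · exact ⟨_, hpair mx hl, h, fun _ => Osc.of_forall_ne ((hpair mx hl).image _)
        (fun u v => add_ne_of_move_left hP hab' hbD hax hl hla hl' hno) hg haD',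
        Or.inr ⟨h2, hi, x, l, rfl, Or.inr (Or.inl ⟨hax, hxb, hla, hl'⟩)⟩⟩
    · exact ⟨_, hpair haD hl, h, fun _ => Osc.of_forall_ne ((hpair haD hl).image _)
        (fun u v => add_ne_of_move_right hP hbD hax hl hla hl' hno) hg haD',
        Or.inr ⟨h2, hi, a, l, rfl, Or.inr (Or.inr ⟨rfl, hla, hl'⟩)⟩⟩

/-- Reconnecting at all edges in `s` of the top face. -/
theorem exists_relink_all {X : LinkedFaces d} {a : Cell d} (hX : X.IsPaired) (hc : X.IsConn)
    (ho : X.IsOsculating) (ha : IsTopFace X.faces a) (hv : ¬ a.Vertical) (s : Finset (Cell d))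
    (hs : s ⊆ a.facets) :
    ∃ Y : LinkedFaces d, Y.faces = X.faces ∧ Y.IsPaired ∧ Y.IsConn ∧
      (∀ g ∉ s, Y.linksAt g = X.linksAt g) ∧ ∀ g ∈ s,
      (2 < (cofaces X.faces g).card → Osc g
        ((cofaces X.faces g).image (Equiv.swap a (g + Pi.single 0 1)))
        ((Y.linksAt g).image (Sym2.map (Equiv.swap a (g + Pi.single 0 1))))) ∧
      (Y.linksAt g = X.linksAt g ∨ (2 < (cofaces X.faces g).card ∧
        (∃ i, g = a + Pi.single i (-1)) ∧ Switched g a (X.linksAt g) (Y.linksAt g))) := by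
  induction s using Finset.induction_on with
  | empty => exact ⟨X, rfl, hX, hc, fun _ _ => rfl, by simp⟩
  | insert e s he ih =>
    obtain ⟨Y, h1, h2, h3, h4, h5⟩ := ih fun g hg => hs (mem_insert_of_mem hg)
    have hlinks := h4 e he
    obtain ⟨Q, q1, q2, q3, q4⟩ := exists_relink (g := e) h2 h3 (h1 ▸ ha) hv
      (hs (mem_insert_self _ _)) (by rw [h1, hlinks]; exact ho e)
    rw [h1] at q3 q4
    rw [hlinks] at q4
    refine ⟨Y.relink e Q, h1, h2.relink q1, q2, fun g hg => ?_, fun g hg => ?_⟩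
    · rw [mem_insert, not_or] at hg
      rw [linksAt_relink_of_ne h2 q1 hg.1, h4 g hg.2]
    · by_cases hge : g = e
      · subst hge
        rw [linksAt_relink_self q1]
        exact ⟨q3, q4⟩
      · rw [linksAt_relink_of_ne h2 q1 hge]
        exact h5 g (mem_of_mem_insert_of_ne hg hge)

end LinkedFaces

end

/-! ### Links of a capped manifold and their recovery. -/

section

open Cell

variable {d : ℕ}

theorem Conn.of_eq_or {S : Finset (Cell d)} {R : Cell d → Cell d → Prop}
    (h : Conn S fun y z => y = z ∨ R y z) : Conn S R := fun p hp =>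
  h p fun x hx y hy hxy => hxy.elim (fun e => by rw [e]) (hp x hx y hy)

variable [NeZero d]

namespace LinkedFaces

/-- `C` has the same links as `X` at the edges of `X`, except at those of the top face `a`, where
the bits `ε` tell whether links are switched before `a` is replaced. -/
structure LowLinks (X : LinkedFaces d) (a : Cell d) (ε : Fin d → Bool) (C : LinkedFaces d) :
    Prop where
  keep : ∀ x ∈ X.faces, ∀ g ∈ x.facets, (¬ a.Vertical → g ∉ a.facets) →
    (a.Vertical → g ≠ a + Pi.single 0 1) → C.linksAt g = X.linksAt g
  top : ¬ a.Vertical → ∀ g ∈ a.facets, ∃ Q, IsPairing (cofaces X.faces g) Q ∧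
    C.linksAt g = Q.image (Sym2.map (Equiv.swap a (g + Pi.single 0 1))) ∧
    ((∀ i, g = a + Pi.single i (-1) → ε i = false) → Q = X.linksAt g) ∧
    ∀ i, g = a + Pi.single i (-1) → ε i = true → Switched g a (X.linksAt g) Q

theorem LowLinks.congr {X Y Z : LinkedFaces d} {a : Cell d} {ε : Fin d → Bool}
    (h : LowLinks X a ε Y) (ha : a ∈ X.faces)
    (hZ : ∀ x ∈ X.faces, ∀ g ∈ x.facets, Z.linksAt g = Y.linksAt g) : LowLinks X a ε Z := by
  refine ⟨fun x hx g hg h1 h2 => ?_, fun hv g hg => ?_⟩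
  · rw [hZ x hx g hg, h.keep x hx g hg h1 h2]
  · rw [hZ a ha g hg]; exact h.top hv g hg

theorem card_cofaces_top {A : Finset (Cell d)} {a : Cell d} (ha : IsTopFace A a) :
    (cofaces A (a + Pi.single 0 1)).card ≤ 1 := by
  refine (card_le_card (t := {a}) fun x hx => ?_).trans (card_singleton a).le
  obtain ⟨h1, h2⟩ := mem_cofaces.1 hx
  have h3 := ha.height_le h1
  rw [mem_singleton]
  exact (add_right_cancel (eq_top_of_height h2 (by simp; omega))).symm

/-- Links away from the edges of a horizontal `a` are copied. At an edge of `a`, moving the face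
back gives `Q`, and the bit tells whether an exchange has to be undone. -/
theorem LowLinks.unique {X X' C : LinkedFaces d} {a : Cell d} {ε ε' : Fin d → Bool}
    (hX : X.IsPaired) (hX' : X'.IsPaired) (hf : X.faces = X'.faces) (ha : IsTopFace X.faces a)
    (h : LowLinks X a ε C) (h' : LowLinks X' a ε' C)
    (hε : ¬ a.Vertical → ∀ i, Odd (a i) → ε i = ε' i) : X = X' := by
  refine ext_of_linksAt hX hX' hf fun g => ?_
  rcases le_or_gt (cofaces X.faces g).card 1 with hc | hc
  · rw [hX.linksAt_eq_empty hc, hX'.linksAt_eq_empty (hf ▸ hc)]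
  obtain ⟨x, hx⟩ := card_pos.1 (by omega : 0 < (cofaces X.faces g).card)
  obtain ⟨hx, hg⟩ := mem_cofaces.1 hx
  by_cases hv : a.Vertical
  · have hne : g ≠ a + Pi.single 0 1 := by
      rintro rfl
      have := card_cofaces_top ha
      omega
    rw [← h.keep x hx g hg (fun h => absurd hv h) fun _ => hne,
      ← h'.keep x (hf ▸ hx) g hg (fun h => absurd hv h) fun _ => hne]
  · by_cases hga : g ∈ a.facets
    · obtain ⟨Q, h1, h2, h3, h4⟩ := h.top hv g hga
      obtain ⟨Q', h1', h2', h3', h4'⟩ := h'.top hv g hga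
      have hQ : Q = Q' := by
        rw [← image_swap_image_swap (P := Q) a (g + Pi.single 0 1), ← h2, h2',
          image_swap_image_swap]
      subst hQ
      -- Only bits on the half-integer dimensions of `a` matter, which are the ones stored in the
      -- tube.
      have hodd : ∀ i, g = a + Pi.single i (-1) → Odd (a i) := by
        rintro i rfl
        obtain ⟨j, hj, h5, h6⟩ := mem_facets_iff.1 hga
        have : i = j := by
          by_contra hne
          have := h6 i hne
          simp at this
        exact this ▸ hj
      by_cases hb : ∃ i, g = a + Pi.single i (-1) ∧ ε i = true
      · obtain ⟨i, hi, he⟩ := hb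
        exact Switched.left_unique (hX.pairing g) (hX'.pairing g) h1 (h4 i hi he)
          (h4' i hi (by rw [← hε hv i (hodd i hi), he]))
      · push Not at hb
        have hb' : ∀ i, g = a + Pi.single i (-1) → ε i = false := fun i hi => by
          simpa using hb i hi
        rw [← h3 hb', ← h3' fun i hi => by rw [← hε hv i (hodd i hi), hb' i hi]]
    · rw [← h.keep x hx g hg (fun _ => hga) (fun h => absurd h hv),
        ← h'.keep x (hf ▸ hx) g hg (fun _ => hga) (fun h => absurd h hv)]

/-- The links can have changed only at edges of a horizontal `a`, but there `a` itself is gone, so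
the neighbouring faces are not the same. Above a vertical `a` there was a single face and no link.
-/
theorem LowLinks.linksAt_eq {X C : LinkedFaces d} {a : Cell d} {ε : Fin d → Bool}
    (hX : X.IsPaired) (hC : C.IsPaired) (hb : Bottom X.faces a C.faces) (h : LowLinks X a ε C)
    {g : Cell d} (hg : cofaces C.faces g = cofaces X.faces g) : C.linksAt g = X.linksAt g := by
  rcases le_or_gt (cofaces X.faces g).card 1 with hc | hc
  · rw [hX.linksAt_eq_empty hc, hC.linksAt_eq_empty (hg ▸ hc)]
  obtain ⟨x, hx⟩ := card_pos.1 (by omega : 0 < (cofaces X.faces g).card)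
  obtain ⟨hx, hgx⟩ := mem_cofaces.1 hx
  refine h.keep x hx g hgx (fun hv hga => ?_) (fun hv => ?_)
  · have h1 : a ∈ cofaces C.faces g := hg ▸ mem_cofaces.2 ⟨hb.top.1, hga⟩
    have := (hb.horizontal hv).2.1 a (mem_cofaces.1 h1).1 (by simp)
    omega
  · rintro rfl
    have := card_cofaces_top hb.top
    omega

theorem image_image_swap (σ : Equiv.Perm (Cell d)) (P : Finset (Sym2 (Cell d))) (x y : Cell d) :
    (P.image (Sym2.map (Equiv.swap x y))).image (Sym2.map σ) =
      (P.image (Sym2.map σ)).image (Sym2.map (Equiv.swap (σ x) (σ y))) := by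
  have h : σ ∘ Equiv.swap x y = Equiv.swap (σ x) (σ y) ∘ σ := by
    ext1 z
    simp only [Function.comp_apply]
    rw [Equiv.swap_apply_apply]
    simp [Equiv.Perm.mul_apply]
  rw [image_image, image_image, ← Sym2.map_comp, ← Sym2.map_comp, h]

theorem Switched.translate {g a : Cell d} {P Q : Finset (Sym2 (Cell d))} (h : Switched g a P Q)
    (w : Fin d → ℤ) : Switched (affine 1 w g) (affine 1 w a)
      (P.image (Sym2.map (affine 1 w))) (Q.image (Sym2.map (affine 1 w))) := by
  have hno : ∀ {y}, (∀ z, s(y, z) ∉ P) →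
      ∀ z, s(affine 1 w y, z) ∉ P.image (Sym2.map (affine 1 w)) := by
    intro y h z
    obtain ⟨z, rfl⟩ := (affine 1 w).surjective z
    rw [mem_image_sym2_map]; exact h z
  obtain ⟨x, y, rfl, h⟩ := h
  refine ⟨affine 1 w x, affine 1 w y, image_image_swap _ _ _ _, ?_⟩
  rcases h with ⟨z, h1, h2, h3, h4, h5⟩ | ⟨h1, h2, h3, h4⟩ | ⟨h1, h2, h3⟩
  · exact Or.inl ⟨affine 1 w z, (mem_image_sym2_map _).2 h1, (mem_image_sym2_map _).2 h2,
      affine_add_affine.2 h3, (affine 1 w).injective.ne h4, (affine 1 w).injective.ne h5⟩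
  · refine Or.inr (Or.inl ⟨(mem_image_sym2_map _).2 h1, ?_, affine_add_affine.2 h3, hno h4⟩)
    have := affine_add_affine (u := 1) (w := w).2 h2
    rwa [affine_one_add] at this
  · exact Or.inr (Or.inr ⟨by rw [h1], affine_add_affine.2 h2, hno h3⟩)

theorem LowLinks.translate {X C : LinkedFaces d} {a : Cell d} {ε : Fin d → Bool}
    (h : LowLinks X a ε C) (w : Fin d → ℤ) :
    LowLinks (X.map 1 w) (affine 1 w a) ε (C.map 1 w) := by
  have hg : ∀ (g : Cell d) i, affine 1 w g = affine 1 w a + Pi.single i (-1) ↔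
      g = a + Pi.single i (-1) := by
    intro g i
    rw [← affine_one_add, (affine 1 w).injective.eq_iff]
  constructor
  · intro x hx g hgx h1 h2
    obtain ⟨x, rfl⟩ := (affine 1 w).surjective x
    obtain ⟨g, rfl⟩ := (affine 1 w).surjective g
    rw [vertical_affine, affine_mem_facets] at h1
    rw [vertical_affine, ← affine_one_add, (affine 1 w).injective.ne_iff] at h2
    rw [affine_mem_facets] at hgx
    rw [linksAt_map, linksAt_map, h.keep x ((mem_image_affine 1 w).1 hx) g hgx h1 h2]
  · intro hv g hga
    rw [vertical_affine] at hv
    obtain ⟨g, rfl⟩ := (affine 1 w).surjective g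
    rw [affine_mem_facets] at hga
    obtain ⟨Q, q1, q2, q3, q4⟩ := h.top hv g hga
    refine ⟨Q.image (Sym2.map (affine 1 w)), ?_, ?_, fun hb => ?_, fun i hi hb => ?_⟩
    · rw [cofaces_map]; exact q1.image _
    · rw [linksAt_map, q2, ← affine_one_add, image_image_swap]
    · rw [linksAt_map, q3 fun i hi => hb i ((hg g i).2 hi)]
    · rw [linksAt_map]
      exact Switched.translate (q4 i ((hg g i).1 hi) hb) w

/-- `Y` is obtained from `X` with top face `a` by adding `low k a`. -/
structure LowPart (k : ℕ) (X : LinkedFaces d) (a : Cell d) (ε : Fin d → Bool)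
    (Y : LinkedFaces d) : Prop where
  faces : Y.faces = symmDiff X.faces (low k a)
  paired : Y.IsPaired
  osculating : Y.IsOsculating
  conn : Y.IsConn
  links : LowLinks X a ε Y

theorem low_translate (k : ℕ) (v : Fin d → ℤ) (a : Cell d) :
    low k (affine 1 v a) = (low k a).image (affine 1 v) := by
  by_cases hv : a.Vertical
  · rw [low_of_vertical hv, low_of_vertical ((vertical_affine).2 hv), lowLid_translate, image_insert,
      stack, stack, image_image]
    congr 1
    refine image_congr fun t _ => ?_
    simp only [Function.comp_apply, affine_one_add]
  · rw [low_of_horizontal hv, low_of_horizontal (fun h => hv ((vertical_affine).1 h)),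
      ← affine_one_add, facets_image]

theorem LowPart.translate {k : ℕ} {X Y : LinkedFaces d} {a : Cell d} {ε : Fin d → Bool}
    (h : LowPart k X a ε Y) (w : Fin d → ℤ) :
    LowPart k (X.map 1 w) (affine 1 w a) ε (Y.map 1 w) := by
  refine ⟨?_, h.paired.map 1 w, h.osculating.map 1 w, h.conn.map 1 w, h.links.translate w⟩
  change Y.faces.image _ = symmDiff (X.faces.image _) _
  rw [h.faces, low_translate, image_symmDiff _ _ (affine 1 w).injective]

/-- Edges of `A` remain edges of the capped set and stay below its lid, so the bridge does not
affect the links at them. -/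
theorem low_edge {k : ℕ} (hk : 1 < k) (hkd : k < d) {A : Finset (Cell d)} {a : Cell d}
    (ha : IsTopFace A a) (hd : a.dim = k) {x g : Cell d} (hx : x ∈ A) (hg : g ∈ x.facets) :
    (∃ y ∈ symmDiff A (low k a), g ∈ y.facets) ∧ g ∉ (lowLid k a).facets := by
  have h1 := ha.height_le hx
  have h2 := height_bounds hg
  by_cases hv : a.Vertical
  · obtain ⟨-, hL, -, he, hh⟩ := low_induction hk hkd ha hv hd (fun _ _ => True) trivial
      (fun _ _ _ _ _ _ _ _ _ _ => trivial)
    refine ⟨⟨x, by rw [he]; exact mem_union_left _ hx, hg⟩, fun hgl => ?_⟩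
    have h3 := hh (lowLid k a) (by rw [low_of_vertical hv]; simp)
    have h4 := height_eq_of_even hgl hL.even
    omega
  · obtain ⟨hJ, hL, -, -, -, hh⟩ := low_joinable (k := k) ha hv hd
    constructor
    · have hpos : 0 < (cofaces (joinFaces A (low k a) a) g).card := by
        by_cases hga : g ∈ a.facets
        · rw [hJ.card_cofaces_of_mem hga]
          exact card_pos.2 ⟨x, mem_cofaces.2 ⟨hx, hg⟩⟩
        · rw [hJ.cofaces_of_left hx hg hga]
          exact card_pos.2 ⟨x, mem_cofaces.2 ⟨hx, hg⟩⟩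
      obtain ⟨y, hy⟩ := card_pos.1 hpos
      rw [hJ.joinFaces_eq] at hy
      exact ⟨y, mem_cofaces.1 hy⟩
    · intro hgl
      have h3 : lowLid k a 0 = a 0 + 2 := by rw [lowLid, if_neg hv]; simp
      have h4 := height_eq_of_even hgl hL.even
      have := hh x hx g hg
      omega

open Classical in
theorem exists_lowPart {k : ℕ} (hk : 1 < k) (hkd : k < d) {X : LinkedFaces d} {a : Cell d}
    (hX : X.IsPaired) (ho : X.IsOsculating) (hc : X.IsConn) (ha : IsTopFace X.faces a)
    (hd : a.dim = k) : ∃ ε Y, LowPart k X a ε Y ∧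
      ((∀ g, (cofaces X.faces g).card ≤ 2) → ε = fun _ => false) := by
  by_cases hv : a.Vertical
  · obtain ⟨⟨Y, h1, h2, h3, h4, h5⟩, -⟩ := low_induction hk hkd ha hv hd
      (fun S _ => ∃ Y : LinkedFaces d, Y.faces = S ∧ Y.IsPaired ∧ Y.IsOsculating ∧ Y.IsConn ∧
        ∀ x ∈ X.faces, ∀ g ∈ x.facets, g ≠ a + Pi.single 0 1 → Y.linksAt g = X.linksAt g)
      ⟨X, rfl, hX, ho, hc, fun _ _ _ _ _ => rfl⟩ (by
        rintro S f g c t hat hsub - hga ⟨Y, rfl, h2, h3, h4, h5⟩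
        refine ⟨Y.attach f c, rfl, isPaired_attach h2 hat, isOsculating_attach h3 hat,
          isConn_attach h4 hat, fun x hx e he hne => ?_⟩
        have heg : e ≠ g := by rintro rfl; exact hne (hga x hx he)
        rw [linksAt_attach_of_ne hat heg, h5 x hx e he hne])
    exact ⟨fun _ => false, Y, ⟨h1, h2, h3, h4, fun x hx g hg _ h => h5 x hx g hg (h hv),
      fun h => absurd hv h⟩, fun _ => rfl⟩
  · obtain ⟨W, w1, w2, w3, w4, w5⟩ := exists_relink_all hX hc ho ha hv a.facets subset_rfl
    obtain ⟨hJ, hL, -, hQ, hh, -⟩ := low_joinable (k := k) ha hv hd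
    have hS := isSAM_facets hk.le hQ
    rw [← low_of_horizontal (k := k) hv] at hS
    set U : LinkedFaces d := full (low k a) with hU
    have hUp : U.IsPaired := isPaired_full hS.selfAvoiding
    have hUo : U.IsOsculating := fun g hg => absurd (hS.selfAvoiding g) (not_le.2 hg)
    have hJ' : Joinable W.faces U.faces a := by rw [w1]; exact hJ
    -- The face that replaces `a` at its edge `g` is the side of the cube standing on `g`; this is
    -- the position `b` prepared by the relinking.
    have hu : ∀ g ∈ a.facets, g + Pi.single 0 1 ≠ a ∧
        cofaces U.faces g = {a, g + Pi.single 0 1} := by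
      intro g hg
      have hg0 := height_eq_of_even hg (Int.not_odd_iff_even.1 hv)
      have hne : g + Pi.single 0 1 ≠ a := fun e => by
        have := congrFun e 0
        simp at this
        omega
      obtain ⟨u, h1, h2⟩ := hJ'.thin g hg
      have hm : g + Pi.single 0 1 ∈ cofaces U.faces g := by
        rw [mem_cofaces]
        constructor
        · change _ ∈ low k a
          rw [low_of_horizontal hv]
          obtain ⟨j, s, hj, hs, rfl⟩ := exists_of_mem_facets hg
          have hj0 : j ≠ 0 := by rintro rfl; exact hv hj
          rw [add_right_comm]
          exact side_mem hj0 hj hs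
        · have : g = g + Pi.single 0 1 + Pi.single 0 (-1) := by
            rw [add_assoc, ← Pi.single_add, add_neg_cancel, Pi.single_zero, add_zero]
          have ho : Odd ((g + Pi.single 0 1 : Cell d) 0) := by
            simp only [Pi.add_apply, Pi.single_eq_same, hg0]
            exact (Int.not_odd_iff_even.1 hv).add_one
          have hm := add_single_mem_facets ho (Or.inr rfl)
          rwa [← this] at hm
      rw [h2, mem_insert, mem_singleton, or_iff_right hne] at hm
      rw [hm]; exact ⟨h1, h2⟩
    set ε : Fin d → Bool := fun i =>
      decide (W.linksAt (a + Pi.single i (-1)) ≠ X.linksAt (a + Pi.single i (-1)))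
    have hε : ∀ i, ε i =
      decide (W.linksAt (a + Pi.single i (-1)) ≠ X.linksAt (a + Pi.single i (-1))) := fun _ => rfl
    have hkeep : ∀ x ∈ X.faces, ∀ g ∈ x.facets, g ∉ a.facets →
        (join W U a).linksAt g = X.linksAt g := by
      intro x hx g hg hga
      rw [linksAt_join_left hJ' hUp (w1 ▸ hx) hg hga, w4 g hga]
    have htop : ∀ g ∈ a.facets, (join W U a).linksAt g =
        (W.linksAt g).image (Sym2.map (Equiv.swap a (g + Pi.single 0 1))) := fun g hg =>
      linksAt_join_of_mem hJ' w2 hUp hg (hu g hg).1 (hu g hg).2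
    refine ⟨ε, join W U a, ⟨?_, isPaired_join hJ' w2 hUp, ?_, ?_, ?_⟩, fun hsam => ?_⟩
    · change joinFaces W.faces U.faces a = _
      rw [hJ'.joinFaces_eq, w1]; rfl
    · refine isOsculating_join hJ' w2 hUp (fun g hg hg2 => ?_) hUo fun g hg hg2 u hu1 hu2 => ?_
      · rw [w4 g hg, w1]; exact ho g (w1 ▸ hg2)
      · have : u = g + Pi.single 0 1 := by
          have h1 : u ∈ cofaces U.faces g := by rw [hu2]; simp
          rw [(hu g hg).2, mem_insert, mem_singleton] at h1
          exact h1.resolve_left hu1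
        rw [this, w1]
        exact (w5 g hg).1 (w1 ▸ hg2)
    · have hmem : a ∈ low k a := hJ.mem_right
      rw [low_of_horizontal hv] at hmem
      obtain ⟨j, s, hj, hs, hg⟩ := exists_of_mem_facets hmem
      have hop : a + Pi.single 0 1 + Pi.single j (-s) ∈ (low k a).erase a := by
        rw [mem_erase, low_of_horizontal hv]
        refine ⟨fun he => ?_, add_single_mem_facets hj (by omega)⟩
        have h1 := congrFun hg j
        have h2 := congrFun he j
        rw [Pi.add_apply, Pi.single_eq_same] at h1 h2
        omega
      have hcU : Conn ((low k a).erase a) ShareFacet := Conn.of_hub hop fun x hx => by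
        rw [mem_erase, low_of_horizontal hv] at hx
        exact eq_or_shareFacet_opposite hj hs hx.2 (hg ▸ hx.1)
      refine Conn.of_eq_or ?_
      refine Conn.glue (S := W.faces) (W := (low k a).erase a) w3 hcU hJ'.mem_left ⟨_, hop⟩ ?_ ?_ ?_
      · intro x hx y hy hxy
        exact Or.inr (mem_links_join_of_left (mem_erase.1 hx).1 (mem_erase.1 hy).1 hxy)
      · intro x hx y hy hxy
        rw [mem_erase] at hx hy
        refine or_iff_not_imp_left.2 fun hne => mem_links_join_of_right hx.1 hy.1 ?_
        exact mem_links_full.2 ⟨hx.2, hy.2, hne, hxy⟩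
      · intro x _ hxa
        have hxa : s(x, a) ∈ W.links := hxa.elim id sym2_mem_swap.1
        obtain ⟨g, u, -, h2, h3, -, h5⟩ := exists_mem_links_join hJ' w2 hxa
        exact ⟨u, mem_erase.2 ⟨h2, h3⟩, Or.inr h5⟩
    · refine ⟨fun x hx g hg hga _ => hkeep x hx g hg (hga hv), fun _ g hg => ?_⟩
      refine ⟨W.linksAt g, w1 ▸ w2.pairing g, htop g hg, fun hb => ?_, fun i hi hb => ?_⟩
      · rcases (w5 g hg).2 with h | ⟨-, ⟨i, hi⟩, -⟩
        · exact h
        · have := hb i hi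
          rw [hε, ← hi] at this
          simpa using this
      · rcases (w5 g hg).2 with h | ⟨-, -, h⟩
        · rw [hε, ← hi] at hb
          simp [h] at hb
        · exact h
    -- Exchanges take place only at edges with more than two faces, so a self-avoiding set has all
    -- bits zero.
    · ext1 i
      rw [hε]
      simp only [ne_eq, decide_eq_false_iff_not, not_not]
      by_cases hg : a + Pi.single i (-1) ∈ a.facets
      · rcases (w5 _ hg).2 with h | ⟨h, -⟩
        · exact h
        · exact absurd (hsam _) (not_le.2 h)
      · exact w4 _ hg

end LinkedFaces

end

/-! ### Joining linked manifolds. -/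

section

open Cell

variable {d : ℕ} [NeZero d]

namespace LinkedFaces

/-- At the edges of a lid there are at most two faces, the lid and the one below or above the edge.
Hence gluing in the tube cannot violate the osculating condition, and no further exchanges are
needed. -/
theorem exists_linked_bridge {k : ℕ} {Y₁ Y₂ : LinkedFaces d} {l x l' : Cell d}
    {K : Finset (Cell d)} (h : Bridge k Y₁.faces l K x Y₂.faces l') (hk : 1 < k) (hd : l.dim = k)
    (h₁ : Y₁.IsPaired) (o₁ : Y₁.IsOsculating) (c₁ : Y₁.IsConn)
    (h₂ : Y₂.IsPaired) (o₂ : Y₂.IsOsculating) (c₂ : Y₂.IsConn) :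
    ∃ Z : LinkedFaces d,
      Z.faces = joinFaces Y₂.faces (joinFaces Y₁.faces (cubeBoundarySum K) l) l' ∧
      Z.IsPaired ∧ Z.IsOsculating ∧ Z.IsConn ∧
      (∀ y ∈ Y₁.faces, ∀ g ∈ y.facets, g ∉ l.facets → Z.linksAt g = Y₁.linksAt g) ∧
      (∀ y ∈ Y₂.faces, ∀ g ∈ y.facets, g ∉ l'.facets → Z.linksAt g = Y₂.linksAt g) := by
  have hl := h.height_lid
  have hS := h.tube.sam.selfAvoiding
  set T : LinkedFaces d := full (cubeBoundarySum K) with hT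
  have hTp : T.IsPaired := isPaired_full hS
  have hTo : T.IsOsculating := fun g hg => absurd (hS g) (not_le.2 hg)
  have hJ : Joinable Y₁.faces T.faces l := h.joinable_lower
  set U := join Y₁ T l with hU
  have hUp : U.IsPaired := isPaired_join hJ h₁ hTp
  have hUo : U.IsOsculating := isOsculating_join hJ h₁ hTp (fun g _ => o₁ g) hTo
    fun g hg hg2 => absurd (h.lower.card_cofaces_le hg) (not_le.2 hg2)
  have hJ' : Joinable Y₂.faces U.faces l' := h.joinable_upper
  have hup : ∀ g ∈ l'.facets, (cofaces Y₂.faces g).card ≤ 2 := by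
    intro g hg
    have := h.upper.card_cofaces_le (neg_mem_facets.2 hg)
    rwa [← affine_neg g, mirror, card_cofaces_image] at this
  have hne1 : ∀ y ∈ Y₁.faces.erase l, y ≠ l ∧ y ≠ l' ∧ y ∈ Y₁.faces := by
    intro y hy
    rw [mem_erase] at hy
    refine ⟨hy.1, ?_, hy.2⟩
    rintro rfl
    have := h.lower.lt _ hy.2 hy.1
    omega
  refine ⟨join Y₂ U l', rfl, isPaired_join hJ' h₂ hUp, isOsculating_join hJ' h₂ hUp
    (fun g _ => o₂ g) hUo fun g hg hg2 => absurd (hup g hg) (not_le.2 hg2), ?_, ?_, ?_⟩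
  · refine Conn.of_eq_or (h.conn c₁ c₂ ?_ ?_ ?_ ?_ ?_ (h.nonempty_tube hd hk))
    · intro y hy z hz hyz
      obtain ⟨a1, a2, -⟩ := hne1 y hy
      obtain ⟨b1, b2, -⟩ := hne1 z hz
      exact Or.inr (mem_links_join_of_right a2 b2 (mem_links_join_of_left a1 b1 hyz))
    · intro y hy z hz hyz
      rw [mem_erase] at hy hz
      exact Or.inr (mem_links_join_of_left hy.1 hz.1 hyz)
    · intro y hy z hz hyz
      simp only [mem_erase] at hy hz
      refine or_iff_not_imp_left.2 fun hne => mem_links_join_of_right hy.1 hz.1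
        (mem_links_join_of_right hy.2.1 hz.2.1 (mem_links_full.2 ⟨hy.2.2, hz.2.2, hne, hyz⟩))
    · intro y hy hyl
      have hyl : s(y, l) ∈ Y₁.links := hyl.elim id sym2_mem_swap.1
      obtain ⟨g, u, hg, hu, huT, hgu, hl'⟩ := exists_mem_links_join hJ h₁ hyl
      have hul : u ≠ l' := by
        rintro rfl
        have := height_eq_of_even hg h.lower.even
        have := height_eq_of_even hgu h.even_lid
        omega
      refine ⟨u, mem_erase.2 ⟨hul, mem_erase.2 ⟨hu, huT⟩⟩, Or.inr ?_⟩
      exact mem_links_join_of_right (hne1 y hy).2.1 hul hl'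
    · intro y hy hyl
      have hyl : s(y, l') ∈ Y₂.links := hyl.elim id sym2_mem_swap.1
      obtain ⟨g, u, hg, hu, huU, hgu, hl'⟩ := exists_mem_links_join hJ' h₂ hyl
      refine ⟨u, mem_erase.2 ⟨hu, ?_⟩, Or.inr hl'⟩
      rcases (mem_joinFaces.1 huU) with ⟨hul, huA | huT⟩
      · have := h.lower.edge_height huA hgu
        have := height_eq_of_even hg h.even_lid
        omega
      · exact mem_erase.2 ⟨hul, huT⟩
  · intro y hy g hg hgl
    have hg1 := h.lower.edge_height hy hg
    have hgl' : g ∉ l'.facets := fun hm => by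
      have := height_eq_of_even hm h.even_lid
      omega
    have hpos : 0 < (cofaces U.faces g).card := by
      change 0 < (cofaces (joinFaces Y₁.faces T.faces l) g).card
      rw [hJ.cofaces_of_left hy hg hgl]
      exact card_pos.2 ⟨y, mem_cofaces.2 ⟨hy, hg⟩⟩
    obtain ⟨z, hz⟩ := card_pos.1 hpos
    obtain ⟨hz, hgz⟩ := mem_cofaces.1 hz
    rw [linksAt_join_right hJ' h₂ hz hgz hgl', linksAt_join_left hJ hTp hy hg hgl]
  · intro y hy g hg hgl
    exact linksAt_join_left hJ' hUp hy hg hgl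

/-- `C` is the join of `A` and `B` by a tube that encodes the changed links. -/
structure LinkJoin (k : ℕ) (ε δ : Fin d → Bool) (A B C : LinkedFaces d) (a b : Cell d)
    (K : Finset (Cell d)) (x : Cell d) : Prop where
  join : FaceJoin k ε δ A.faces B.faces C.faces a b K x
  lower : LowLinks A a ε C
  upper : LowLinks (B.map (-1) 0) (-b) δ (C.map (-1) 0)
  bits_lower : (∀ g, (cofaces A.faces g).card ≤ 2) → ε = fun _ => false
  bits_upper : (∀ g, (cofaces B.faces g).card ≤ 2) → δ = fun _ => false

theorem map_neg_map_neg (X : LinkedFaces d) : (X.map (-1) 0).map (-1) 0 = X := by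
  have h : (affine (-1) 0 : Cell d → Cell d) ∘ affine (-1) 0 = id := by
    ext1 c; simp [affine_neg]
  ext1
  · simp only [map, image_image, h, image_id]
  · simp only [map, image_image, ← Sym2.map_comp, h, Sym2.map_id, image_id]

theorem map_one_map_neg (X : LinkedFaces d) (w : Fin d → ℤ) :
    (X.map 1 w).map (-1) 0 = (X.map (-1) 0).map 1 (-w) := by
  have h : (affine (-1) 0 : Cell d → Cell d) ∘ affine 1 w =
      (affine 1 (-w) : Cell d → Cell d) ∘ affine (-1) 0 := by
    ext c i; simp [affine_apply]; ring
  ext1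
  · simp only [map, image_image, h]
  · simp only [map, image_image, ← Sym2.map_comp, h]

theorem exists_linkJoin {k n m : ℕ} (hk : 1 < k) (hkd : k < d) {A B : LinkedFaces d}
    (hA : A.IsSOM k n) (hB : B.IsSOM k m) : ∃ ε δ v w C a b K x,
      LinkJoin k ε δ (A.map 1 v) (B.map 1 w) C a b K x ∧ C.IsSOM k (n + m + extraFaces k) := by
  obtain ⟨xA, pA, oA, cA⟩ := isSOM_iff.1 hA
  obtain ⟨xB, pB, oB, cB⟩ := isSOM_iff.1 hB
  obtain ⟨xM, pM, oM, cM⟩ := isSOM_iff.1 (hB.map (-1) 0)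
  obtain ⟨a₀, ha₀⟩ := exists_isTopFace xA.connected.1
  obtain ⟨b₀, hb₀⟩ := exists_isTopFace xM.connected.1
  obtain ⟨ε, Y₁, hY₁, hε⟩ := exists_lowPart hk hkd pA oA cA ha₀ (xA.dim_eq a₀ ha₀.1)
  obtain ⟨δ, Y₂, hY₂, hδ⟩ := exists_lowPart hk hkd pM oM cM hb₀ (xM.dim_eq b₀ hb₀.1)
  -- The bits are known before the tube is chosen. The caps were built on untranslated
  -- representatives and are moved into place afterwards.
  obtain ⟨v, w, C, a, b, K, x, h⟩ := exists_faceJoin hk hkd xA.connected.1 xB.connected.1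
    xA.dim_eq xB.dim_eq ε δ
  have xA' := xA.image 1 v
  have xB' := xB.image 1 w
  have hda := xA'.dim_eq a h.top.1
  have hdb := xB'.dim_eq b h.mem_bot
  have ha : affine 1 v a₀ = a := (isTopFace_translate ha₀ v).unique h.top
  have hb : affine 1 (-w) b₀ = -b :=
    (isTopFace_translate hb₀ (-w)).unique (mirror_translate B.faces w ▸ h.bot)
  have hY₁' := hY₁.translate v
  have hY₂' := hY₂.translate (-w)
  rw [ha] at hY₁'
  rw [hb, ← map_one_map_neg] at hY₂'
  set Z₁ := Y₁.map 1 v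
  set Z₂ := Y₂.map 1 (-w)
  have hbr := h.bridge hk hkd hda hdb
  have f₁ : Z₁.faces = symmDiff (A.faces.image (affine 1 v)) (low k a) := hY₁'.faces
  have f₂ : (Z₂.map (-1) 0).faces =
      symmDiff (B.faces.image (affine 1 w)) (mirror (low k (-b))) := by
    change mirror Z₂.faces = _
    rw [hY₂'.faces, mirror_symmDiff]
    congr 1
    exact mirror_mirror _
  rw [← f₁, ← f₂] at hbr
  obtain ⟨Z, z1, z2, z3, z4, z5, z6⟩ := exists_linked_bridge hbr hk
    (lidded_low hk hkd h.top hda).2 hY₁'.paired hY₁'.osculating hY₁'.conn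
    (hY₂'.paired.map _ _) (hY₂'.osculating.map _ _) (hY₂'.conn.map _ _)
  have hZ : Z.faces = C := by
    rw [z1, f₁, f₂, h.eq_joinFaces hk hkd hda hdb]
  subst hZ
  refine ⟨ε, δ, v, w, Z, a, b, K, x, ⟨h, ?_, ?_, fun hs => hε fun g => ?_, fun hs => hδ fun g => ?_⟩,
    isSOM_iff.2 ⟨h.isXD hk hkd xA' xB', z2, z3, z4⟩⟩
  · refine hY₁'.links.congr h.top.1 fun y hy g hg => ?_
    obtain ⟨⟨y', hy', hgy'⟩, hgl⟩ := low_edge hk hkd h.top hda hy hg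
    exact z5 y' (f₁ ▸ hy') g hgy' hgl
  · refine hY₂'.links.congr h.bot.1 fun y hy g hg => ?_
    obtain ⟨⟨y', hy', hgy'⟩, hgl⟩ := low_edge hk hkd h.bot (by rw [dim_neg, hdb]) hy hg
    obtain ⟨g, rfl⟩ := (affine (-1) 0).surjective g
    rw [affine_neg] at hgl hgy'
    have hm : -y' ∈ (Z₂.map (-1) 0).faces := by
      change -y' ∈ mirror Z₂.faces
      rw [neg_mem_mirror, hY₂'.faces]; exact hy'
    have := z6 (-y') hm g (by rw [← neg_mem_facets, neg_neg]; exact hgy')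
      (fun hc => hgl (by rw [← neg_mem_facets, neg_neg]; exact hc))
    rw [linksAt_map, this, ← linksAt_map, map_neg_map_neg]
  · have := hs (affine 1 v g)
    rwa [cofaces_map, card_image_of_injective _ (affine 1 v).injective] at this
  · have := hs (affine 1 w (affine (-1) 0 g))
    rw [cofaces_map, card_image_of_injective _ (affine 1 w).injective] at this
    have e : g = affine (-1) 0 (affine (-1) 0 g) := by simp [affine_neg]
    rw [e, cofaces_map, card_image_of_injective _ (affine (-1) 0).injective]
    exact this

namespace LinkJoin

variable {k n m : ℕ} {ε δ ε' δ' : Fin d → Bool} {A B C A' B' C' : LinkedFaces d}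
  {a b x a' b' x' : Cell d} {K K' : Finset (Cell d)}

theorem halfInt_lowLid {a : Cell d} (hv : ¬ a.Vertical) : (lowLid k a).halfInt = a.halfInt := by
  ext i
  rw [lowLid, if_neg hv, mem_halfInt, mem_halfInt, Pi.add_apply]
  rcases eq_or_ne i 0 with rfl | hi
  · simp
  · simp [hi]

theorem decode {v : Fin d → ℤ} (hk : 1 < k) (hkd : k < d) (h : LinkJoin k ε δ A B C a b K x)
    (h' : LinkJoin k ε' δ' A' B' (C.map 1 v) a' b' K' x') (hA : A.IsSOM k n) (hB : B.IsSOM k m)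
    (hA' : A'.IsSOM k n) (hB' : B'.IsSOM k m) : A = A' ∧ B = B' := by
  obtain ⟨xA, pA, -⟩ := isSOM_iff.1 hA
  obtain ⟨xB, pB, -⟩ := isSOM_iff.1 hB
  obtain ⟨xA', pA', -⟩ := isSOM_iff.1 hA'
  obtain ⟨xB', pB', -⟩ := isSOM_iff.1 hB'
  obtain ⟨rfl, h1, h2, rfl, rfl, h3, h4⟩ := h.join.decode hk hkd h'.join (xA.dim_eq a h.join.top.1)
    (xB.dim_eq b h.join.mem_bot) (xA'.dim_eq a' h'.join.top.1) (xB'.dim_eq b' h'.join.mem_bot)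
    (xA.card_eq.trans xA'.card_eq.symm) (xB.card_eq.trans xB'.card_eq.symm)
  rw [map_one_zero] at h'
  constructor
  · refine h.lower.unique pA pA' h1 h.join.top h'.lower fun hv i hi => h3 i ?_
    rw [halfInt_lowLid hv]; exact mem_halfInt.2 hi
  · have := h.upper.unique (pB.map _ _) (pB'.map _ _) (congrArg mirror h2) h.join.bot h'.upper
      fun hv i hi => h4 i (by rw [halfInt_lowLid hv]; exact mem_halfInt.2 hi)
    rw [← map_neg_map_neg B, this, map_neg_map_neg]

theorem linksAt_eq (hk : 1 < k) (hkd : k < d) (h : LinkJoin k ε δ A B C a b K x)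
    (hA : A.IsSOM k n) (hB : B.IsSOM k m) (hC : C.IsPaired) :
    (∀ g, cofaces C.faces g = cofaces A.faces g → C.linksAt g = A.linksAt g) ∧
      ∀ g, cofaces C.faces g = cofaces B.faces g → C.linksAt g = B.linksAt g := by
  obtain ⟨xA, pA, -⟩ := isSOM_iff.1 hA
  obtain ⟨xB, pB, -⟩ := isSOM_iff.1 hB
  have hda := xA.dim_eq a h.join.top.1
  have hdb := xB.dim_eq b h.join.mem_bot
  refine ⟨fun g hg => h.lower.linksAt_eq pA hC (h.join.bottom hk hkd hda hdb) hg, fun g hg => ?_⟩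
  have := h.upper.linksAt_eq (pB.map _ _) (hC.map _ _) (h.join.bottom_mirror hk hkd hda hdb)
    (g := affine (-1) 0 g) (by rw [cofaces_map, cofaces_map, hg])
  rw [linksAt_map, linksAt_map] at this
  exact image_injective (Sym2.map.injective (affine (-1) 0).injective) this

end LinkJoin

end LinkedFaces

open LinkedFaces

theorem linkedClass_eq_iff {A B : LinkedFaces d} :
    (⟦A⟧ : LinkedClass d) = ⟦B⟧ ↔ ∃ v, B = A.map 1 v := by
  rw [Quotient.eq]
  simp only [map_one]
  rfl

theorem isSOM_of_mem {k n : ℕ} {A : LinkedFaces d} (h : (⟦A⟧ : LinkedClass d) ∈ SOM d k n) :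
    A.IsSOM k n := by
  obtain ⟨A', e, hA'⟩ := h
  obtain ⟨v, rfl⟩ := linkedClass_eq_iff.1 e.symm
  exact hA'.map 1 v

/-- `Z` is the join of `X` and `Y`. -/
def LinkedClassJoin (k : ℕ) (X Y Z : LinkedClass d) : Prop :=
  ∃ ε δ A B C a b K x, X = ⟦A⟧ ∧ Y = ⟦B⟧ ∧ Z = ⟦C⟧ ∧ (∃ N, C.IsSOM k N) ∧
    LinkJoin k ε δ A B C a b K x

namespace LinkedClassJoin

variable {k n m : ℕ} {X Y Z X' Y' : LinkedClass d}

theorem exists_of_mem (hk : 1 < k) (hkd : k < d) (hX : X ∈ SOM d k n) (hY : Y ∈ SOM d k m) :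
    ∃ Z, LinkedClassJoin k X Y Z := by
  obtain ⟨A, rfl, hA⟩ := hX
  obtain ⟨B, rfl, hB⟩ := hY
  obtain ⟨ε, δ, v, w, C, a, b, K, x, h, hC⟩ := exists_linkJoin hk hkd hA hB
  exact ⟨⟦C⟧, ε, δ, _, _, C, a, b, K, x, linkedClass_eq_iff.2 ⟨v, rfl⟩,
    linkedClass_eq_iff.2 ⟨w, rfl⟩, rfl, ⟨_, hC⟩, h⟩

theorem mem_SOM (hk : 1 < k) (hkd : k < d) (h : LinkedClassJoin k X Y Z) (hX : X ∈ SOM d k n)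
    (hY : Y ∈ SOM d k m) : Z ∈ SOM d k (n + m + extraFaces k) := by
  obtain ⟨ε, δ, A, B, C, a, b, K, x, rfl, rfl, rfl, ⟨N, hC⟩, h⟩ := h
  have xA := (isSOM_iff.1 (isSOM_of_mem hX)).1
  have xB := (isSOM_iff.1 (isSOM_of_mem hY)).1
  exact ⟨C, rfl, isSOM_iff.2 ⟨h.join.isXD hk hkd xA xB, (isSOM_iff.1 hC).2⟩⟩

theorem injective (hk : 1 < k) (hkd : k < d) (h : LinkedClassJoin k X Y Z)
    (h' : LinkedClassJoin k X' Y' Z) (hX : X ∈ SOM d k n) (hY : Y ∈ SOM d k m)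
    (hX' : X' ∈ SOM d k n) (hY' : Y' ∈ SOM d k m) : X = X' ∧ Y = Y' := by
  obtain ⟨ε, δ, A, B, C, a, b, K, x, rfl, rfl, rfl, -, h⟩ := h
  obtain ⟨ε', δ', A', B', C', a', b', K', x', rfl, rfl, hC, -, h'⟩ := h'
  obtain ⟨v, rfl⟩ := linkedClass_eq_iff.1 hC
  obtain ⟨h1, h2⟩ := h.decode hk hkd h' (isSOM_of_mem hX) (isSOM_of_mem hY) (isSOM_of_mem hX')
    (isSOM_of_mem hY')
  rw [h1, h2]
  exact ⟨rfl, rfl⟩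

theorem isConcatenation (hk : 1 < k) (hkd : k < d) (h : LinkedClassJoin k X Y Z)
    (hX : X ∈ SOM d k n) (hY : Y ∈ SOM d k m) : LinkedClass.IsConcatenation k X Y Z := by
  obtain ⟨ε, δ, A, B, C, a, b, K, x, rfl, rfl, rfl, ⟨N, hC⟩, h⟩ := h
  have hA := isSOM_of_mem hX
  have hB := isSOM_of_mem hY
  obtain ⟨h1, h2⟩ := h.linksAt_eq hk hkd hA hB (isSOM_iff.1 hC).2.1
  exact ⟨A, B, C, rfl, rfl, rfl, h.join.isConcatenation hk hkd
    ((isSOM_iff.1 hA).1.dim_eq a h.join.top.1) ((isSOM_iff.1 hB).1.dim_eq b h.join.mem_bot), h1, h2⟩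

theorem classJoin (h : LinkedClassJoin k X Y Z) (hX : X.faces ∈ SAM d k n)
    (hY : Y.faces ∈ SAM d k m) : ClassJoin k X.faces Y.faces Z.faces := by
  obtain ⟨ε, δ, A, B, C, a, b, K, x, rfl, rfl, rfl, -, h⟩ := h
  have hA := ClassJoin.isSAM_of_mem hX
  have hB := ClassJoin.isSAM_of_mem hY
  have h1 := h.join
  rw [h.bits_lower hA.selfAvoiding, h.bits_upper hB.selfAvoiding] at h1
  exact ⟨A.faces, B.faces, C.faces, a, b, K, x, rfl, rfl, rfl, ⟨n, hA.toIsXD⟩, ⟨m, hB.toIsXD⟩, h1⟩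

end LinkedClassJoin

theorem encard_mul_encard_le {α β γ : Type*} {s : Set α} {t : Set β} {u : Set γ} {F : α × β → γ}
    (h : Set.MapsTo F (s ×ˢ t) u) (hF : Set.InjOn F (s ×ˢ t)) : s.encard * t.encard ≤ u.encard := by
  rw [← Set.encard_prod]
  exact Set.encard_le_encard_of_injOn h hF

end

/-! ### The two maps on translation classes and the inequalities. -/

theorem mainTheorem2 (d k : ℕ) [NeZero d] (hk : 1 < k) (hkd : k < d) :
    (∃ (Φ : FaceClass d × FaceClass d → FaceClass d)
       (Ψ : LinkedClass d × LinkedClass d → LinkedClass d),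
      -- the procedure for self-avoiding manifolds
      (∀ n m h g : ℕ,
        Set.MapsTo Φ (SAMh d k n h ×ˢ SAMh d k m g) (SAMh d k (n + m + extraFaces k) (h + g)) ∧
        Set.InjOn Φ (SAMh d k n h ×ˢ SAMh d k m g)) ∧
      -- the same procedure for polyominoids
      (∀ n m : ℕ,
        Set.MapsTo Φ (XD d k n ×ˢ XD d k m) (XD d k (n + m + extraFaces k)) ∧
        Set.InjOn Φ (XD d k n ×ˢ XD d k m) ∧
        ∀ X ∈ XD d k n, ∀ Y ∈ XD d k m, FaceClass.IsConcatenation k X Y (Φ (X, Y))) ∧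
      -- the procedure for self-osculating manifolds, which agrees with `Φ` where both make sense
      (∀ n m : ℕ,
        Set.MapsTo Ψ (SOM d k n ×ˢ SOM d k m) (SOM d k (n + m + extraFaces k)) ∧
        Set.InjOn Ψ (SOM d k n ×ˢ SOM d k m) ∧
        ∀ X ∈ SOM d k n, ∀ Y ∈ SOM d k m,
          LinkedClass.IsConcatenation k X Y (Ψ (X, Y)) ∧
          (X.faces ∈ SAM d k n → Y.faces ∈ SAM d k m →
            (Ψ (X, Y)).faces = Φ (X.faces, Y.faces)))) ∧
    -- pseudo-superadditivity of the counts
    (∀ n m : ℕ,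
      (∀ h g : ℕ, (SAMh d k n h).encard * (SAMh d k m g).encard ≤
        (SAMh d k (n + m + extraFaces k) (h + g)).encard) ∧
      (SAM d k n).encard * (SAM d k m).encard ≤ (SAM d k (n + m + extraFaces k)).encard ∧
      (SOM d k n).encard * (SOM d k m).encard ≤ (SOM d k (n + m + extraFaces k)).encard ∧
      (XD d k n).encard * (XD d k m).encard ≤ (XD d k (n + m + extraFaces k)).encard) := by
  classical
  -- The default values of both maps are never used on polyominoids and osculating manifolds, for
  -- which joins exist.
  set Φ : FaceClass d × FaceClass d → FaceClass d := fun p =>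
    if h : ∃ Z, ClassJoin k p.1 p.2 Z then h.choose else p.1 with hΦ
  -- A join of linked classes need not be unique. Any choice works, because every join can be
  -- decoded.
  set Ψ : LinkedClass d × LinkedClass d → LinkedClass d := fun p =>
    if h : ∃ Z, LinkedClassJoin k p.1 p.2 Z then h.choose else p.1 with hΨ
  have hΦ' : ∀ {n m : ℕ} {p}, p ∈ XD d k n ×ˢ XD d k m → ClassJoin k p.1 p.2 (Φ p) := by
    intro n m p hp
    have h := ClassJoin.exists_of_mem hk hkd hp.1 hp.2
    simp only [hΦ, dif_pos h]
    exact h.choose_spec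
  have hΨ' : ∀ {n m : ℕ} {p}, p ∈ SOM d k n ×ˢ SOM d k m → LinkedClassJoin k p.1 p.2 (Ψ p) := by
    intro n m p hp
    have h := LinkedClassJoin.exists_of_mem hk hkd hp.1 hp.2
    simp only [hΨ, dif_pos h]
    exact h.choose_spec
  have hinj : ∀ n m : ℕ, Set.InjOn Φ (XD d k n ×ˢ XD d k m) := by
    intro n m p hp q hq he
    obtain ⟨h1, h2⟩ := (hΦ' hp).injective hk hkd (he ▸ hΦ' hq) hp.1 hp.2 hq.1 hq.2
    exact Prod.ext h1 h2
  have hXD : ∀ n m : ℕ, Set.MapsTo Φ (XD d k n ×ˢ XD d k m) (XD d k (n + m + extraFaces k)) :=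
    fun n m p hp => (hΦ' hp).mem_XD hk hkd hp.1 hp.2
  have hsub : ∀ n r, SAMh d k n r ⊆ XD d k n := fun n r =>
    (SAMh_subset d k n r).trans (SAM_subset d k n)
  have hSAMh : ∀ n m h g : ℕ, Set.MapsTo Φ (SAMh d k n h ×ˢ SAMh d k m g)
      (SAMh d k (n + m + extraFaces k) (h + g)) := fun n m h g p hp =>
    (hΦ' ⟨hsub n h hp.1, hsub m g hp.2⟩).mem_SAMh hk hkd hp.1 hp.2
  have hSAMi : ∀ n m h g : ℕ, Set.InjOn Φ (SAMh d k n h ×ˢ SAMh d k m g) := fun n m h g =>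
    (hinj n m).mono (Set.prod_mono (hsub n h) (hsub m g))
  have hSAM : ∀ n m : ℕ, Set.MapsTo Φ (SAM d k n ×ˢ SAM d k m)
      (SAM d k (n + m + extraFaces k)) := fun n m p hp => by
    obtain ⟨r, hr⟩ := mem_SAM_iff.1 hp.1
    obtain ⟨s, hs⟩ := mem_SAM_iff.1 hp.2
    exact mem_SAM_iff.2 ⟨r + s, hSAMh n m r s ⟨hr, hs⟩⟩
  have hSOM : ∀ n m : ℕ, Set.MapsTo Ψ (SOM d k n ×ˢ SOM d k m)
      (SOM d k (n + m + extraFaces k)) := fun n m p hp =>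
    (hΨ' hp).mem_SOM hk hkd hp.1 hp.2
  have hSOMi : ∀ n m : ℕ, Set.InjOn Ψ (SOM d k n ×ˢ SOM d k m) := by
    intro n m p hp q hq he
    obtain ⟨h1, h2⟩ := (hΨ' hp).injective hk hkd (he ▸ hΨ' hq) hp.1 hp.2 hq.1 hq.2
    exact Prod.ext h1 h2
  refine ⟨⟨Φ, Ψ, fun n m h g => ⟨hSAMh n m h g, hSAMi n m h g⟩, fun n m => ⟨hXD n m, hinj n m,
    fun X hX Y hY => (hΦ' (p := (X, Y)) ⟨hX, hY⟩).isConcatenation hk hkd⟩, fun n m =>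
    ⟨hSOM n m, hSOMi n m, fun X hX Y hY => ⟨(hΨ' (p := (X, Y)) ⟨hX, hY⟩).isConcatenation hk hkd
      hX hY, fun h1 h2 => ?_⟩⟩⟩, fun n m => ⟨fun h g => ?_, ?_, ?_, ?_⟩⟩
  -- For self-avoiding arguments all bits vanish, and the join of face classes with zero bits is
  -- unique.
  · exact ((hΨ' (p := (X, Y)) ⟨hX, hY⟩).classJoin h1 h2).unique
      (hΦ' (p := (X.faces, Y.faces)) ⟨SAM_subset d k n h1, SAM_subset d k m h2⟩)
  · exact encard_mul_encard_le (hSAMh n m h g) (hSAMi n m h g)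
  · exact encard_mul_encard_le (hSAM n m)
      ((hinj n m).mono (Set.prod_mono (SAM_subset d k n) (SAM_subset d k m)))
  · exact encard_mul_encard_le (hSOM n m) (hSOMi n m)
  · exact encard_mul_encard_le (hXD n m) (hinj n m)
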